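/- Let $\mathcal M=(M,\cdot,1,\le)$ be a preordered monoid (a monoid with a preorder for which multiplication is monotone in both arguments). **The calculus $\mathrm{GMCC}(\mathcal M)$.** Types are $A,B ::= \mathbf{Unit}\mid\mathbf{Void}\mid A\to B\mid A\times B\mid A+B\mid S_m A$ ($m\in M$). Terms are those of the simply typed $\lambda$-calculus with pairs and projections, the unit element, injections, $\mathbf{case}\ a\ \mathbf{of}\ b_1;b_2$ (with $a:A_1+A_2$ and functions $b_i:A_i\to C$) and $\mathbf{abort}$, together with the following: $\mathbf{ret}\,a:S_1A$ for $a:A$; $\mathbf{extr}\,a:A$ for $a:S_1A$; $\mathbf{lift}^m f:S_mA\to S_mB$ for $f:A\to B$; $\mathbf{join}^{m_1,m_2}a:S_{m_1m_2}A$ for $a:S_{m_1}S_{m_2}A$; $\mathbf{fork}^{m_1,m_2}a:S_{m_1}S_{m_2}A$ for $a:S_{m_1m_2}A$; $\mathbf{up}^{m_1,m_2}a:S_{m_2}A$ for $a:S_{m_1}A$ and $m_1\le m_2$. Provable equality $\equiv$ of terms of the same type in the same context is the congruence generated by the $\beta\eta$-rules for $\to,\times,\mathbf{Unit},+,\mathbf{Void}$;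 the rules $\mathbf{lift}(\lambda x.x)\equiv\lambda x.x$, $\mathbf{lift}(\lambda x.g(f\,x))\equiv\lambda x.(\mathbf{lift}\,g)((\mathbf{lift}\,f)\,x)$, $\mathbf{up}^{m,m}a\equiv a$, $\mathbf{up}^{m_2,m_3}(\mathbf{up}^{m_1,m_2}a)\equiv\mathbf{up}^{m_1,m_3}a$; the naturality rules (in both grades), left and right identity rules and associativity rule for the graded bind $\mathbf{join}((\mathbf{lift}\,f)\,a)$ with unit $\mathbf{ret}$, and their duals for the graded extend $(\mathbf{lift}\,f)(\mathbf{fork}\,a)$ with counit $\mathbf{extr}$; and the rules making $\mathbf{ret},\mathbf{extr}$ mutually inverse and $\mathbf{join},\mathbf{fork}$ mutually inverse. **Models.** Let $\mathbf C(\mathcal M)$ be the thin strict monoidal category given by $\mathcal M$, and for a category $\mathbb D$ with finite products let $\mathbf{End}^s_{\mathbb D}$ be the monoidal category of strong endofunctors of $\mathbb D$ and strong natural transformations, with composition as tensor product. A model is a bicartesian closed category $\mathbb D$ (with specified structure) together with a strong monoidal functor $\mathbf S:\mathbf C(\mathcal M)\to\mathbf{End}^s_{\mathbb D}$; write $\eta,\mu$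 for its structure maps, $\epsilon,\delta$ for their inverses and $t$ for the strengths. Types, contexts and the $\lambda$-calculus are interpreted in the standard way, with $[\![S_mA]\!]=\mathbf S_m[\![A]\!]$, $[\![\emptyset]\!]=\top$, $[\![\Gamma,x:A]\!]=[\![\Gamma]\!]\times[\![A]\!]$, and $[\![\mathbf{ret}\,a]\!]=\eta\circ[\![a]\!]$, $[\![\mathbf{extr}\,a]\!]=\epsilon\circ[\![a]\!]$, $[\![\mathbf{join}\,a]\!]=\mu\circ[\![a]\!]$, $[\![\mathbf{fork}\,a]\!]=\delta\circ[\![a]\!]$, $[\![\mathbf{up}^{m_1,m_2}a]\!]=\mathbf S^{m_1\le m_2}\circ[\![a]\!]$, $[\![\mathbf{lift}^mf]\!]=\Lambda(\mathbf S_m(\Lambda^{-1}[\![f]\!])\circ t)$. **Classifying category and generic model.** $\mathit{Cl}$ is the bicartesian closed category whose objects are the types and whose morphisms $A\to B$ are the closed terms of type $A\to B$ modulo $\equiv$, with identity $\lambda x.x$, composition $g\circ f=\lambda x.g(f\,x)$ and the structure given by $\mathbf{Unit},\times,\mathbf{Void},+,\to$. The generic model $G$ is $\mathit{Cl}$ with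 the strong monoidal functor given by $A\mapsto S_mA$, $f\mapsto\mathbf{lift}^mf$, strength $\lambda x.(\mathbf{lift}^m(\lambda y.(\mathbf{proj}_1x,y)))(\mathbf{proj}_2x)$, $\mathbf S^{m_1\le m_2}=\lambda x.\mathbf{up}^{m_1,m_2}x$, $\eta=\lambda x.\mathbf{ret}\,x$, $\epsilon=\lambda x.\mathbf{extr}\,x$, $\mu=\lambda x.\mathbf{join}\,x$, $\delta=\lambda x.\mathbf{fork}\,x$. For a finite-product-preserving functor $F:\mathit{Cl}\to\mathbb D$ and a model $W$ in $\mathit{Cl}$, let $F(W)$ be the interpretation in $\mathbb D$ with $[\![A]\!]_{F(W)}=F[\![A]\!]_W$ and $[\![\Gamma\vdash a:A]\!]_{F(W)}=F([\![a]\!]_W)\circ p^{-1}$, where $p:F(\prod_i[\![A_i]\!]_W)\cong\prod_iF[\![A_i]\!]_W$ is the canonical isomorphism for $\Gamma=x_1:A_1,\dots,x_n:A_n$. **Theorem.** 1. (Completeness.) If $\Gamma\vdash a_1:A$ and $\Gamma\vdash a_2:A$ satisfy $[\![a_1]\!]=[\![a_2]\!]$ in all models, then $a_1\equiv a_2$.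 2. In the generic model, $[\![a_1]\!]_G=[\![a_2]\!]_G$ if and only if $a_1\equiv a_2$. 3. For every bicartesian closed category $\mathbb D$, every finite-product-preserving functor $F:\mathit{Cl}\to\mathbb D$ and every model $W$ in $\mathit{Cl}$, the interpretation $F(W)$ is sound: $a_1\equiv a_2$ implies $[\![a_1]\!]_{F(W)}=[\![a_2]\!]_{F(W)}$. 4. (Universal property.) For every model $W'$ in any bicartesian closed category $\mathbb D$ there is a unique finite-product-preserving functor $F:\mathit{Cl}\to\mathbb D$ such that $F(G)=W'$, i.e. $[\![-]\!]_{F(G)}=[\![-]\!]_{W'}$ on all types and all terms. -/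

import Mathlib

open CategoryTheory MonoidalCategory CartesianMonoidalCategory Limits

universe u v w v' w'

namespace GMCC

/-! ### Types, contexts, terms -/

/-- Types of the calculus; `gr m A` is the graded type `S_m A`. -/
inductive Ty (M : Type u) : Type u
  | unit : Ty M
  | void : Ty M
  | fn : Ty M → Ty M → Ty M
  | prod : Ty M → Ty M → Ty M
  | sum : Ty M → Ty M → Ty M
  | gr : M → Ty M → Ty M

/-- A context is the list of the types of its variables, the most recently bound one first. -/
abbrev Ctx (M : Type u) := List (Ty M)

/-- Variables: positions in a context. -/
inductive Var {M : Type u} : Ctx M → Ty M → Type u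
  | z {Γ : Ctx M} {A : Ty M} : Var (A :: Γ) A
  | s {Γ : Ctx M} {A B : Ty M} : Var Γ A → Var (B :: Γ) A

/-- `Tm Γ A` is the type of typing derivations `Γ ⊢ a : A`.
In `join` and `fork` the grade of the composite type is any `n` with `m₁ * m₂ = n`: equal grades
give the same type, and this form avoids transporting terms along equations between grades. -/
inductive Tm {M : Type u} [Monoid M] [Preorder M] : Ctx M → Ty M → Type u
  | var {Γ : Ctx M} {A : Ty M} : Var Γ A → Tm Γ A
  | lam {Γ : Ctx M} {A B : Ty M} : Tm (A :: Γ) B → Tm Γ (.fn A B)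
  | app {Γ : Ctx M} {A B : Ty M} : Tm Γ (.fn A B) → Tm Γ A → Tm Γ B
  | pair {Γ : Ctx M} {A B : Ty M} : Tm Γ A → Tm Γ B → Tm Γ (.prod A B)
  | fst {Γ : Ctx M} {A B : Ty M} : Tm Γ (.prod A B) → Tm Γ A
  | snd {Γ : Ctx M} {A B : Ty M} : Tm Γ (.prod A B) → Tm Γ B
  | unit {Γ : Ctx M} : Tm Γ .unit
  | inl {Γ : Ctx M} {A B : Ty M} : Tm Γ A → Tm Γ (.sum A B)
  | inr {Γ : Ctx M} {A B : Ty M} : Tm Γ B → Tm Γ (.sum A B)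
  | case {Γ : Ctx M} {A B C : Ty M} :
      Tm Γ (.sum A B) → Tm Γ (.fn A C) → Tm Γ (.fn B C) → Tm Γ C
  | abort {Γ : Ctx M} {A : Ty M} : Tm Γ .void → Tm Γ A
  | ret {Γ : Ctx M} {A : Ty M} : Tm Γ A → Tm Γ (.gr 1 A)
  | extr {Γ : Ctx M} {A : Ty M} : Tm Γ (.gr 1 A) → Tm Γ A
  | lift {Γ : Ctx M} {A B : Ty M} (m : M) : Tm Γ (.fn A B) → Tm Γ (.fn (.gr m A) (.gr m B))
  | join {Γ : Ctx M} {A : Ty M} {m₁ m₂ n : M} (e : m₁ * m₂ = n) :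
      Tm Γ (.gr m₁ (.gr m₂ A)) → Tm Γ (.gr n A)
  | fork {Γ : Ctx M} {A : Ty M} {m₁ m₂ n : M} (e : m₁ * m₂ = n) :
      Tm Γ (.gr n A) → Tm Γ (.gr m₁ (.gr m₂ A))
  | up {Γ : Ctx M} {A : Ty M} {m₁ m₂ : M} (h : m₁ ≤ m₂) : Tm Γ (.gr m₁ A) → Tm Γ (.gr m₂ A)

variable {M : Type u}

/-! ### Renaming and substitution -/

/-- Renamings. -/
abbrev Ren (Γ Δ : Ctx M) := ∀ ⦃A : Ty M⦄, Var Γ A → Var Δ A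

/-- Extension of a renaming under a binder. -/
def Ren.ext {Γ Δ : Ctx M} (ρ : Ren Γ Δ) (B : Ty M) : Ren (B :: Γ) (B :: Δ)
  | _, .z => .z
  | _, .s x => .s (ρ x)

variable [Monoid M] [Preorder M]

/-- Action of a renaming on terms. -/
def Tm.ren {Γ Δ : Ctx M} {A : Ty M} (ρ : Ren Γ Δ) : Tm Γ A → Tm Δ A
  | .var x => .var (ρ x)
  | .lam b => .lam (b.ren (ρ.ext _))
  | .app f a => .app (f.ren ρ) (a.ren ρ)
  | .pair a b => .pair (a.ren ρ) (b.ren ρ)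
  | .fst a => .fst (a.ren ρ)
  | .snd a => .snd (a.ren ρ)
  | .unit => .unit
  | .inl a => .inl (a.ren ρ)
  | .inr a => .inr (a.ren ρ)
  | .case a b₁ b₂ => .case (a.ren ρ) (b₁.ren ρ) (b₂.ren ρ)
  | .abort a => .abort (a.ren ρ)
  | .ret a => .ret (a.ren ρ)
  | .extr a => .extr (a.ren ρ)
  | .lift m f => .lift m (f.ren ρ)
  | .join e a => .join e (a.ren ρ)
  | .fork e a => .fork e (a.ren ρ)
  | .up h a => .up h (a.ren ρ)

/-- Weakening by one variable. -/
abbrev Tm.wk {Γ : Ctx M} {A B : Ty M} (a : Tm Γ A) : Tm (B :: Γ) A := a.ren (fun _ => Var.s)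

/-- Simultaneous substitutions. -/
abbrev Sub (Γ Δ : Ctx M) := ∀ ⦃A : Ty M⦄, Var Γ A → Tm Δ A

/-- Extension of a substitution under a binder. -/
def Sub.ext {Γ Δ : Ctx M} (σ : Sub Γ Δ) (B : Ty M) : Sub (B :: Γ) (B :: Δ)
  | _, .z => .var .z
  | _, .s x => (σ x).wk

/-- Capture-avoiding simultaneous substitution. -/
def Tm.sub {Γ Δ : Ctx M} {A : Ty M} (σ : Sub Γ Δ) : Tm Γ A → Tm Δ A
  | .var x => σ x
  | .lam b => .lam (b.sub (σ.ext _))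
  | .app f a => .app (f.sub σ) (a.sub σ)
  | .pair a b => .pair (a.sub σ) (b.sub σ)
  | .fst a => .fst (a.sub σ)
  | .snd a => .snd (a.sub σ)
  | .unit => .unit
  | .inl a => .inl (a.sub σ)
  | .inr a => .inr (a.sub σ)
  | .case a b₁ b₂ => .case (a.sub σ) (b₁.sub σ) (b₂.sub σ)
  | .abort a => .abort (a.sub σ)
  | .ret a => .ret (a.sub σ)
  | .extr a => .extr (a.sub σ)
  | .lift m f => .lift m (f.sub σ)
  | .join e a => .join e (a.sub σ)
  | .fork e a => .fork e (a.sub σ)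
  | .up h a => .up h (a.sub σ)

/-- The substitution `{a / x}` of the last variable. -/
def Sub.one {Γ : Ctx M} {B : Ty M} (a : Tm Γ B) : Sub (B :: Γ) Γ
  | _, .z => a
  | _, .s x => .var x

/-- `b {a / x}`. -/
abbrev Tm.inst {Γ : Ctx M} {A B : Ty M} (b : Tm (B :: Γ) A) (a : Tm Γ B) : Tm Γ A :=
  b.sub (Sub.one a)

/-! ### The equational theory -/

/-- Graded bind: `a >>= f` is `join ((lift f) a)`. -/
abbrev Tm.bind {Γ : Ctx M} {A B : Ty M} {m₁ m₂ n : M} (e : m₁ * m₂ = n)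
    (a : Tm Γ (.gr m₁ A)) (f : Tm Γ (.fn A (.gr m₂ B))) : Tm Γ (.gr n B) :=
  .join e (.app (.lift m₁ f) a)

/-- Graded extend: `f =<< a` is `(lift f) (fork a)`. -/
abbrev Tm.extend {Γ : Ctx M} {A B : Ty M} {m₁ m₂ n : M} (e : m₁ * m₂ = n)
    (f : Tm Γ (.fn (.gr m₂ A) B)) (a : Tm Γ (.gr n A)) : Tm Γ (.gr m₁ B) :=
  .app (.lift m₁ f) (.fork e a)

open Tm in
/-- Provable equality `Γ ⊢ a ≡ b : A`: the congruent equivalence relation generated by the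
`βη`-rules of the simply typed `λ`-calculus with products and sums (nullary ones included), the
graded monadic rules, the graded comonadic rules, and the rules making `ret`, `extr` and `join`,
`fork` mutually inverse. -/
inductive Eqv : ∀ {Γ : Ctx M} {A : Ty M}, Tm Γ A → Tm Γ A → Prop
  -- equivalence
  | refl {Γ : Ctx M} {A : Ty M} (a : Tm Γ A) : Eqv a a
  | symm {Γ : Ctx M} {A : Ty M} {a b : Tm Γ A} : Eqv a b → Eqv b a
  | trans {Γ : Ctx M} {A : Ty M} {a b c : Tm Γ A} : Eqv a b → Eqv b c → Eqv a c
  -- congruence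
  | lam {Γ : Ctx M} {A B : Ty M} {b b' : Tm (A :: Γ) B} : Eqv b b' → Eqv (lam b) (lam b')
  | app {Γ : Ctx M} {A B : Ty M} {f f' : Tm Γ (.fn A B)} {a a' : Tm Γ A} :
      Eqv f f' → Eqv a a' → Eqv (app f a) (app f' a')
  | pair {Γ : Ctx M} {A B : Ty M} {a a' : Tm Γ A} {b b' : Tm Γ B} :
      Eqv a a' → Eqv b b' → Eqv (pair a b) (pair a' b')
  | fst {Γ : Ctx M} {A B : Ty M} {a a' : Tm Γ (.prod A B)} : Eqv a a' → Eqv (fst a) (fst a')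
  | snd {Γ : Ctx M} {A B : Ty M} {a a' : Tm Γ (.prod A B)} : Eqv a a' → Eqv (snd a) (snd a')
  | inl {Γ : Ctx M} {A B : Ty M} {a a' : Tm Γ A} :
      Eqv a a' → Eqv (inl (B := B) a) (inl a')
  | inr {Γ : Ctx M} {A B : Ty M} {a a' : Tm Γ B} :
      Eqv a a' → Eqv (inr (A := A) a) (inr a')
  | case {Γ : Ctx M} {A B C : Ty M} {a a' : Tm Γ (.sum A B)} {b b' : Tm Γ (.fn A C)}
      {c c' : Tm Γ (.fn B C)} : Eqv a a' → Eqv b b' → Eqv c c' → Eqv (case a b c) (case a' b' c')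
  | abort {Γ : Ctx M} {A : Ty M} {a a' : Tm Γ .void} :
      Eqv a a' → Eqv (abort (A := A) a) (abort a')
  | ret {Γ : Ctx M} {A : Ty M} {a a' : Tm Γ A} : Eqv a a' → Eqv (ret a) (ret a')
  | extr {Γ : Ctx M} {A : Ty M} {a a' : Tm Γ (.gr 1 A)} : Eqv a a' → Eqv (extr a) (extr a')
  | lift {Γ : Ctx M} {A B : Ty M} (m : M) {f f' : Tm Γ (.fn A B)} :
      Eqv f f' → Eqv (lift m f) (lift m f')
  | join {Γ : Ctx M} {A : Ty M} {m₁ m₂ n : M} (e : m₁ * m₂ = n)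
      {a a' : Tm Γ (.gr m₁ (.gr m₂ A))} : Eqv a a' → Eqv (join e a) (join e a')
  | fork {Γ : Ctx M} {A : Ty M} {m₁ m₂ n : M} (e : m₁ * m₂ = n)
      {a a' : Tm Γ (.gr n A)} : Eqv a a' → Eqv (fork e a) (fork e a')
  | up {Γ : Ctx M} {A : Ty M} {m₁ m₂ : M} (h : m₁ ≤ m₂) {a a' : Tm Γ (.gr m₁ A)} :
      Eqv a a' → Eqv (up h a) (up h a')
  -- `βη`-rules
  | fn_beta {Γ : Ctx M} {A B : Ty M} (b : Tm (A :: Γ) B) (a : Tm Γ A) :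
      Eqv (app (lam b) a) (b.inst a)
  | fn_eta {Γ : Ctx M} {A B : Ty M} (f : Tm Γ (.fn A B)) :
      Eqv f (lam (app f.wk (var .z)))
  | fst_beta {Γ : Ctx M} {A B : Ty M} (a : Tm Γ A) (b : Tm Γ B) : Eqv (fst (pair a b)) a
  | snd_beta {Γ : Ctx M} {A B : Ty M} (a : Tm Γ A) (b : Tm Γ B) : Eqv (snd (pair a b)) b
  | prod_eta {Γ : Ctx M} {A B : Ty M} (a : Tm Γ (.prod A B)) : Eqv a (pair (fst a) (snd a))
  | unit_eta {Γ : Ctx M} (a : Tm Γ .unit) : Eqv a unit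
  | inl_beta {Γ : Ctx M} {A B C : Ty M} (a : Tm Γ A) (b₁ : Tm Γ (.fn A C)) (b₂ : Tm Γ (.fn B C)) :
      Eqv (case (inl a) b₁ b₂) (app b₁ a)
  | inr_beta {Γ : Ctx M} {A B C : Ty M} (a : Tm Γ B) (b₁ : Tm Γ (.fn A C)) (b₂ : Tm Γ (.fn B C)) :
      Eqv (case (inr a) b₁ b₂) (app b₂ a)
  | sum_eta {Γ : Ctx M} {A B C : Ty M} (f : Tm Γ (.fn (.sum A B) C)) (a : Tm Γ (.sum A B)) :
      Eqv (app f a)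
        (case a (lam (app f.wk (inl (var .z)))) (lam (app f.wk (inr (var .z)))))
  | void_eta {Γ : Ctx M} {C : Ty M} (f : Tm Γ (.fn .void C)) (a : Tm Γ .void) :
      Eqv (app f a) (abort a)
  -- functoriality of `lift` and `up`
  | lift_id {Γ : Ctx M} {A : Ty M} (m : M) :
      Eqv (Γ := Γ) (lift m (lam (var (Var.z (A := A))))) (lam (var .z))
  | lift_comp {Γ : Ctx M} {A B C : Ty M} (m : M) (f : Tm Γ (.fn A B)) (g : Tm Γ (.fn B C)) :
      Eqv (lift m (lam (app g.wk (app f.wk (var .z)))))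
        (lam (app (lift m g).wk (app (lift m f).wk (var .z))))
  | up_refl {Γ : Ctx M} {A : Ty M} {m : M} (h : m ≤ m) (a : Tm Γ (.gr m A)) : Eqv (up h a) a
  | up_trans {Γ : Ctx M} {A : Ty M} {m₁ m₂ m₃ : M} (h : m₁ ≤ m₂) (h' : m₂ ≤ m₃) (h'' : m₁ ≤ m₃)
      (a : Tm Γ (.gr m₁ A)) : Eqv (up h' (up h a)) (up h'' a)
  -- graded monadic rules
  | bind_natl {Γ : Ctx M} {A B : Ty M} {m₁ m₁' m₂ n n' : M} (h : m₁ ≤ m₁') (e : m₁ * m₂ = n)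
      (e' : m₁' * m₂ = n') (h' : n ≤ n') (a : Tm Γ (.gr m₁ A)) (f : Tm Γ (.fn A (.gr m₂ B))) :
      Eqv (bind e' (up h a) f) (up h' (bind e a f))
  | bind_natr {Γ : Ctx M} {A B : Ty M} {m₁ m₂ m₂' n n' : M} (h : m₂ ≤ m₂') (e : m₁ * m₂ = n)
      (e' : m₁ * m₂' = n') (h' : n ≤ n') (a : Tm Γ (.gr m₁ A)) (b : Tm (A :: Γ) (.gr m₂ B)) :
      Eqv (bind e' a (lam (up h b))) (up h' (bind e a (lam b)))
  | bind_idl {Γ : Ctx M} {A B : Ty M} {m : M} (e : 1 * m = m) (a : Tm Γ A)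
      (f : Tm Γ (.fn A (.gr m B))) : Eqv (bind e (ret a) f) (app f a)
  | bind_idr {Γ : Ctx M} {A : Ty M} {m : M} (e : m * 1 = m) (a : Tm Γ (.gr m A)) :
      Eqv (bind e a (lam (ret (var .z)))) a
  | bind_assoc {Γ : Ctx M} {A B C : Ty M} {m₁ m₂ m₃ m₁₂ m₂₃ n : M} (e₁₂ : m₁ * m₂ = m₁₂)
      (e : m₁₂ * m₃ = n) (e₂₃ : m₂ * m₃ = m₂₃) (e' : m₁ * m₂₃ = n) (a : Tm Γ (.gr m₁ A))
      (f : Tm Γ (.fn A (.gr m₂ B))) (g : Tm Γ (.fn B (.gr m₃ C))) :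
      Eqv (bind e (bind e₁₂ a f) g) (bind e' a (lam (bind e₂₃ (app f.wk (var .z)) g.wk)))
  -- graded comonadic rules
  | extend_natl {Γ : Ctx M} {A B : Ty M} {m₁ m₁' m₂ n n' : M} (h : m₁ ≤ m₁') (e : m₁ * m₂ = n)
      (e' : m₁' * m₂ = n') (h' : n ≤ n') (f : Tm Γ (.fn (.gr m₂ A) B)) (a : Tm Γ (.gr n A)) :
      Eqv (extend e' f (up h' a)) (up h (extend e f a))
  | extend_natr {Γ : Ctx M} {A B : Ty M} {m₁ m₂ m₂' n n' : M} (h : m₂ ≤ m₂') (e : m₁ * m₂ = n)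
      (e' : m₁ * m₂' = n') (h' : n ≤ n') (f : Tm Γ (.fn (.gr m₂' A) B)) (a : Tm Γ (.gr n A)) :
      Eqv (extend e' f (up h' a)) (extend e (lam (app f.wk (up h (var .z)))) a)
  | extend_idl {Γ : Ctx M} {A B : Ty M} {m : M} (e : 1 * m = m) (f : Tm Γ (.fn (.gr m A) B))
      (a : Tm Γ (.gr m A)) : Eqv (extr (extend e f a)) (app f a)
  | extend_idr {Γ : Ctx M} {A : Ty M} {m : M} (e : m * 1 = m) (a : Tm Γ (.gr m A)) :
      Eqv (extend e (lam (extr (var .z))) a) a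
  | extend_assoc {Γ : Ctx M} {A B C : Ty M} {m₁ m₂ m₃ m₁₂ m₂₃ n : M} (e₁₂ : m₁ * m₂ = m₁₂)
      (e : m₁₂ * m₃ = n) (e₂₃ : m₂ * m₃ = m₂₃) (e' : m₁ * m₂₃ = n)
      (f : Tm Γ (.fn (.gr m₃ A) B)) (g : Tm Γ (.fn (.gr m₂ B) C)) (a : Tm Γ (.gr n A)) :
      Eqv (extend e₁₂ g (extend e f a))
        (extend e' (lam (app g.wk (extend e₂₃ f.wk (var .z)))) a)
  -- the monadic and the comonadic structure are mutually inverse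
  | extr_ret {Γ : Ctx M} {A : Ty M} (a : Tm Γ A) : Eqv (extr (ret a)) a
  | ret_extr {Γ : Ctx M} {A : Ty M} (a : Tm Γ (.gr 1 A)) : Eqv (ret (extr a)) a
  | fork_join {Γ : Ctx M} {A : Ty M} {m₁ m₂ n : M} (e : m₁ * m₂ = n)
      (a : Tm Γ (.gr m₁ (.gr m₂ A))) : Eqv (fork e (join e a)) a
  | join_fork {Γ : Ctx M} {A : Ty M} {m₁ m₂ n : M} (e : m₁ * m₂ = n) (a : Tm Γ (.gr n A)) :
      Eqv (join e (fork e a)) a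

set_option linter.unusedSectionVars false
set_option linter.unusedVariables false

/-! ### Substitution lemmas -/

theorem Ren.ext_id {Γ : Ctx M} (B : Ty M) :
    Ren.ext (fun _ x => x : Ren Γ Γ) B = fun _ x => x := by
  funext A x; cases x <;> rfl

theorem Ren.ext_comp {Γ Δ Θ : Ctx M} (ρ : Ren Γ Δ) (τ : Ren Δ Θ) (B : Ty M) :
    (fun A x => (τ.ext B) ((ρ.ext B) x) : Ren (B :: Γ) (B :: Θ)) = Ren.ext (fun A x => τ (ρ x)) B := by
  funext A x; cases x <;> rfl

theorem Tm.ren_ren {Γ : Ctx M} {A : Ty M} (t : Tm Γ A) : ∀ {Δ Θ : Ctx M} (ρ : Ren Γ Δ)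
    (τ : Ren Δ Θ), (t.ren ρ).ren τ = t.ren (fun _ x => τ (ρ x)) := by
  induction t with
  | lam b ih => intros; simp only [Tm.ren, ih, Ren.ext_comp]
  | _ => intros; simp only [Tm.ren, *]

theorem Sub.ext_ren {Γ Δ Θ : Ctx M} (ρ : Ren Γ Δ) (σ : Sub Δ Θ) (B : Ty M) :
    (fun A x => (σ.ext B) ((ρ.ext B) x) : Sub (B :: Γ) (B :: Θ)) = Sub.ext (fun A x => σ (ρ x)) B := by
  funext A x; cases x <;> rfl

theorem Tm.sub_ren {Γ : Ctx M} {A : Ty M} (t : Tm Γ A) : ∀ {Δ Θ : Ctx M} (ρ : Ren Γ Δ)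
    (σ : Sub Δ Θ), (t.ren ρ).sub σ = t.sub (fun _ x => σ (ρ x)) := by
  induction t with
  | lam b ih => intros; simp only [Tm.ren, Tm.sub, ih, Sub.ext_ren]
  | _ => intros; simp only [Tm.ren, Tm.sub, *]

theorem Sub.ren_ext {Γ Δ Θ : Ctx M} (σ : Sub Γ Δ) (ρ : Ren Δ Θ) (B : Ty M) :
    (fun A x => ((σ.ext B) x).ren (ρ.ext B) : Sub (B :: Γ) (B :: Θ)) =
      Sub.ext (fun A x => (σ x).ren ρ) B := by
  funext A x
  cases x
  · rfl
  · simp only [Sub.ext, Tm.wk, Tm.ren_ren]; rfl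

theorem Tm.ren_sub {Γ : Ctx M} {A : Ty M} (t : Tm Γ A) : ∀ {Δ Θ : Ctx M} (σ : Sub Γ Δ)
    (ρ : Ren Δ Θ), (t.sub σ).ren ρ = t.sub (fun _ x => (σ x).ren ρ) := by
  induction t with
  | lam b ih => intros; simp only [Tm.ren, Tm.sub, ih, Sub.ren_ext]
  | _ => intros; simp only [Tm.ren, Tm.sub, *]

theorem Tm.wk_sub_ext {Γ Δ : Ctx M} {A B : Ty M} (t : Tm Γ A) (σ : Sub Γ Δ) :
    (t.wk (B := B)).sub (σ.ext B) = (t.sub σ).wk := by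
  simp only [Tm.wk, Tm.sub_ren, Tm.ren_sub]; rfl

theorem Sub.ext_sub {Γ Δ Θ : Ctx M} (σ : Sub Γ Δ) (τ : Sub Δ Θ) (B : Ty M) :
    (fun A x => ((σ.ext B) x).sub (τ.ext B) : Sub (B :: Γ) (B :: Θ)) =
      Sub.ext (fun A x => (σ x).sub τ) B := by
  funext A x
  cases x
  · rfl
  · exact Tm.wk_sub_ext _ _

theorem Tm.sub_sub {Γ : Ctx M} {A : Ty M} (t : Tm Γ A) : ∀ {Δ Θ : Ctx M} (σ : Sub Γ Δ)
    (τ : Sub Δ Θ), (t.sub σ).sub τ = t.sub (fun _ x => (σ x).sub τ) := by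
  induction t with
  | lam b ih => intros; simp only [Tm.sub, ih, Sub.ext_sub]
  | _ => intros; simp only [Tm.sub, *]

theorem Sub.ext_var {Γ Δ : Ctx M} (ρ : Ren Γ Δ) (B : Ty M) :
    Sub.ext (fun _ x => .var (ρ x)) B = fun _ x => .var ((ρ.ext B) x) := by
  funext A x; cases x <;> rfl

theorem Tm.sub_var {Γ : Ctx M} {A : Ty M} (t : Tm Γ A) : ∀ {Δ : Ctx M} (ρ : Ren Γ Δ),
    t.sub (fun _ x => .var (ρ x)) = t.ren ρ := by
  induction t with
  | lam b ih => intros; simp only [Tm.sub, Tm.ren, ih, Sub.ext_var]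
  | _ => intros; simp only [Tm.sub, Tm.ren, *]

theorem Tm.ren_id {Γ : Ctx M} {A : Ty M} (t : Tm Γ A) : t.ren (fun _ x => x) = t := by
  induction t with
  | lam b ih => simp only [Tm.ren, ih, Ren.ext_id]
  | _ => simp only [Tm.ren, *]

theorem Tm.wk_inst {Γ : Ctx M} {A B : Ty M} (t : Tm Γ A) (a : Tm Γ B) : t.wk.inst a = t := by
  simp only [Tm.inst, Tm.wk, Tm.sub_ren]
  exact (Tm.sub_var t _).trans t.ren_id

theorem Tm.inst_sub {Γ Δ : Ctx M} {A B : Ty M} (b : Tm (B :: Γ) A) (a : Tm Γ B) (σ : Sub Γ Δ) :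
    (b.inst a).sub σ = (b.sub (σ.ext B)).inst (a.sub σ) := by
  simp only [Tm.inst, Tm.sub_sub]
  congr 1
  funext A x
  cases x
  · rfl
  · exact (Tm.wk_inst _ _).symm

/-- Provable equality is stable under substitution. -/
theorem Eqv.sub {Γ : Ctx M} {A : Ty M} {a b : Tm Γ A} (h : Eqv a b) :
    ∀ {Δ : Ctx M} (σ : Sub Γ Δ), Eqv (a.sub σ) (b.sub σ) := by
  induction h with
  | refl => intros; exact .refl _
  | symm _ ih => intro _ σ; exact .symm (ih σ)
  | trans _ _ ih ih' => intro _ σ; exact .trans (ih σ) (ih' σ)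
  | lam _ ih => intro _ σ; exact .lam (ih _)
  | app _ _ ih ih' => intro _ σ; exact .app (ih σ) (ih' σ)
  | pair _ _ ih ih' => intro _ σ; exact .pair (ih σ) (ih' σ)
  | fst _ ih => intro _ σ; exact .fst (ih σ)
  | snd _ ih => intro _ σ; exact .snd (ih σ)
  | inl _ ih => intro _ σ; exact .inl (ih σ)
  | inr _ ih => intro _ σ; exact .inr (ih σ)
  | case _ _ _ ih ih' ih'' => intro _ σ; exact .case (ih σ) (ih' σ) (ih'' σ)
  | abort _ ih => intro _ σ; exact .abort (ih σ)
  | ret _ ih => intro _ σ; exact .ret (ih σ)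
  | extr _ ih => intro _ σ; exact .extr (ih σ)
  | lift m _ ih => intro _ σ; exact .lift m (ih σ)
  | join e _ ih => intro _ σ; exact .join e (ih σ)
  | fork e _ ih => intro _ σ; exact .fork e (ih σ)
  | up h _ ih => intro _ σ; exact .up h (ih σ)
  | fn_beta b a => intro _ σ; rw [Tm.inst_sub]; exact .fn_beta _ _
  | fn_eta f =>
    intro _ σ; simp only [Tm.sub, Tm.wk_sub_ext, Sub.ext]; exact .fn_eta _
  | fst_beta a b => intro _ σ; exact .fst_beta _ _
  | snd_beta a b => intro _ σ; exact .snd_beta _ _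
  | prod_eta a => intro _ σ; exact .prod_eta _
  | unit_eta a => intro _ σ; exact .unit_eta _
  | inl_beta a b c => intro _ σ; exact .inl_beta _ _ _
  | inr_beta a b c => intro _ σ; exact .inr_beta _ _ _
  | sum_eta f a =>
    intro _ σ; simp only [Tm.sub, Tm.wk_sub_ext, Sub.ext]; exact .sum_eta _ _
  | void_eta f a => intro _ σ; exact .void_eta _ _
  | lift_id m => intro _ σ; exact .lift_id m
  | lift_comp m f g =>
    intro _ σ; simp only [Tm.sub, Tm.wk_sub_ext, Sub.ext]; exact .lift_comp m _ _
  | up_refl h a => intro _ σ; exact .up_refl h _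
  | up_trans h h' h'' a => intro _ σ; exact .up_trans h h' h'' _
  | bind_natl h e e' h' a f => intro _ σ; exact .bind_natl h e e' h' _ _
  | bind_natr h e e' h' a b => intro _ σ; exact .bind_natr h e e' h' _ _
  | bind_idl e a f => intro _ σ; exact .bind_idl e _ _
  | bind_idr e a => intro _ σ; exact .bind_idr e _
  | bind_assoc e₁₂ e e₂₃ e' a f g =>
    intro _ σ; simp only [Tm.sub, Tm.wk_sub_ext, Sub.ext]; exact .bind_assoc e₁₂ e e₂₃ e' _ _ _
  | extend_natl h e e' h' f a => intro _ σ; exact .extend_natl h e e' h' _ _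
  | extend_natr h e e' h' f a =>
    intro _ σ; simp only [Tm.sub, Tm.wk_sub_ext, Sub.ext]; exact .extend_natr h e e' h' _ _
  | extend_idl e f a => intro _ σ; exact .extend_idl e _ _
  | extend_idr e a => intro _ σ; exact .extend_idr e _
  | extend_assoc e₁₂ e e₂₃ e' f g a =>
    intro _ σ; simp only [Tm.sub, Tm.wk_sub_ext, Sub.ext]; exact .extend_assoc e₁₂ e e₂₃ e' _ _ _
  | extr_ret a => intro _ σ; exact .extr_ret _
  | ret_extr a => intro _ σ; exact .ret_extr _
  | fork_join e a => intro _ σ; exact .fork_join e _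
  | join_fork e a => intro _ σ; exact .join_fork e _

theorem Eqv.ren {Γ Δ : Ctx M} {A : Ty M} {a b : Tm Γ A} (h : Eqv a b) (ρ : Ren Γ Δ) :
    Eqv (a.ren ρ) (b.ren ρ) := by
  rw [← Tm.sub_var, ← Tm.sub_var]; exact h.sub _

theorem Eqv.sub_congr {Γ : Ctx M} {A : Ty M} (t : Tm Γ A) : ∀ {Δ : Ctx M} {σ τ : Sub Γ Δ},
    (∀ {B : Ty M} (x : Var Γ B), Eqv (σ x) (τ x)) → Eqv (t.sub σ) (t.sub τ) := by
  induction t with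
  | var x => intro _ _ _ h; exact h x
  | lam b ih =>
    intro _ _ _ h
    refine .lam (ih fun x => ?_)
    cases x
    · exact .refl _
    · exact (h _).ren _
  | app _ _ ih ih' => intro _ _ _ h; exact .app (ih h) (ih' h)
  | pair _ _ ih ih' => intro _ _ _ h; exact .pair (ih h) (ih' h)
  | fst _ ih => intro _ _ _ h; exact .fst (ih h)
  | snd _ ih => intro _ _ _ h; exact .snd (ih h)
  | unit => intro _ _ _ h; exact .refl _
  | inl _ ih => intro _ _ _ h; exact .inl (ih h)
  | inr _ ih => intro _ _ _ h; exact .inr (ih h)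
  | case _ _ _ ih ih' ih'' => intro _ _ _ h; exact .case (ih h) (ih' h) (ih'' h)
  | abort _ ih => intro _ _ _ h; exact .abort (ih h)
  | ret _ ih => intro _ _ _ h; exact .ret (ih h)
  | extr _ ih => intro _ _ _ h; exact .extr (ih h)
  | lift m _ ih => intro _ _ _ h; exact .lift m (ih h)
  | join e _ ih => intro _ _ _ h; exact .join e (ih h)
  | fork e _ ih => intro _ _ _ h; exact .fork e (ih h)
  | up h' _ ih => intro _ _ _ h; exact .up h' (ih h)

/-! ### Terms modulo provable equality -/

instance eqvSetoid (Γ : Ctx M) (A : Ty M) : Setoid (Tm Γ A) where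
  r := Eqv
  iseqv := ⟨Eqv.refl, Eqv.symm, Eqv.trans⟩

/-- Terms modulo provable equality. -/
def Q (Γ : Ctx M) (A : Ty M) : Type u := Quotient (eqvSetoid Γ A)

namespace Q

variable {Γ Δ : Ctx M} {A B C : Ty M}

/-- The class of a term. -/
def mk (a : Tm Γ A) : Q Γ A := Quotient.mk _ a

theorem mk_eq {a b : Tm Γ A} : mk a = mk b ↔ Eqv a b := Quotient.eq

theorem sound {a b : Tm Γ A} (h : Eqv a b) : mk a = mk b := Quotient.sound h

/-- A representative. -/
noncomputable def out (a : Q Γ A) : Tm Γ A := Quotient.out a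

theorem mk_out (a : Q Γ A) : mk a.out = a := Quotient.out_eq a

theorem out_mk (a : Tm Γ A) : Eqv (mk a).out a := Quotient.mk_out a

theorem ind {p : Q Γ A → Prop} (h : ∀ a, p (mk a)) (a : Q Γ A) : p a := Quotient.ind h a

def var (x : Var Γ A) : Q Γ A := mk (.var x)

def lam : Q (A :: Γ) B → Q Γ (.fn A B) := Quotient.map .lam fun _ _ h => .lam h

def app : Q Γ (.fn A B) → Q Γ A → Q Γ B :=
  Quotient.map₂ .app fun _ _ h _ _ h' => .app h h'

def pair : Q Γ A → Q Γ B → Q Γ (.prod A B) :=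
  Quotient.map₂ .pair fun _ _ h _ _ h' => .pair h h'

def fst : Q Γ (.prod A B) → Q Γ A := Quotient.map .fst fun _ _ h => .fst h

def snd : Q Γ (.prod A B) → Q Γ B := Quotient.map .snd fun _ _ h => .snd h

def unit : Q Γ .unit := mk .unit

def inl : Q Γ A → Q Γ (.sum A B) := Quotient.map .inl fun _ _ h => .inl h

def inr : Q Γ B → Q Γ (.sum A B) := Quotient.map .inr fun _ _ h => .inr h

def case (a : Q Γ (.sum A B)) (b : Q Γ (.fn A C)) (c : Q Γ (.fn B C)) : Q Γ C :=
  Quotient.liftOn₂ b c (fun b c => Quotient.map (Tm.case · b c)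
    (fun _ _ h => .case h (.refl _) (.refl _)) a)
    (fun _ _ _ _ h h' => by
      induction a using Quotient.ind
      exact Quotient.sound (.case (.refl _) h h'))

def abort : Q Γ .void → Q Γ A := Quotient.map .abort fun _ _ h => .abort h

def ret : Q Γ A → Q Γ (.gr 1 A) := Quotient.map .ret fun _ _ h => .ret h

def extr : Q Γ (.gr 1 A) → Q Γ A := Quotient.map .extr fun _ _ h => .extr h

def lift (m : M) : Q Γ (.fn A B) → Q Γ (.fn (.gr m A) (.gr m B)) :=
  Quotient.map (.lift m) fun _ _ h => .lift m h

variable {m₁ m₂ n : M}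

def join (e : m₁ * m₂ = n) : Q Γ (.gr m₁ (.gr m₂ A)) → Q Γ (.gr n A) :=
  Quotient.map (.join e) fun _ _ h => .join e h

def fork (e : m₁ * m₂ = n) : Q Γ (.gr n A) → Q Γ (.gr m₁ (.gr m₂ A)) :=
  Quotient.map (.fork e) fun _ _ h => .fork e h

def up (h : m₁ ≤ m₂) : Q Γ (.gr m₁ A) → Q Γ (.gr m₂ A) :=
  Quotient.map (.up h) fun _ _ h' => .up h h'

/-- Substitution of classes for variables. -/
noncomputable def sub (σ : ∀ ⦃A : Ty M⦄, Var Γ A → Q Δ A) : Q Γ A → Q Δ A :=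
  Quotient.map (Tm.sub fun _ x => (σ x).out) fun _ _ h => h.sub _

/-- Weakening. -/
def wk : Q Γ A → Q (B :: Γ) A := Quotient.map Tm.wk fun _ _ h => h.ren _

/-- A closed term in an arbitrary context. -/
def clo : Q [] A → Q Γ A := Quotient.map (Tm.ren fun _ x => nomatch x) fun _ _ h => h.ren _

/-- The substitution out of the empty context. -/
def nil : ∀ ⦃A : Ty M⦄, Var [] A → Q Γ A := fun _ x => nomatch x

/-- Extension of a substitution under a binder. -/
def ext (σ : ∀ ⦃A : Ty M⦄, Var Γ A → Q Δ A) (B : Ty M) :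
    ∀ ⦃A : Ty M⦄, Var (B :: Γ) A → Q (B :: Δ) A
  | _, .z => var .z
  | _, .s x => (σ x).wk

/-- Substitution for the last variable. -/
def one (a : Q Γ B) : ∀ ⦃A : Ty M⦄, Var (B :: Γ) A → Q Γ A
  | _, .z => a
  | _, .s x => var x

theorem sub_mk (σ : Sub Γ Δ) (t : Tm Γ A) : (mk t).sub (fun _ x => mk (σ x)) = mk (t.sub σ) :=
  sound (Eqv.sub_congr t fun _ => out_mk _)

theorem exists_sub (σ : ∀ ⦃A : Ty M⦄, Var Γ A → Q Δ A) :
    ∃ τ : Sub Γ Δ, σ = fun _ x => mk (τ x) :=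
  ⟨fun _ x => (σ x).out, by funext A x; exact (mk_out _).symm⟩

theorem ext_mk (σ : Sub Γ Δ) (B : Ty M) :
    ext (fun _ x => mk (σ x)) B = fun _ x => mk ((σ.ext B) x) := by
  funext A x; cases x <;> rfl

theorem one_mk (a : Tm Γ B) : one (mk a) = fun _ x => mk ((Sub.one a) x) := by
  funext A x; cases x <;> rfl

section sub
variable (σ : ∀ ⦃A : Ty M⦄, Var Γ A → Q Δ A)

@[simp] theorem ext_z : ext σ B (.z : Var (B :: Γ) B) = var .z := rfl
@[simp] theorem ext_s (x : Var Γ A) : ext σ B (.s x) = (σ x).wk := rfl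
@[simp] theorem one_z (a : Q Γ B) : one a .z = a := rfl
@[simp] theorem one_s (a : Q Γ B) (x : Var Γ A) : one a (.s x) = var x := rfl

@[simp] theorem sub_var (x : Var Γ A) : (var x).sub σ = σ x := mk_out _

@[simp] theorem sub_lam (b : Q (A :: Γ) B) : (lam b).sub σ = lam (b.sub (ext σ A)) := by
  obtain ⟨σ, rfl⟩ := exists_sub σ
  induction b using ind with | h b => rw [ext_mk, sub_mk]; exact sub_mk σ (.lam b)

@[simp] theorem sub_app (f : Q Γ (.fn A B)) (a : Q Γ A) :
    (app f a).sub σ = app (f.sub σ) (a.sub σ) := by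
  induction f using ind; induction a using ind; rfl

@[simp] theorem sub_pair (a : Q Γ A) (b : Q Γ B) :
    (pair a b).sub σ = pair (a.sub σ) (b.sub σ) := by
  induction a using ind; induction b using ind; rfl

@[simp] theorem sub_fst (a : Q Γ (.prod A B)) : a.fst.sub σ = (a.sub σ).fst := by
  induction a using ind; rfl

@[simp] theorem sub_snd (a : Q Γ (.prod A B)) : a.snd.sub σ = (a.sub σ).snd := by
  induction a using ind; rfl

@[simp] theorem sub_unit : unit.sub σ = unit := rfl

@[simp] theorem sub_inl (a : Q Γ A) : (inl (B := B) a).sub σ = inl (a.sub σ) := by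
  induction a using ind; rfl

@[simp] theorem sub_inr (a : Q Γ B) : (inr (A := A) a).sub σ = inr (a.sub σ) := by
  induction a using ind; rfl

@[simp] theorem sub_case (a : Q Γ (.sum A B)) (b : Q Γ (.fn A C)) (c : Q Γ (.fn B C)) :
    (case a b c).sub σ = case (a.sub σ) (b.sub σ) (c.sub σ) := by
  induction a using ind; induction b using ind; induction c using ind; rfl

@[simp] theorem sub_abort (a : Q Γ .void) : (abort (A := A) a).sub σ = abort (a.sub σ) := by
  induction a using ind; rfl

@[simp] theorem sub_ret (a : Q Γ A) : a.ret.sub σ = (a.sub σ).ret := by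
  induction a using ind; rfl

@[simp] theorem sub_extr (a : Q Γ (.gr 1 A)) : a.extr.sub σ = (a.sub σ).extr := by
  induction a using ind; rfl

@[simp] theorem sub_lift (m : M) (f : Q Γ (.fn A B)) : (lift m f).sub σ = lift m (f.sub σ) := by
  induction f using ind; rfl

@[simp] theorem sub_join (e : m₁ * m₂ = n) (a : Q Γ (.gr m₁ (.gr m₂ A))) :
    (join e a).sub σ = join e (a.sub σ) := by
  induction a using ind; rfl

@[simp] theorem sub_fork (e : m₁ * m₂ = n) (a : Q Γ (.gr n A)) :
    (fork e a).sub σ = fork e (a.sub σ) := by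
  induction a using ind; rfl

@[simp] theorem sub_up (h : m₁ ≤ m₂) (a : Q Γ (.gr m₁ A)) : (up h a).sub σ = up h (a.sub σ) := by
  induction a using ind; rfl

theorem wk_eq_sub (a : Q Γ A) : (a.wk : Q (B :: Γ) A) = a.sub (fun _ x => var (.s x)) := by
  induction a using ind with
  | h a => exact (congrArg mk (Tm.sub_var a _).symm).trans (sub_mk (fun _ x => .var (.s x)) a).symm

@[simp] theorem sub_clo (a : Q [] A) : (clo a).sub σ = clo a := by
  obtain ⟨σ, rfl⟩ := exists_sub σ
  induction a using ind with
  | h a =>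
    refine (sub_mk σ _).trans (congrArg mk ?_)
    rw [Tm.sub_ren, ← Tm.sub_var]
    congr 1; funext B x; exact nomatch x

theorem sub_wk (a : Q Γ A) (τ : ∀ ⦃A : Ty M⦄, Var (B :: Γ) A → Q Δ A) :
    a.wk.sub τ = a.sub (fun _ x => τ (.s x)) := by
  obtain ⟨τ, rfl⟩ := exists_sub τ
  induction a using ind with
  | h a =>
    refine (sub_mk τ _).trans ?_
    rw [Tm.sub_ren]; exact (sub_mk _ a).symm

theorem sub_id (a : Q Γ A) : a.sub (fun _ x => var x) = a := by
  induction a using ind with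
  | h a =>
    have h : a.sub (fun _ x => .var x) = a := (Tm.sub_var a (fun _ x => x)).trans a.ren_id
    exact (sub_mk (fun _ x => .var x) a).trans (congrArg mk h)

@[simp] theorem wk_sub_one (a : Q Γ A) (b : Q Γ B) : a.wk.sub (one b) = a := by
  rw [sub_wk]; exact sub_id a

@[simp] theorem wk_sub_ext (a : Q Γ A) : (a.wk (B := B)).sub (ext σ B) = (a.sub σ).wk := by
  obtain ⟨σ, rfl⟩ := exists_sub σ
  induction a using ind with
  | h a =>
    rw [ext_mk, sub_mk]
    exact (sub_mk (σ.ext B) a.wk).trans (congrArg mk (Tm.wk_sub_ext a σ))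

end sub

@[simp] theorem clo_wk (a : Q [] A) : ((clo a : Q Γ A).wk : Q (B :: Γ) A) = clo a := by
  rw [wk_eq_sub, sub_clo]

@[simp] theorem clo_nil (a : Q [] A) : (clo a : Q [] A) = a := by
  rw [← sub_id (clo a), ← sub_id a]
  induction a using ind with
  | h a =>
    rw [sub_id, sub_id]
    refine congrArg mk (Eq.trans ?_ a.ren_id)
    congr 1; funext B x; exact nomatch x

/-! Weakening and closing commute with the term formers. -/

@[simp] theorem wk_var (x : Var Γ A) : ((var x).wk : Q (B :: Γ) A) = var (.s x) := rfl

section wk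
variable {D : Ty M}

@[simp] theorem wk_app (f : Q Γ (.fn A B)) (a : Q Γ A) :
    ((app f a).wk : Q (D :: Γ) B) = app f.wk a.wk := by simp [wk_eq_sub]
@[simp] theorem wk_pair (a : Q Γ A) (b : Q Γ B) :
    ((pair a b).wk : Q (D :: Γ) _) = pair a.wk b.wk := by simp [wk_eq_sub]
@[simp] theorem wk_fst (a : Q Γ (.prod A B)) : (a.fst.wk : Q (D :: Γ) A) = a.wk.fst := by
  simp [wk_eq_sub]
@[simp] theorem wk_snd (a : Q Γ (.prod A B)) : (a.snd.wk : Q (D :: Γ) B) = a.wk.snd := by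
  simp [wk_eq_sub]
@[simp] theorem wk_unit : (unit.wk : Q (D :: Γ) .unit) = unit := rfl
@[simp] theorem wk_inl (a : Q Γ A) :
    ((inl (B := B) a).wk : Q (D :: Γ) _) = inl a.wk := by simp [wk_eq_sub]
@[simp] theorem wk_inr (a : Q Γ B) :
    ((inr (A := A) a).wk : Q (D :: Γ) _) = inr a.wk := by simp [wk_eq_sub]
@[simp] theorem wk_ret (a : Q Γ A) : (a.ret.wk : Q (D :: Γ) _) = a.wk.ret := by
  simp [wk_eq_sub]
@[simp] theorem wk_extr (a : Q Γ (.gr 1 A)) : (a.extr.wk : Q (D :: Γ) _) = a.wk.extr := by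
  simp [wk_eq_sub]
@[simp] theorem wk_lift (m : M) (f : Q Γ (.fn A B)) :
    ((lift m f).wk : Q (D :: Γ) _) = lift m f.wk := by simp [wk_eq_sub]
@[simp] theorem wk_join (e : m₁ * m₂ = n) (a : Q Γ (.gr m₁ (.gr m₂ A))) :
    ((join e a).wk : Q (D :: Γ) _) = join e a.wk := by simp [wk_eq_sub]
@[simp] theorem wk_fork (e : m₁ * m₂ = n) (a : Q Γ (.gr n A)) :
    ((fork e a).wk : Q (D :: Γ) _) = fork e a.wk := by simp [wk_eq_sub]
@[simp] theorem wk_up (h : m₁ ≤ m₂) (a : Q Γ (.gr m₁ A)) :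
    ((up h a).wk : Q (D :: Γ) _) = up h a.wk := by simp [wk_eq_sub]

/-- The substitution used to weaken under one binder. -/
@[simp] theorem wk_lam (b : Q (A :: Γ) B) :
    ((lam b).wk : Q (D :: Γ) _) = lam (b.sub (ext (fun _ x => var (.s x)) A)) := by
  simp [wk_eq_sub]

theorem clo_eq_sub (a : Q [] A) : (clo a : Q Γ A) = a.sub nil := by
  conv_rhs => rw [← clo_nil a]
  rw [sub_clo]

@[simp] theorem clo_lam (b : Q [A] B) :
    (clo (lam b) : Q Γ (.fn A B)) = lam (b.sub (ext nil A)) := by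
  rw [clo_eq_sub, sub_lam]

@[simp] theorem clo_lift (m : M) (f : Q [] (.fn A B)) :
    (clo (lift m f) : Q Γ _) = lift m (clo f) := by
  rw [clo_eq_sub, sub_lift, ← clo_eq_sub]

@[simp] theorem clo_app (f : Q [] (.fn A B)) (a : Q [] A) :
    (clo (app f a) : Q Γ B) = app (clo f) (clo a) := by
  simp [clo_eq_sub]

end wk

@[simp] theorem sub_s (a : Q Γ A) : a.sub (fun _ x => var (.s x)) = (a.wk : Q (B :: Γ) A) :=
  (wk_eq_sub a).symm

/-! The equational theory, as equations between classes. -/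

@[simp] theorem fn_beta (b : Q (A :: Γ) B) (a : Q Γ A) : app (lam b) a = b.sub (one a) := by
  induction b using ind with
  | h b => induction a using ind with
    | h a => rw [one_mk, sub_mk]; exact sound (.fn_beta b a)

theorem fn_eta (f : Q Γ (.fn A B)) : lam (app f.wk (var .z)) = f := by
  induction f using ind with | h f => exact (sound (.fn_eta f)).symm

theorem fn_ext {f g : Q Γ (.fn A B)} (h : app f.wk (var .z) = app g.wk (var .z)) : f = g := by
  rw [← fn_eta f, h, fn_eta]

theorem hom_ext {f g : Q [] (.fn A B)}
    (h : app (clo f) (var .z : Q [A] A) = app (clo g) (var .z)) : f = g := by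
  apply fn_ext
  rw [← clo_nil f, ← clo_nil g, clo_wk, clo_wk]; exact h

@[simp] theorem fst_beta (a : Q Γ A) (b : Q Γ B) : fst (pair a b) = a := by
  induction a using ind; induction b using ind; exact sound (.fst_beta _ _)

@[simp] theorem snd_beta (a : Q Γ A) (b : Q Γ B) : snd (pair a b) = b := by
  induction a using ind; induction b using ind; exact sound (.snd_beta _ _)

@[simp] theorem prod_eta (a : Q Γ (.prod A B)) : pair (fst a) (snd a) = a := by
  induction a using ind; exact (sound (.prod_eta _)).symm

theorem prod_ext {a b : Q Γ (.prod A B)} (h : fst a = fst b) (h' : snd a = snd b) : a = b := by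
  rw [← prod_eta a, h, h', prod_eta]

theorem unit_eta (a : Q Γ .unit) : a = unit := by
  induction a using ind; exact sound (.unit_eta _)

@[simp] theorem inl_beta (a : Q Γ A) (b : Q Γ (.fn A C)) (c : Q Γ (.fn B C)) :
    case (inl a) b c = app b a := by
  induction a using ind; induction b using ind; induction c using ind
  exact sound (.inl_beta _ _ _)

@[simp] theorem inr_beta (a : Q Γ B) (b : Q Γ (.fn A C)) (c : Q Γ (.fn B C)) :
    case (inr a) b c = app c a := by
  induction a using ind; induction b using ind; induction c using ind
  exact sound (.inr_beta _ _ _)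

theorem sum_eta (f : Q Γ (.fn (.sum A B) C)) (a : Q Γ (.sum A B)) :
    app f a = case a (lam (app f.wk (inl (var .z)))) (lam (app f.wk (inr (var .z)))) := by
  induction f using ind; induction a using ind; exact sound (.sum_eta _ _)

theorem sum_ext {f g : Q [] (.fn (.sum A B) C)}
    (h : app (clo f) (inl (var .z) : Q [A] _) = app (clo g) (inl (var .z)))
    (h' : app (clo f) (inr (var .z) : Q [B] _) = app (clo g) (inr (var .z))) : f = g := by
  have key : ∀ k : Q [] (.fn (.sum A B) C), k = lam (case (var .z)
      (clo (lam (app (clo k) (inl (var .z))))) (clo (lam (app (clo k) (inr (var .z)))))) := by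
    intro k
    apply hom_ext
    rw [sum_eta]
    simp
  rw [key f, key g, h, h']

theorem void_ext (f g : Q [] (.fn .void C)) : f = g := by
  apply hom_ext
  have key : ∀ k : Q [Ty.void] (.fn .void C), app k (var .z) = abort (var .z) := by
    intro k; induction k using ind; exact sound (.void_eta _ _)
  rw [key, key]

@[simp] theorem lift_id (m : M) : (lift m (lam (var .z)) : Q Γ (.fn (.gr m A) _)) = lam (var .z) :=
  sound (.lift_id m)

theorem lift_comp (m : M) (f : Q Γ (.fn A B)) (g : Q Γ (.fn B C)) :
    lift m (lam (app g.wk (app f.wk (var .z)))) =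
      lam (app (lift m g).wk (app (lift m f).wk (var .z))) := by
  induction f using ind; induction g using ind; exact sound (.lift_comp m _ _)

theorem lift_lift (m : M) (f : Q Γ (.fn A B)) (g : Q Γ (.fn B C)) (a : Q Γ (.gr m A)) :
    app (lift m g) (app (lift m f) a) = app (lift m (lam (app g.wk (app f.wk (var .z))))) a := by
  rw [lift_comp]; simp

@[simp] theorem up_refl {m : M} (h : m ≤ m) (a : Q Γ (.gr m A)) : up h a = a := by
  induction a using ind; exact sound (.up_refl h _)

theorem up_trans {m₁ m₂ m₃ : M} (h : m₁ ≤ m₂) (h' : m₂ ≤ m₃) (a : Q Γ (.gr m₁ A)) :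
    up h' (up h a) = up (h.trans h') a := by
  induction a using ind; exact sound (.up_trans h h' _ _)

@[simp] theorem extr_ret (a : Q Γ A) : extr (ret a) = a := by
  induction a using ind; exact sound (.extr_ret _)

@[simp] theorem ret_extr (a : Q Γ (.gr 1 A)) : ret (extr a) = a := by
  induction a using ind; exact sound (.ret_extr _)

@[simp] theorem fork_join (e : m₁ * m₂ = n) (a : Q Γ (.gr m₁ (.gr m₂ A))) :
    fork e (join e a) = a := by
  induction a using ind; exact sound (.fork_join e _)

@[simp] theorem join_fork (e : m₁ * m₂ = n) (a : Q Γ (.gr n A)) : join e (fork e a) = a := by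
  induction a using ind; exact sound (.join_fork e _)

theorem bind_natl {m₁' n' : M} (h : m₁ ≤ m₁') (e : m₁ * m₂ = n) (e' : m₁' * m₂ = n')
    (h' : n ≤ n') (a : Q Γ (.gr m₁ A)) (f : Q Γ (.fn A (.gr m₂ B))) :
    join e' (app (lift m₁' f) (up h a)) = up h' (join e (app (lift m₁ f) a)) := by
  induction a using ind; induction f using ind; exact sound (.bind_natl h e e' h' _ _)

theorem bind_natr {m₂' n' : M} (h : m₂ ≤ m₂') (e : m₁ * m₂ = n) (e' : m₁ * m₂' = n')
    (h' : n ≤ n') (a : Q Γ (.gr m₁ A)) (b : Q (A :: Γ) (.gr m₂ B)) :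
    join e' (app (lift m₁ (lam (up h b))) a) = up h' (join e (app (lift m₁ (lam b)) a)) := by
  induction a using ind; induction b using ind; exact sound (.bind_natr h e e' h' _ _)

theorem bind_idl {m : M} (e : 1 * m = m) (a : Q Γ A) (f : Q Γ (.fn A (.gr m B))) :
    join e (app (lift 1 f) (ret a)) = app f a := by
  induction a using ind; induction f using ind; exact sound (.bind_idl e _ _)

theorem bind_idr {m : M} (e : m * 1 = m) (a : Q Γ (.gr m A)) :
    join e (app (lift m (lam (ret (var .z)))) a) = a := by
  induction a using ind; exact sound (.bind_idr e _)

theorem bind_assoc {m₃ m₁₂ m₂₃ : M} (e₁₂ : m₁ * m₂ = m₁₂) (e : m₁₂ * m₃ = n)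
    (e₂₃ : m₂ * m₃ = m₂₃) (e' : m₁ * m₂₃ = n) (a : Q Γ (.gr m₁ A))
    (f : Q Γ (.fn A (.gr m₂ B))) (g : Q Γ (.fn B (.gr m₃ C))) :
    join e (app (lift m₁₂ g) (join e₁₂ (app (lift m₁ f) a))) =
      join e' (app (lift m₁ (lam (join e₂₃ (app (lift m₂ g.wk) (app f.wk (var .z)))))) a) := by
  induction a using ind; induction f using ind; induction g using ind
  exact sound (.bind_assoc e₁₂ e e₂₃ e' _ _ _)

/-! Derived equations. -/

theorem lift_eq_bind {m : M} (e : m * 1 = m) (f : Q Γ (.fn A B)) (a : Q Γ (.gr m A)) :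
    app (lift m f) a = join e (app (lift m (lam (ret (app f.wk (var .z))))) a) := by
  rw [← bind_idr e (app (lift m f) a), lift_lift]; simp

theorem lift_up (h : m₁ ≤ m₂) (f : Q Γ (.fn A B)) (a : Q Γ (.gr m₁ A)) :
    app (lift m₂ f) (up h a) = up h (app (lift m₁ f) a) := by
  rw [lift_eq_bind (mul_one m₂) f (up h a), bind_natl h (mul_one _) _ h, ← lift_eq_bind]

theorem lift_ret (f : Q Γ (.fn A B)) (a : Q Γ A) : app (lift 1 f) (ret a) = ret (app f a) := by
  rw [lift_eq_bind (mul_one _), bind_idl]; simp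

theorem join_eq_bind (e : m₁ * m₂ = n) (a : Q Γ (.gr m₁ (.gr m₂ A))) :
    join e a = join e (app (lift m₁ (lam (var .z))) a) := by simp

theorem lift_join (e : m₁ * m₂ = n) (f : Q Γ (.fn A B)) (a : Q Γ (.gr m₁ (.gr m₂ A))) :
    app (lift n f) (join e a) = join e (app (lift m₁ (lift m₂ f)) a) := by
  have key : lift m₂ f = lam (join (mul_one m₂) (app (lift m₂ (lam (ret (app f.wk (var .z)))).wk)
      (var .z))) := by
    rw [← fn_eta (lift m₂ f), wk_lift, lift_eq_bind (mul_one _) f.wk]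
    simp
  rw [lift_eq_bind (mul_one n) f (join e a), join_eq_bind e a,
    bind_assoc e (mul_one n) (mul_one m₂) e, key]
  simp

theorem lift_join' (e : m₁ * m₂ = n) (f : Q Γ (.fn A B)) (a : Q Γ (.gr m₁ (.gr m₂ A))) :
    app (lift n f) (join e a) =
      join e (app (lift m₁ (lam (app (lift m₂ f.wk) (var .z)))) a) := by
  rw [lift_join, ← fn_eta (lift m₂ f), wk_lift]

theorem join_up (e : m₁ * m₂ = n) {m₁' n' : M} (h : m₁ ≤ m₁') (e' : m₁' * m₂ = n') (h' : n ≤ n')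
    (a : Q Γ (.gr m₁ (.gr m₂ A))) : join e' (up h a) = up h' (join e a) := by
  rw [join_eq_bind e', bind_natl h e e' h', ← join_eq_bind]

theorem join_lift_up (e : m₁ * m₂ = n) {m₂' n' : M} (h : m₂ ≤ m₂') (e' : m₁ * m₂' = n')
    (h' : n ≤ n') (a : Q Γ (.gr m₁ (.gr m₂ A))) :
    join e' (app (lift m₁ (lam (up h (var .z)))) a) = up h' (join e a) := by
  rw [bind_natr h e e' h', ← join_eq_bind]

theorem join_join {m₃ m₁₂ m₂₃ : M} (e₁₂ : m₁ * m₂ = m₁₂) (e : m₁₂ * m₃ = n)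
    (e₂₃ : m₂ * m₃ = m₂₃) (e' : m₁ * m₂₃ = n) (a : Q Γ (.gr m₁ (.gr m₂ (.gr m₃ A)))) :
    join e (join e₁₂ a) = join e' (app (lift m₁ (lam (join e₂₃ (var .z)))) a) := by
  rw [join_eq_bind e, join_eq_bind e₁₂, bind_assoc e₁₂ e e₂₃ e']; simp

theorem join_ret {m : M} (e : 1 * m = m) (a : Q Γ (.gr m A)) : join e (ret a) = a := by
  rw [join_eq_bind, bind_idl]; simp

end Q

/-! ### Grades as a monoidal category -/

section Models

/-- A preordered monoid, seen as a (thin) category, is strict monoidal with tensor product the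
multiplication. -/
instance gradeMonoidal (M : Type u) [Monoid M] [Preorder M] [MulLeftMono M] [MulRightMono M] :
    MonoidalCategory M where
  tensorObj m n := m * n
  tensorUnit := 1
  whiskerLeft m _ _ f := homOfLE (mul_le_mul_right f.le m)
  whiskerRight f n := homOfLE (mul_le_mul_left f.le n)
  tensorHom f g := homOfLE (mul_le_mul' f.le g.le)
  associator m₁ m₂ m₃ := eqToIso (mul_assoc m₁ m₂ m₃)
  leftUnitor m := eqToIso (one_mul m)
  rightUnitor m := eqToIso (mul_one m)

/-! ### Strong endofunctors -/

/-- A strong endofunctor: an endofunctor with a (tensorial) strength. -/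
structure StrongEndo (C : Type v) [Category.{w} C] [MonoidalCategory C] extends C ⥤ C where
  /-- the strength -/
  str (X Y : C) : X ⊗ obj Y ⟶ obj (X ⊗ Y)
  str_natural_left {X X' : C} (f : X ⟶ X') (Y : C) :
    f ▷ obj Y ≫ str X' Y = str X Y ≫ map (f ▷ Y)
  str_natural_right (X : C) {Y Y' : C} (g : Y ⟶ Y') :
    X ◁ map g ≫ str X Y' = str X Y ≫ map (X ◁ g)
  str_unit (Y : C) : str (𝟙_ C) Y ≫ map (λ_ Y).hom = (λ_ (obj Y)).hom
  str_assoc (X Y Z : C) :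
    str (X ⊗ Y) Z ≫ map (α_ X Y Z).hom = (α_ X Y (obj Z)).hom ≫ X ◁ str Y Z ≫ str X (Y ⊗ Z)

namespace StrongEndo

variable {C : Type v} [Category.{w} C] [MonoidalCategory C]

/-- A strong natural transformation: a natural transformation commuting with the strengths. -/
@[ext] structure Hom (F G : StrongEndo C) where
  app (X : C) : F.obj X ⟶ G.obj X
  naturality {X Y : C} (f : X ⟶ Y) : F.map f ≫ app Y = app X ≫ G.map f
  strong (X Y : C) : F.str X Y ≫ app (X ⊗ Y) = X ◁ app Y ≫ G.str X Y

instance : Category (StrongEndo C) where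
  Hom := Hom
  id F := ⟨fun X => 𝟙 (F.obj X), by simp, by simp⟩
  comp {F G H} α β := ⟨fun X => α.app X ≫ β.app X,
    fun f => by rw [← Category.assoc, α.naturality, Category.assoc, β.naturality, Category.assoc],
    fun X Y => by
      rw [← Category.assoc, α.strong, Category.assoc, β.strong, ← Category.assoc,
        MonoidalCategory.whiskerLeft_comp]⟩
  id_comp _ := Hom.ext (funext fun _ => Category.id_comp _)
  comp_id _ := Hom.ext (funext fun _ => Category.comp_id _)
  assoc _ _ _ := Hom.ext (funext fun _ => Category.assoc _ _ _)

/-- The component at `X` of a strong natural transformation. -/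
def app {F G : StrongEndo C} (α : F ⟶ G) (X : C) : F.obj X ⟶ G.obj X := Hom.app α X

theorem hom_ext {F G : StrongEndo C} {α β : F ⟶ G} (h : ∀ X, app α X = app β X) : α = β :=
  Hom.ext (funext h)

theorem naturality {F G : StrongEndo C} (α : F ⟶ G) {X Y : C} (f : X ⟶ Y) :
    F.map f ≫ app α Y = app α X ≫ G.map f := Hom.naturality α f

theorem strong {F G : StrongEndo C} (α : F ⟶ G) (X Y : C) :
    F.str X Y ≫ app α (X ⊗ Y) = X ◁ app α Y ≫ G.str X Y := Hom.strong α X Y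

@[simp] theorem id_app (F : StrongEndo C) (X : C) : app (𝟙 F) X = 𝟙 (F.obj X) := rfl

@[simp] theorem comp_app {F G H : StrongEndo C} (α : F ⟶ G) (β : G ⟶ H) (X : C) :
    app (α ≫ β) X = app α X ≫ app β X := rfl

/-- The identity endofunctor, with the identity strength. -/
def unit : StrongEndo C where
  obj X := X
  map f := f
  map_id _ := rfl
  map_comp _ _ := rfl
  str _ _ := 𝟙 _
  str_natural_left _ _ := by simp
  str_natural_right _ _ _ := by simp
  str_unit _ := by simp
  str_assoc _ _ _ := by simp

/-- The composite `F ∘ G`, with the composite strength. -/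
def comp (F G : StrongEndo C) : StrongEndo C where
  obj X := F.obj (G.obj X)
  map f := F.map (G.map f)
  map_id _ := by simp
  map_comp _ _ := by simp
  str X Y := F.str X (G.obj Y) ≫ F.map (G.str X Y)
  str_natural_left f Y := by
    rw [← Category.assoc, F.str_natural_left, Category.assoc, ← F.map_comp, G.str_natural_left,
      F.map_comp, Category.assoc]
  str_natural_right X _ _ g := by
    rw [← Category.assoc, F.str_natural_right, Category.assoc, ← F.map_comp, G.str_natural_right,
      F.map_comp, Category.assoc]
  str_unit Y := by
    rw [Category.assoc, ← F.map_comp, G.str_unit, F.str_unit]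
  str_assoc X Y Z := by
    rw [Category.assoc, ← F.map_comp, G.str_assoc, F.map_comp, ← Category.assoc, F.str_assoc,
      F.map_comp, MonoidalCategory.whiskerLeft_comp]
    simp only [Category.assoc]
    rw [← Category.assoc (F.str X _) (F.map _), ← F.str_natural_right]
    simp only [Category.assoc]

/-- A strong natural isomorphism from invertible components. -/
def isoOfId (F G : StrongEndo C) (e : ∀ X, F.obj X ≅ G.obj X)
    (h : ∀ {X Y : C} (f : X ⟶ Y), F.map f ≫ (e Y).hom = (e X).hom ≫ G.map f)
    (h' : ∀ X Y, F.str X Y ≫ (e (X ⊗ Y)).hom = X ◁ (e Y).hom ≫ G.str X Y) : F ≅ G where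
  hom := ⟨fun X => (e X).hom, h, h'⟩
  inv := ⟨fun X => (e X).inv, fun {X Y} f => by
      rw [Iso.comp_inv_eq, Category.assoc, h, Iso.inv_hom_id_assoc],
    fun X Y => by
      rw [Iso.comp_inv_eq, Category.assoc, h', ← Category.assoc,
        ← MonoidalCategory.whiskerLeft_comp, Iso.inv_hom_id, MonoidalCategory.whiskerLeft_id,
        Category.id_comp]⟩
  hom_inv_id := hom_ext fun X => (e X).hom_inv_id
  inv_hom_id := hom_ext fun X => (e X).inv_hom_id

/-- Left whiskering: `F ∘ α`. -/
def whiskerL (F : StrongEndo C) {G H : StrongEndo C} (α : G ⟶ H) : comp F G ⟶ comp F H :=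
  (⟨fun X => F.map (app α X),
    fun f => by
      change F.map (G.map f) ≫ F.map _ = F.map _ ≫ F.map (H.map f)
      rw [← F.map_comp, ← F.map_comp, naturality],
    fun X Y => by
      change (F.str X (G.obj Y) ≫ F.map (G.str X Y)) ≫ F.map _ =
        X ◁ F.map _ ≫ F.str X (H.obj Y) ≫ F.map (H.str X Y)
      rw [Category.assoc, ← F.map_comp, strong, F.map_comp, ← Category.assoc, ← Category.assoc,
        F.str_natural_right]⟩ : Hom (comp F G) (comp F H))

/-- Right whiskering: `α ∘ H`. -/
def whiskerR {F G : StrongEndo C} (α : F ⟶ G) (H : StrongEndo C) : comp F H ⟶ comp G H :=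
  (⟨fun X => app α (H.obj X), fun f => naturality α _,
    fun X Y => by
      change (F.str X (H.obj Y) ≫ F.map (H.str X Y)) ≫ app α _ =
        X ◁ app α _ ≫ G.str X (H.obj Y) ≫ G.map (H.str X Y)
      rw [Category.assoc, naturality, ← Category.assoc, strong, Category.assoc]⟩ : Hom (comp F H) (comp G H))

/-- Strong endofunctors form a strict monoidal category under composition, `F ⊗ G = F ∘ G`. -/
instance : MonoidalCategory (StrongEndo C) where
  tensorObj F G := comp F G
  tensorUnit := unit
  whiskerLeft F _ _ α := whiskerL F α
  whiskerRight α H := whiskerR α H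
  tensorHom {_ F₂ G₁ _} α β := whiskerR α G₁ ≫ whiskerL F₂ β
  associator F G H := isoOfId _ _ (fun X => Iso.refl (F.obj (G.obj (H.obj X))))
    (fun _ => (Category.comp_id _).trans (Category.id_comp _).symm)
    (fun X Y => by simp [comp])
  leftUnitor F := isoOfId _ _ (fun X => Iso.refl (F.obj X))
    (fun _ => (Category.comp_id _).trans (Category.id_comp _).symm)
    (fun X Y => by simp [comp, unit])
  rightUnitor F := isoOfId _ _ (fun X => Iso.refl (F.obj X))
    (fun _ => (Category.comp_id _).trans (Category.id_comp _).symm)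
    (fun X Y => by simp [comp, unit])
  tensorHom_def _ _ := rfl
  id_tensorHom_id F G := hom_ext fun X => by
    change 𝟙 _ ≫ F.map (𝟙 _) = 𝟙 (F.obj (G.obj X))
    simp
  tensorHom_comp_tensorHom {F₁ F₂ F₃ G₁ G₂ G₃} α₁ β₁ α₂ β₂ := hom_ext fun X => by
    change (app α₁ _ ≫ F₂.map (app β₁ X)) ≫ app α₂ _ ≫ F₃.map (app β₂ X) =
      (app α₁ _ ≫ app α₂ _) ≫ F₃.map (app β₁ X ≫ app β₂ X)
    rw [F₃.map_comp, Category.assoc, Category.assoc, ← Category.assoc (F₂.map _), naturality,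
      Category.assoc]
  whiskerLeft_id F G := hom_ext fun X => F.map_id _
  id_whiskerRight F G := hom_ext fun X => rfl
  associator_naturality {F₁ F₂ F₃ G₁ G₂ G₃} α β γ := hom_ext fun X => by
    change ((app α _ ≫ G₁.map (app β _)) ≫ G₁.map (G₂.map (app γ X))) ≫ 𝟙 _ =
      𝟙 _ ≫ app α _ ≫ G₁.map (app β _ ≫ G₂.map (app γ X))
    simp
  leftUnitor_naturality {F G} α := hom_ext fun X =>
    (Category.comp_id _).trans (Category.id_comp _).symm
  rightUnitor_naturality {F G} α := hom_ext fun X =>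
    (Category.comp_id _).trans (Category.id_comp _).symm
  pentagon F G H K := hom_ext fun X => by
    change 𝟙 _ ≫ 𝟙 _ ≫ F.map (𝟙 (G.obj (H.obj (K.obj X)))) = 𝟙 _ ≫ 𝟙 _
    simp
  triangle F G := hom_ext fun X => by
    change 𝟙 _ ≫ F.map (𝟙 (G.obj X)) = 𝟙 _
    simp

end StrongEndo

/-! ### Interpretation in a model -/

/-- Chosen finite coproducts. Together with `CartesianMonoidalCategory` (chosen finite products)
and `MonoidalClosed` (chosen exponentials) this is the structure of a bicartesian closed category. -/
class ChosenFiniteCoproducts (D : Type v) [Category.{w} D] where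
  initial : D
  isInitial : IsInitial initial
  coprod : D → D → D
  inl (X Y : D) : X ⟶ coprod X Y
  inr (X Y : D) : Y ⟶ coprod X Y
  isColimit (X Y : D) : IsColimit (BinaryCofan.mk (inl X Y) (inr X Y))

namespace ChosenFiniteCoproducts

variable {D : Type v} [Category.{w} D] [ChosenFiniteCoproducts D]

/-- The morphism out of the initial object. -/
def fromInitial (X : D) : initial (D := D) ⟶ X := isInitial.to X

/-- Copairing. -/
def desc {X Y Z : D} (f : X ⟶ Z) (g : Y ⟶ Z) : coprod X Y ⟶ Z :=
  BinaryCofan.IsColimit.desc (isColimit X Y) f g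

end ChosenFiniteCoproducts

/-- The object interpreting a context, given the objects interpreting the types:
`⟦∅⟧ = ⊤` and `⟦Γ, x : A⟧ = ⟦Γ⟧ × ⟦A⟧`. -/
def ctxObj {D : Type v} [Category.{w} D] [CartesianMonoidalCategory D] (ty : Ty M → D) :
    Ctx M → D
  | [] => 𝟙_ D
  | A :: Γ => ctxObj ty Γ ⊗ ty A

/-- An interpretation of types as objects and of terms `Γ ⊢ a : A` as morphisms `⟦Γ⟧ ⟶ ⟦A⟧`. -/
structure Interp (M : Type u) [Monoid M] [Preorder M] (D : Type v) [Category.{w} D]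
    [CartesianMonoidalCategory D] where
  ty : Ty M → D
  tm {Γ : Ctx M} {A : Ty M} : Tm Γ A → (ctxObj ty Γ ⟶ ty A)

section

variable {D : Type v} [Category.{w} D] [CartesianMonoidalCategory D]

/-- The projection interpreting a variable. -/
def varHom (ty : Ty M → D) : ∀ {Γ : Ctx M} {A : Ty M}, Var Γ A → (ctxObj ty Γ ⟶ ty A)
  | _, _, .z => snd _ _
  | _, _, .s x => fst _ _ ≫ varHom ty x

section CCC

variable [MonoidalClosed D]

/-- Currying `X × Y ⟶ Z` to `X ⟶ Z ^ Y`. -/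
def curryHom {X Y Z : D} (f : X ⊗ Y ⟶ Z) : X ⟶ (ihom Y).obj Z :=
  MonoidalClosed.curry (lift (snd Y X) (fst Y X) ≫ f)

/-- Uncurrying `X ⟶ Z ^ Y` to `X × Y ⟶ Z`. -/
def uncurryHom {X Y Z : D} (f : X ⟶ (ihom Y).obj Z) : X ⊗ Y ⟶ Z :=
  lift (snd X Y) (fst X Y) ≫ MonoidalClosed.uncurry f

/-- Application of `f` to `a`. -/
def appHom {X Y Z : D} (f : X ⟶ (ihom Y).obj Z) (a : X ⟶ Y) : X ⟶ Z :=
  lift (𝟙 X) a ≫ uncurryHom f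

/-- Case analysis: copairing of the uncurried branches, using that `X × -` preserves coproducts
by cartesian closure. -/
def caseHom [ChosenFiniteCoproducts D] {X Y₁ Y₂ Z : D} (a : X ⟶ ChosenFiniteCoproducts.coprod Y₁ Y₂)
    (b₁ : X ⟶ (ihom Y₁).obj Z) (b₂ : X ⟶ (ihom Y₂).obj Z) : X ⟶ Z :=
  lift (𝟙 X) a ≫ MonoidalClosed.uncurry (ChosenFiniteCoproducts.desc
    (MonoidalClosed.curry (uncurryHom b₁)) (MonoidalClosed.curry (uncurryHom b₂)))

end CCC

variable [MulLeftMono M] [MulRightMono M] (S : M ⥤ StrongEndo D)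

/-- The component of `S (m₁ ≤ m₂)`. -/
def upHom {m₁ m₂ : M} (h : m₁ ≤ m₂) (X : D) : (S.obj m₁).obj X ⟶ (S.obj m₂).obj X :=
  StrongEndo.app (S.map (homOfLE h)) X

section Monoidal

variable [S.Monoidal]

/-- The component of the unit `η : Id ⟶ S 1`. -/
def retHom (X : D) : X ⟶ (S.obj 1).obj X := StrongEndo.app (Functor.LaxMonoidal.ε S) X

/-- The component of the counit `ε : S 1 ⟶ Id`, inverse to `η`. -/
def extrHom (X : D) : (S.obj 1).obj X ⟶ X := StrongEndo.app (Functor.OplaxMonoidal.η S) X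

/-- The component of the multiplication `μ : S m₁ ∘ S m₂ ⟶ S (m₁ * m₂)`. -/
def joinHom (m₁ m₂ : M) (X : D) : (S.obj m₁).obj ((S.obj m₂).obj X) ⟶ (S.obj (m₁ * m₂)).obj X :=
  StrongEndo.app (Functor.LaxMonoidal.μ S m₁ m₂) X

/-- The component of the comultiplication `δ : S (m₁ * m₂) ⟶ S m₁ ∘ S m₂`, inverse to `μ`. -/
def forkHom (m₁ m₂ : M) (X : D) : (S.obj (m₁ * m₂)).obj X ⟶ (S.obj m₁).obj ((S.obj m₂).obj X) :=
  StrongEndo.app (Functor.OplaxMonoidal.δ S m₁ m₂) X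

end Monoidal

variable [MonoidalClosed D]

/-- Interpretation of `lift`: `⟦lift f⟧ = Λ (S_m (Λ⁻¹ ⟦f⟧) ∘ t)`. -/
def liftHom (m : M) {X Y Z : D} (f : X ⟶ (ihom Y).obj Z) :
    X ⟶ (ihom ((S.obj m).obj Y)).obj ((S.obj m).obj Z) :=
  curryHom ((S.obj m).str X Y ≫ (S.obj m).map (uncurryHom f))

variable [ChosenFiniteCoproducts D]

/-- Interpretation of types. -/
def interpTy : Ty M → D
  | .unit => 𝟙_ D
  | .void => ChosenFiniteCoproducts.initial
  | .fn A B => (ihom (interpTy A)).obj (interpTy B)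
  | .prod A B => interpTy A ⊗ interpTy B
  | .sum A B => ChosenFiniteCoproducts.coprod (interpTy A) (interpTy B)
  | .gr m A => (S.obj m).obj (interpTy A)

variable [S.Monoidal]

/-- Interpretation of terms. -/
def interpTm : ∀ {Γ : Ctx M} {A : Ty M}, Tm Γ A → (ctxObj (interpTy S) Γ ⟶ interpTy S A)
  | _, _, .var x => varHom (interpTy S) x
  | _, _, .lam b => curryHom (interpTm b)
  | _, _, .app f a => appHom (interpTm f) (interpTm a)
  | _, _, .pair a b => lift (interpTm a) (interpTm b)
  | _, _, .fst a => interpTm a ≫ fst _ _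
  | _, _, .snd a => interpTm a ≫ snd _ _
  | _, _, .unit => toUnit _
  | _, _, .inl a => interpTm a ≫ ChosenFiniteCoproducts.inl _ _
  | _, _, .inr a => interpTm a ≫ ChosenFiniteCoproducts.inr _ _
  | _, _, .case a b₁ b₂ => caseHom (interpTm a) (interpTm b₁) (interpTm b₂)
  | _, _, .abort a => interpTm a ≫ ChosenFiniteCoproducts.fromInitial _
  | _, _, .ret a => interpTm a ≫ retHom S _
  | _, _, .extr a => interpTm a ≫ extrHom S _
  | _, _, .lift m f => liftHom S m (interpTm f)
  | _, _, .join (m₁ := m₁) (m₂ := m₂) e a =>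
      interpTm a ≫ joinHom S m₁ m₂ _ ≫ upHom S (le_of_eq e) _
  | _, _, .fork (m₁ := m₁) (m₂ := m₂) e a =>
      interpTm a ≫ upHom S (le_of_eq e.symm) _ ≫ forkHom S m₁ m₂ _
  | _, _, .up h a => interpTm a ≫ upHom S h _

/-- The interpretation of the calculus in the model given by a bicartesian closed category `D` and
a strong monoidal functor `S` from the grades to the strong endofunctors of `D`. -/
def interp : Interp M D where
  ty := interpTy S
  tm := interpTm S

end

/-! ### Transport of interpretations along finite-product-preserving functors -/

section push

variable {C : Type v'} [Category.{w'} C] [CartesianMonoidalCategory C]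
  {D : Type v} [Category.{w} D] [CartesianMonoidalCategory D]
  (F : C ⥤ D) [PreservesFiniteProducts F]

/-- The canonical isomorphism `p : F (Π Aᵢ) ≅ Π F Aᵢ`. -/
noncomputable def ctxIso (ty : Ty M → C) :
    ∀ Γ : Ctx M, F.obj (ctxObj ty Γ) ≅ ctxObj (fun A => F.obj (ty A)) Γ
  | [] => CartesianMonoidalCategory.preservesTerminalIso F
  | A :: Γ => CartesianMonoidalCategory.prodComparisonIso F (ctxObj ty Γ) (ty A) ≪≫
      MonoidalCategory.whiskerRightIso (ctxIso ty Γ) (F.obj (ty A))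

/-- The image `F(W)` of an interpretation `W`: `⟦A⟧_{F(W)} = F ⟦A⟧_W` and
`⟦a⟧_{F(W)} = F ⟦a⟧_W ∘ p⁻¹`. -/
noncomputable def Interp.push (W : Interp M C) : Interp M D where
  ty A := F.obj (W.ty A)
  tm {Γ _} a := (ctxIso F W.ty Γ).inv ≫ F.map (W.tm a)

end push

end Models

/-! ### The classifying category -/

namespace Q

variable {Γ Δ Θ : Ctx M} {A B : Ty M}

theorem sub_sub (a : Q Γ A) (σ : ∀ ⦃A : Ty M⦄, Var Γ A → Q Δ A)
    (τ : ∀ ⦃A : Ty M⦄, Var Δ A → Q Θ A) : (a.sub σ).sub τ = a.sub (fun _ x => (σ x).sub τ) := by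
  obtain ⟨σ, rfl⟩ := exists_sub σ
  obtain ⟨τ, rfl⟩ := exists_sub τ
  induction a using ind with
  | h a =>
    simp only [sub_mk]
    rw [Tm.sub_sub]

/-- Substitution for the only variable. -/
def only (a : Q Γ B) : ∀ ⦃A : Ty M⦄, Var [B] A → Q Γ A
  | _, .z => a

@[simp] theorem only_z (a : Q Γ B) : only a .z = a := rfl

theorem clo_lam_app (b : Q [A] B) (a : Q Γ A) : app (clo (lam b)) a = b.sub (only a) := by
  rw [clo_lam, fn_beta, sub_sub]
  congr 1
  funext C x
  cases x with
  | z => exact sub_var _ _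
  | s x => exact nomatch x

end Q

/-- The classifying category: its objects are the types and its morphisms from `A` to `B` are the
closed terms of type `A → B` up to provable equality. -/
abbrev Cl (M : Type u) : Type u := Ty M

namespace Cl

open Q

/-- The identity is `λ x. x`, and the composite of `f` and `g` is `λ x. g (f x)`. -/
instance : CategoryStruct (Cl M) where
  Hom A B := Q [] (.fn A B)
  id _ := lam (var .z)
  comp f g := lam (app (clo g) (app (clo f) (var .z)))

/-- Application of a morphism to a term. -/
def ap {Γ : Ctx M} {A B : Cl M} (f : A ⟶ B) (a : Q Γ A) : Q Γ B := app (clo f) a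

/-- The morphism `λ x. b`. -/
def fun' {A B : Cl M} (b : Q [A] B) : A ⟶ B := lam b

variable {Γ Δ : Ctx M} {A B C A' B' : Cl M}

theorem ext' {f g : A ⟶ B} (h : ap f (var .z : Q [A] A) = ap g (var .z)) : f = g := Q.hom_ext h

theorem ap_fun' (b : Q [A] B) (a : Q Γ A) : ap (fun' b) a = b.sub (only a) := clo_lam_app b a

theorem sub_ap (σ : ∀ ⦃A : Ty M⦄, Var Γ A → Q Δ A) (f : A ⟶ B) (a : Q Γ A) :
    (ap f a).sub σ = ap f (a.sub σ) := by simp [ap]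

theorem wk_ap (f : A ⟶ B) (a : Q Γ A) {D : Ty M} :
    ((ap f a).wk : Q (D :: Γ) B) = ap f a.wk := by simp [ap]

theorem ap_id (a : Q Γ A) : ap (𝟙 A) a = a :=
  (clo_lam_app _ _).trans (sub_var _ _)

theorem ap_comp (f : A ⟶ B) (g : B ⟶ C) (a : Q Γ A) : ap (f ≫ g) a = ap g (ap f a) :=
  (clo_lam_app _ _).trans (by simp [ap])

instance : Category (Cl M) where
  id_comp _ := ext' (by simp only [ap_comp, ap_id])
  comp_id _ := ext' (by simp only [ap_comp, ap_id])
  assoc _ _ _ := ext' (by simp only [ap_comp])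

/-- Finite products are given by `Unit` and `×`. -/
instance : MonoidalCategoryStruct (Cl M) where
  tensorObj A B := Ty.prod A B
  tensorUnit := Ty.unit
  whiskerLeft A _ _ f := fun' (pair (fst (var .z)) (ap f (snd (var .z))))
  whiskerRight f B := fun' (pair (ap f (fst (var .z))) (snd (var .z)))
  tensorHom f g := fun' (pair (ap f (fst (var .z))) (ap g (snd (var .z))))
  associator A B C :=
    { hom := fun' (pair (fst (fst (var .z))) (pair (snd (fst (var .z))) (snd (var .z))))
      inv := fun' (pair (pair (fst (var .z)) (fst (snd (var .z)))) (snd (snd (var .z))))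
      hom_inv_id := ext' (by simp [ap_comp, ap_id, ap_fun'])
      inv_hom_id := ext' (by simp [ap_comp, ap_id, ap_fun']) }
  leftUnitor A :=
    { hom := fun' (snd (var .z))
      inv := fun' (pair unit (var .z))
      hom_inv_id := ext' (prod_ext ((unit_eta _).trans (unit_eta _).symm)
        (by simp [ap_comp, ap_id, ap_fun']))
      inv_hom_id := ext' (by simp [ap_comp, ap_id, ap_fun']) }
  rightUnitor A :=
    { hom := fun' (fst (var .z))
      inv := fun' (pair (var .z) unit)
      hom_inv_id := ext' (prod_ext (by simp [ap_comp, ap_id, ap_fun'])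
        ((unit_eta _).trans (unit_eta _).symm))
      inv_hom_id := ext' (by simp [ap_comp, ap_id, ap_fun']) }

theorem ap_whiskerLeft (f : B ⟶ B') (a : Q Γ (A ⊗ B : Cl M)) :
    ap (A ◁ f) a = pair (fst a) (ap f (snd a)) :=
  (ap_fun' _ _).trans (by simp [sub_ap])

theorem ap_whiskerRight (f : A ⟶ A') (a : Q Γ (A ⊗ B : Cl M)) :
    ap (f ▷ B) a = pair (ap f (fst a)) (snd a) :=
  (ap_fun' _ _).trans (by simp [sub_ap])

theorem ap_tensorHom (f : A ⟶ A') (g : B ⟶ B') (a : Q Γ (A ⊗ B : Cl M)) :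
    ap (f ⊗ₘ g) a = pair (ap f (fst a)) (ap g (snd a)) :=
  (ap_fun' _ _).trans (by simp [sub_ap])

theorem ap_associator (a : Q Γ ((A ⊗ B) ⊗ C : Cl M)) :
    ap (α_ A B C).hom a = pair (fst (fst a)) (pair (snd (fst a)) (snd a)) := 
  (ap_fun' (pair (fst (fst (var .z))) (pair (snd (fst (var .z))) (snd (var .z)))) a).trans (by simp)

theorem ap_leftUnitor (a : Q Γ (𝟙_ (Cl M) ⊗ A : Cl M)) : ap (λ_ A).hom a = snd a := 
  (ap_fun' (snd (var .z)) a).trans (by simp)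

theorem ap_rightUnitor (a : Q Γ (A ⊗ 𝟙_ (Cl M) : Cl M)) : ap (ρ_ A).hom a = fst a := 
  (ap_fun' (fst (var .z)) a).trans (by simp)

instance : MonoidalCategory (Cl M) where
  tensorHom_def _ _ := ext' (by simp [ap_comp, ap_tensorHom, ap_whiskerLeft, ap_whiskerRight])
  id_tensorHom_id _ _ := ext' (by simp only [ap_tensorHom, ap_id]; exact prod_eta _)
  tensorHom_comp_tensorHom _ _ _ _ := ext' (by simp [ap_comp, ap_tensorHom])
  whiskerLeft_id _ _ := ext' (by simp only [ap_whiskerLeft, ap_id]; exact prod_eta _)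
  id_whiskerRight _ _ := ext' (by simp only [ap_whiskerRight, ap_id]; exact prod_eta _)
  associator_naturality _ _ _ := ext' (by simp [ap_comp, ap_tensorHom, ap_associator])
  leftUnitor_naturality _ := ext' (by simp [ap_comp, ap_whiskerLeft, ap_leftUnitor])
  rightUnitor_naturality _ := ext' (by simp [ap_comp, ap_whiskerRight, ap_rightUnitor])
  pentagon _ _ _ _ := ext' (by
    simp [ap_comp, ap_whiskerLeft, ap_whiskerRight, ap_associator])
  triangle _ _ := ext' (by
    simp [ap_comp, ap_whiskerLeft, ap_whiskerRight, ap_associator, ap_leftUnitor, ap_rightUnitor])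

instance : CartesianMonoidalCategory (Cl M) where
  isTerminalTensorUnit := IsTerminal.ofUniqueHom (fun _ => fun' unit)
    fun _ _ => ext' ((unit_eta _).trans (unit_eta _).symm)
  fst A B := fun' (Q.fst (var .z))
  snd A B := fun' (Q.snd (var .z))
  fst_def A B := ext' (by simp [ap_comp, ap_fun', ap_whiskerLeft, ap_rightUnitor])
  snd_def A B := ext' (by simp [ap_comp, ap_fun', ap_whiskerRight, ap_leftUnitor])
  tensorProductIsBinaryProduct A B := BinaryFan.IsLimit.mk _
    (fun f g => fun' (pair (ap f (var .z)) (ap g (var .z))))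
    (fun f g => ext' (by simp [ap_comp, ap_fun', sub_ap]))
    (fun f g => ext' (by simp [ap_comp, ap_fun', sub_ap]))
    (fun f g m hf hg => ext' (by
      subst hf hg
      refine prod_ext ?_ ?_ <;> simp [ap_comp, ap_fun', sub_ap]))

/-- Exponentials are given by `→`. -/
instance : MonoidalClosed (Cl M) where
  closed A :=
    { rightAdj :=
        { obj B := Ty.fn A B
          map f := fun' (lam (ap f (app (var (.s .z)) (var .z))))
          map_id B := ext' (by
            simp only [ap_id, ap_fun', sub_lam, sub_app, sub_var, ext_z, ext_s, only_z]
            exact fn_eta _)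
          map_comp f g := ext' (by simp [ap_comp, ap_fun', sub_ap]) }
      adj := Adjunction.mkOfHomEquiv
        { homEquiv X Y :=
            { toFun f := fun' (lam (ap f (pair (var .z) (var (.s .z)))))
              invFun g := fun' (app (ap g (snd (var .z))) (fst (var .z)))
              left_inv f := ext' (by simp [ap_fun', sub_ap])
              right_inv g := ext' (by
                simp [ap_fun', sub_ap]
                rw [← fn_eta (ap g (var .z)), wk_ap]; rfl) }
          homEquiv_naturality_left_symm f g := ext' (by
            simp [ap_comp, ap_fun', sub_ap]
            erw [ap_whiskerLeft]
            simp)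
          homEquiv_naturality_right f g := ext' (by simp [ap_comp, ap_fun', sub_ap]) } }


theorem copair_inl (f : A ⟶ C) (g : B ⟶ C) :
    (fun' (Q.inl (var .z)) : A ⟶ (Ty.sum A B : Cl M)) ≫ fun' (case (var .z) (clo f) (clo g)) = f :=
  ext' (by rw [ap_comp, ap_fun', ap_fun']; simp [ap])

theorem copair_inr (f : A ⟶ C) (g : B ⟶ C) :
    (fun' (Q.inr (var .z)) : B ⟶ (Ty.sum A B : Cl M)) ≫ fun' (case (var .z) (clo f) (clo g)) = g :=
  ext' (by rw [ap_comp, ap_fun', ap_fun']; simp [ap])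

theorem copair_uniq (f : A ⟶ C) (g : B ⟶ C) (m : (Ty.sum A B : Cl M) ⟶ C)
    (hf : (fun' (Q.inl (var .z)) : A ⟶ (Ty.sum A B : Cl M)) ≫ m = f)
    (hg : (fun' (Q.inr (var .z)) : B ⟶ (Ty.sum A B : Cl M)) ≫ m = g) :
    m = fun' (case (var .z) (clo f) (clo g)) := by
  refine sum_ext ?_ ?_
  · refine Eq.trans ?_ (ap_fun' _ _).symm
    have h := (ap_comp (fun' (Q.inl (var .z)) : A ⟶ (Ty.sum A B : Cl M)) m
      (var .z : Q [A] A)).symm.trans (congrArg (fun k => ap k (var .z)) hf)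
    rw [ap_fun'] at h
    simpa [ap] using h
  · refine Eq.trans ?_ (ap_fun' _ _).symm
    have h := (ap_comp (fun' (Q.inr (var .z)) : B ⟶ (Ty.sum A B : Cl M)) m
      (var .z : Q [B] B)).symm.trans (congrArg (fun k => ap k (var .z)) hg)
    rw [ap_fun'] at h
    simpa [ap] using h

/-- Finite coproducts are given by `Void` and `+`. -/
instance : ChosenFiniteCoproducts (Cl M) where
  initial := Ty.void
  isInitial := IsInitial.ofUniqueHom (fun _ => fun' (abort (var .z))) fun _ _ => void_ext _ _
  coprod A B := Ty.sum A B
  inl A B := fun' (Q.inl (var .z))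
  inr A B := fun' (Q.inr (var .z))
  isColimit A B := BinaryCofan.IsColimit.mk _
    (fun f g => fun' (case (var .z) (clo f) (clo g)))
    (fun f g => copair_inl f g)
    (fun f g => copair_inr f g)
    (fun {_} f g m hf hg => copair_uniq f g m hf hg)

/-! ### The generic model -/

theorem ap_lift {m : M} (f : A ⟶ B) (a : Q Γ (.gr m A)) :
    ap (A := Ty.gr m A) (B := Ty.gr m B) (lift m f) a =
      app (lift m (lam (ap f (var .z)))) a := by
  have h : (lam (ap f (var .z)) : Q Γ (.fn A B)) = clo f := by
    rw [← fn_eta (clo f : Q Γ (.fn A B)), clo_wk]; rfl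
  rw [h]; simp [ap]

/-- The strong endofunctor `S_m` of the classifying category: it maps `f` to `lift f`, and its
strength is `λ x. (lift (λ y. (proj₁ x, y))) (proj₂ x)`. -/
def endo (m : M) : StrongEndo (Cl M) where
  obj A := Ty.gr m A
  map {A B} f := (lift m f : Q [] (.fn (.gr m A) (.gr m B)))
  map_id A := lift_id m
  map_comp {A B C} f g := ext' (by
    simp [ap_comp, ap_lift, sub_ap, lift_lift])
  str X Y := fun' (app (lift m (lam (pair (fst (var (.s .z))) (var .z)))) (snd (var .z)))
  str_natural_left f Y := ext' (by
    simp [ap_comp, ap_fun', ap_lift, ap_whiskerRight, lift_lift, sub_ap, wk_ap])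
  str_natural_right X _ _ g := ext' (by
    simp [ap_comp, ap_fun', ap_lift, ap_whiskerLeft, lift_lift, sub_ap])
  str_unit Y := ext' (by
    simp [ap_comp, ap_fun', ap_lift, ap_leftUnitor, lift_lift])
  str_assoc X Y Z := ext' (by
    simp [ap_comp, ap_fun', ap_lift, ap_associator, ap_whiskerLeft, lift_lift])

/-- The component `λ x. up x` of `S_{m₁ ≤ m₂}`. -/
def upTo {m₁ m₂ : M} (h : m₁ ≤ m₂) (A : Cl M) : (endo m₁).obj A ⟶ (endo m₂).obj A :=
  fun' (up h (var .z) : Q [Ty.gr m₁ A] (Ty.gr m₂ A))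

/-- `S_{m₁ ≤ m₂}` is `λ x. up x`. -/
def upTrans {m₁ m₂ : M} (h : m₁ ≤ m₂) : endo m₁ ⟶ endo m₂ :=
  (⟨upTo h,
    fun f => ext' (by simp [endo, upTo, ap_comp, ap_fun', ap_lift, lift_up]),
    fun A B => ext' (by simp [endo, upTo, ap_comp, ap_fun', ap_whiskerLeft, lift_up])⟩ :
    StrongEndo.Hom (endo m₁) (endo m₂))

theorem upTo_refl {m : M} (h : m ≤ m) (A : Cl M) : upTo h A = 𝟙 ((endo m).obj A) :=
  ext' (by simp [endo, upTo, ap_id, ap_fun'])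

theorem upTo_trans {m₁ m₂ m₃ : M} (h : m₁ ≤ m₂) (h' : m₂ ≤ m₃) (A : Cl M) :
    upTo (h.trans h') A = upTo h A ≫ upTo h' A :=
  ext' (by simp [endo, upTo, ap_comp, ap_fun', up_trans])

/-- The isomorphism `λ x. ret x`, with inverse `λ x. extr x`. -/
def retIso (A : Cl M) : A ≅ (endo (1 : M)).obj A where
  hom := fun' (ret (var .z) : Q [A] (Ty.gr 1 A))
  inv := fun' (extr (var .z) : Q [Ty.gr 1 A] A)
  hom_inv_id := ext' (by simp [endo, ap_comp, ap_id, ap_fun'])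
  inv_hom_id := ext' (by simp [endo, ap_comp, ap_id, ap_fun'])

theorem retIso_natural (f : A ⟶ B) :
    f ≫ (retIso B).hom = (retIso A).hom ≫ (endo (1 : M)).map f := ext' (by
  simp [endo, retIso, ap_comp, ap_fun', ap_lift, lift_ret, sub_ap])

theorem retIso_strong (A B : Cl M) :
    (retIso (A ⊗ B)).hom = A ◁ (retIso B).hom ≫ (endo (1 : M)).str A B := ext' (by
  simp [endo, retIso, ap_comp, ap_fun', ap_whiskerLeft, lift_ret])

/-- The isomorphism `λ x. join x`, with inverse `λ x. fork x`. -/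
def joinIso (m₁ m₂ : M) (A : Cl M) :
    (endo m₁).obj ((endo m₂).obj A) ≅ (endo (m₁ * m₂)).obj A where
  hom := fun' (join rfl (var .z) : Q [Ty.gr m₁ (Ty.gr m₂ A)] (Ty.gr (m₁ * m₂) A))
  inv := fun' (fork rfl (var .z) : Q [Ty.gr (m₁ * m₂) A] (Ty.gr m₁ (Ty.gr m₂ A)))
  hom_inv_id := ext' (by simp [endo, ap_comp, ap_id, ap_fun'])
  inv_hom_id := ext' (by simp [endo, ap_comp, ap_id, ap_fun'])

theorem joinIso_natural (m₁ m₂ : M) (f : A ⟶ B) :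
    (endo m₁).map ((endo m₂).map f) ≫ (joinIso m₁ m₂ B).hom =
      (joinIso m₁ m₂ A).hom ≫ (endo (m₁ * m₂)).map f := ext' (by
  simp [endo, joinIso, ap_comp, ap_fun', ap_lift, lift_join', sub_ap])

theorem joinIso_strong (m₁ m₂ : M) (A B : Cl M) :
    ((endo m₁).str A ((endo m₂).obj B) ≫ (endo m₁).map ((endo m₂).str A B)) ≫
        (joinIso m₁ m₂ (A ⊗ B)).hom =
      A ◁ (joinIso m₁ m₂ B).hom ≫ (endo (m₁ * m₂)).str A B := ext' (by
  simp [endo, joinIso, ap_comp, ap_fun', ap_lift, ap_whiskerLeft, lift_join', lift_lift])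

theorem upTo_join {m₁ m₁' : M} (h : m₁ ≤ m₁') (m₂ : M) (h' : m₁ * m₂ ≤ m₁' * m₂) (A : Cl M) :
    upTo h ((endo m₂).obj A) ≫ (joinIso m₁' m₂ A).hom = (joinIso m₁ m₂ A).hom ≫ upTo h' A :=
  ext' (by simp [endo, upTo, joinIso, ap_comp, ap_fun', join_up rfl h rfl h'])

theorem map_upTo_join (m₁ : M) {m₂ m₂' : M} (h : m₂ ≤ m₂') (h' : m₁ * m₂ ≤ m₁ * m₂') (A : Cl M) :
    (endo m₁).map (upTo h A) ≫ (joinIso m₁ m₂' A).hom = (joinIso m₁ m₂ A).hom ≫ upTo h' A :=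
  ext' (by simp [endo, upTo, joinIso, ap_comp, ap_fun', ap_lift, join_lift_up rfl h rfl h'])

theorem up_join {m₁ m₂ n n' : M} (h : n ≤ n') (e : m₁ * m₂ = n) (e' : m₁ * m₂ = n')
    (a : Q Γ (.gr m₁ (.gr m₂ A))) : up h (join e a) = join e' a := by
  subst e; subst e'; simp

theorem join_assoc (m₁ m₂ m₃ : M) (h : m₁ * m₂ * m₃ ≤ m₁ * (m₂ * m₃)) (A : Cl M) :
    (joinIso m₁ m₂ ((endo m₃).obj A)).hom ≫ (joinIso (m₁ * m₂) m₃ A).hom ≫ upTo h A =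
      (endo m₁).map (joinIso m₂ m₃ A).hom ≫ (joinIso m₁ (m₂ * m₃) A).hom :=
  ext' (by
    simp [endo, upTo, joinIso, ap_comp, ap_fun', ap_lift]
    rw [join_join rfl rfl rfl (mul_assoc m₁ m₂ m₃).symm, up_join h _ rfl])

theorem ret_join (m : M) (h : 1 * m ≤ m) (A : Cl M) :
    (retIso ((endo m).obj A)).hom ≫ (joinIso 1 m A).hom ≫ upTo h A = 𝟙 ((endo m).obj A) :=
  ext' (by
    simp [endo, upTo, joinIso, retIso, ap_comp, ap_id, ap_fun']
    rw [up_join h _ (one_mul m), join_ret])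

theorem map_ret_join (m : M) (h : m * 1 ≤ m) (A : Cl M) :
    (endo m).map (retIso A).hom ≫ (joinIso m 1 A).hom ≫ upTo h A = 𝟙 ((endo m).obj A) :=
  ext' (by
    simp [endo, upTo, joinIso, retIso, ap_comp, ap_id, ap_fun', ap_lift]
    rw [up_join h _ (mul_one m), bind_idr])

end Cl

/-- The generic model, a strong monoidal functor to the strong endofunctors of the classifying
category. -/
def generic (M : Type u) [Monoid M] [Preorder M] : M ⥤ StrongEndo (Cl M) where
  obj m := Cl.endo m
  map f := Cl.upTrans f.le
  map_id m := StrongEndo.hom_ext fun A => Cl.upTo_refl le_rfl A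
  map_comp f g := StrongEndo.hom_ext fun A => Cl.upTo_trans f.le g.le A

section

variable [MulLeftMono M] [MulRightMono M]

/-- The generic model is strong monoidal, with `η = λ x. ret x`, `ε = λ x. extr x`,
`μ = λ x. join x` and `δ = λ x. fork x`. -/
def genericCore : (generic M).CoreMonoidal where
  εIso := StrongEndo.isoOfId StrongEndo.unit (Cl.endo 1) Cl.retIso Cl.retIso_natural
    (fun A B => (Category.id_comp _).trans (Cl.retIso_strong A B))
  μIso m₁ m₂ := StrongEndo.isoOfId (StrongEndo.comp (Cl.endo m₁) (Cl.endo m₂)) (Cl.endo (m₁ * m₂))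
    (Cl.joinIso m₁ m₂) (Cl.joinIso_natural m₁ m₂) (Cl.joinIso_strong m₁ m₂)
  μIso_hom_natural_left f m₂ := StrongEndo.hom_ext fun A => Cl.upTo_join f.le m₂ _ A
  μIso_hom_natural_right m₁ f := StrongEndo.hom_ext fun A => Cl.map_upTo_join m₁ f.le _ A
  associativity m₁ m₂ m₃ := StrongEndo.hom_ext fun A =>
    (Cl.join_assoc m₁ m₂ m₃ (mul_assoc m₁ m₂ m₃).le A).trans (Category.id_comp _).symm
  left_unitality m := StrongEndo.hom_ext fun A => (Cl.ret_join m (one_mul m).le A).symm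
  right_unitality m := StrongEndo.hom_ext fun A => (Cl.map_ret_join m (mul_one m).le A).symm

instance : (generic M).Monoidal := genericCore.toMonoidal

end

end GMCC

/-! The theorem rests on soundness in every model and on identifying the generic model with the
syntax.

Soundness. After uncurrying, a function in context `X` is a morphism `X ⊗ Y ⟶ Z`, that is, a
morphism from `Y` to `Z` in the co-Kleisli category of `X ⊗ -`. A strength makes an endofunctor act
there: `smap F f = str ≫ F.map f` preserves identities by the unit law of the strength (`smap_snd`)
and composites by its associativity law (`lift_fst_smap`), and strong natural transformations are
natural for it (`whiskerLeft_app_smap`). Since `lift` is interpreted by `smap`, the graded rules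
reduce to the laws of a strong monoidal functor, the comonadic ones by inverting `join`. With the
substitution lemma `interpTm_sub` this yields `interpTm_eq_of_eqv`.

Generic model. Replacing the variables of a term by the projections of a single variable gives a
morphism `homOf a` out of the product of the context; evaluating it at the tuple of variables gives
`a` back, so `homOf` is injective on classes. Each combinator of `Cl` acts on terms as the term
former that it interprets, so the interpretation in the generic model is `homOf` (`interp_generic`).
This gives part 2, and part 1 because the generic model is one of the models. Part 3 is soundness of
`W` followed by `F`.

Universal property. By soundness, a model interprets classes of closed terms, which defines a
functor `classify S`. It sends projections to projections, so it preserves finite products, and the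
substitution lemma shows that it carries the generic model to `S` (`push_classify`). Conversely, the
image of the generic model under `F` records `F` on objects and, through one-variable terms, on
morphisms, so it determines `F` (`functor_ext_of_push`). -/

namespace GMCC

set_option linter.unusedSectionVars false

/-! ### Chosen binary coproducts -/

section Coproducts

open ChosenFiniteCoproducts

variable {D : Type v} [Category.{w} D] [ChosenFiniteCoproducts D] {Y₁ Y₂ Z : D}

theorem inl_desc (f : Y₁ ⟶ Z) (g : Y₂ ⟶ Z) : inl Y₁ Y₂ ≫ desc f g = f :=
  BinaryCofan.IsColimit.inl_desc (isColimit Y₁ Y₂) f g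

theorem inr_desc (f : Y₁ ⟶ Z) (g : Y₂ ⟶ Z) : inr Y₁ Y₂ ≫ desc f g = g :=
  BinaryCofan.IsColimit.inr_desc (isColimit Y₁ Y₂) f g

theorem coprod_hom_ext {f g : coprod Y₁ Y₂ ⟶ Z} (h : inl Y₁ Y₂ ≫ f = inl Y₁ Y₂ ≫ g)
    (h' : inr Y₁ Y₂ ≫ f = inr Y₁ Y₂ ≫ g) : f = g :=
  BinaryCofan.IsColimit.hom_ext (isColimit Y₁ Y₂) h h'

end Coproducts

section Combinators

open ChosenFiniteCoproducts

variable {D : Type v} [Category.{w} D] [CartesianMonoidalCategory D]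

/-! ### Currying and application in a context -/

section Closed

variable [MonoidalClosed D] {X X' Y Z Z' : D}

theorem lift_snd_fst_whiskerLeft (h : X' ⟶ X) (Y : D) :
    lift (snd X' Y) (fst X' Y) ≫ Y ◁ h = h ▷ Y ≫ lift (snd X Y) (fst X Y) := by
  ext <;> simp

@[simp] theorem uncurryHom_curryHom (f : X ⊗ Y ⟶ Z) : uncurryHom (curryHom f) = f := by
  have h : lift (snd X Y) (fst X Y) ≫ lift (snd Y X) (fst Y X) = 𝟙 _ := by ext <;> simp
  simp [uncurryHom, curryHom, reassoc_of% h]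

@[simp] theorem curryHom_uncurryHom (f : X ⟶ (ihom Y).obj Z) : curryHom (uncurryHom f) = f := by
  have h : lift (snd Y X) (fst Y X) ≫ lift (snd X Y) (fst X Y) = 𝟙 _ := by ext <;> simp
  simp [uncurryHom, curryHom, reassoc_of% h]

theorem uncurryHom_injective :
    Function.Injective (uncurryHom : (X ⟶ (ihom Y).obj Z) → (X ⊗ Y ⟶ Z)) :=
  Function.LeftInverse.injective curryHom_uncurryHom

theorem uncurryHom_comp (h : X' ⟶ X) (f : X ⟶ (ihom Y).obj Z) :
    uncurryHom (h ≫ f) = h ▷ Y ≫ uncurryHom f := by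
  simp only [uncurryHom, MonoidalClosed.uncurry_natural_left, ← Category.assoc,
    lift_snd_fst_whiskerLeft]

theorem comp_curryHom (h : X' ⟶ X) (f : X ⊗ Y ⟶ Z) :
    h ≫ curryHom f = curryHom (h ▷ Y ≫ f) :=
  uncurryHom_injective (by simp [uncurryHom_comp])

theorem comp_appHom (h : X' ⟶ X) (f : X ⟶ (ihom Y).obj Z) (a : X ⟶ Y) :
    h ≫ appHom f a = appHom (h ≫ f) (h ≫ a) := by
  simp [appHom, uncurryHom_comp, ← Category.assoc, comp_lift]

theorem appHom_fst_comp_snd (f : X ⟶ (ihom Y).obj Z) :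
    appHom (fst X Y ≫ f) (snd X Y) = uncurryHom f := by
  rw [appHom, uncurryHom_comp, ← Category.assoc]
  simp

/-- Applying a weakened function under a binder is composition in the co-Kleisli category of `X ⊗
-`. The rules that mention `f.wk` are evaluated in this way. -/
theorem appHom_fst_comp (f : X ⟶ (ihom Y).obj Z) (a : X ⊗ Z' ⟶ Y) :
    appHom (fst X Z' ≫ f) a = lift (fst X Z') a ≫ uncurryHom f := by
  rw [appHom, uncurryHom_comp, ← Category.assoc]
  simp

/-! ### Copairing in a context -/

section Coproducts

variable [ChosenFiniteCoproducts D] {Y₁ Y₂ : D}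

/-- Copairing in a context. -/
def ctxDesc (f : X ⊗ Y₁ ⟶ Z) (g : X ⊗ Y₂ ⟶ Z) : X ⊗ coprod Y₁ Y₂ ⟶ Z :=
  MonoidalClosed.uncurry (desc (MonoidalClosed.curry f) (MonoidalClosed.curry g))

theorem whiskerLeft_inl_ctxDesc (f : X ⊗ Y₁ ⟶ Z) (g : X ⊗ Y₂ ⟶ Z) :
    X ◁ inl Y₁ Y₂ ≫ ctxDesc f g = f := by
  rw [ctxDesc, ← MonoidalClosed.uncurry_natural_left, inl_desc, MonoidalClosed.uncurry_curry]

theorem whiskerLeft_inr_ctxDesc (f : X ⊗ Y₁ ⟶ Z) (g : X ⊗ Y₂ ⟶ Z) :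
    X ◁ inr Y₁ Y₂ ≫ ctxDesc f g = g := by
  rw [ctxDesc, ← MonoidalClosed.uncurry_natural_left, inr_desc, MonoidalClosed.uncurry_curry]

/-- `X ⊗ -` is a left adjoint and so preserves coproducts: currying `X` away leaves two morphisms
out of the coproduct itself. -/
theorem ctx_coprod_hom_ext {f g : X ⊗ coprod Y₁ Y₂ ⟶ Z}
    (h : X ◁ inl Y₁ Y₂ ≫ f = X ◁ inl Y₁ Y₂ ≫ g)
    (h' : X ◁ inr Y₁ Y₂ ≫ f = X ◁ inr Y₁ Y₂ ≫ g) : f = g := by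
  apply MonoidalClosed.curry_injective
  apply coprod_hom_ext <;> simp only [← MonoidalClosed.curry_natural_left, h, h']

theorem ctx_initial_hom_ext (f g : X ⊗ initial ⟶ Z) : f = g :=
  MonoidalClosed.curry_injective (isInitial.hom_ext _ _)

theorem caseHom_eq (a : X ⟶ coprod Y₁ Y₂) (b₁ : X ⟶ (ihom Y₁).obj Z) (b₂ : X ⟶ (ihom Y₂).obj Z) :
    caseHom a b₁ b₂ = lift (𝟙 X) a ≫ ctxDesc (uncurryHom b₁) (uncurryHom b₂) := rfl

theorem whiskerRight_ctxDesc (h : X' ⟶ X) (f : X ⊗ Y₁ ⟶ Z) (g : X ⊗ Y₂ ⟶ Z) :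
    h ▷ coprod Y₁ Y₂ ≫ ctxDesc f g = ctxDesc (h ▷ Y₁ ≫ f) (h ▷ Y₂ ≫ g) := by
  apply ctx_coprod_hom_ext
  · rw [whiskerLeft_inl_ctxDesc, whisker_exchange_assoc, whiskerLeft_inl_ctxDesc]
  · rw [whiskerLeft_inr_ctxDesc, whisker_exchange_assoc, whiskerLeft_inr_ctxDesc]

theorem comp_caseHom (h : X' ⟶ X) (a : X ⟶ coprod Y₁ Y₂) (b₁ : X ⟶ (ihom Y₁).obj Z)
    (b₂ : X ⟶ (ihom Y₂).obj Z) :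
    h ≫ caseHom a b₁ b₂ = caseHom (h ≫ a) (h ≫ b₁) (h ≫ b₂) := by
  simp only [caseHom_eq, uncurryHom_comp, ← whiskerRight_ctxDesc]
  simp [← Category.assoc, comp_lift]

theorem caseHom_inl (a : X ⟶ Y₁) (b₁ : X ⟶ (ihom Y₁).obj Z) (b₂ : X ⟶ (ihom Y₂).obj Z) :
    caseHom (a ≫ inl Y₁ Y₂) b₁ b₂ = appHom b₁ a := by
  rw [caseHom_eq, appHom, ← lift_whiskerLeft, Category.assoc, whiskerLeft_inl_ctxDesc]

theorem caseHom_inr (a : X ⟶ Y₂) (b₁ : X ⟶ (ihom Y₁).obj Z) (b₂ : X ⟶ (ihom Y₂).obj Z) :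
    caseHom (a ≫ inr Y₁ Y₂) b₁ b₂ = appHom b₂ a := by
  rw [caseHom_eq, appHom, ← lift_whiskerLeft, Category.assoc, whiskerLeft_inr_ctxDesc]

end Coproducts

end Closed

/-! ### Strong endofunctors acting on morphisms in a context -/

section Strength

variable (F : StrongEndo D) {X X' Y Z V : D}

/-- The action of a strong endofunctor on morphisms in a context. -/
def smap (f : X ⊗ Y ⟶ Z) : X ⊗ F.obj Y ⟶ F.obj Z := F.str X Y ≫ F.map f

theorem whiskerRight_smap (h : X' ⟶ X) (f : X ⊗ Y ⟶ Z) :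
    h ▷ F.obj Y ≫ smap F f = smap F (h ▷ Y ≫ f) := by
  rw [smap, smap, ← Category.assoc, F.str_natural_left, Category.assoc, ← F.map_comp]

theorem whiskerLeft_map_smap (g : V ⟶ Y) (f : X ⊗ Y ⟶ Z) :
    X ◁ F.map g ≫ smap F f = smap F (X ◁ g ≫ f) := by
  rw [smap, smap, ← Category.assoc, F.str_natural_right, Category.assoc, ← F.map_comp]

theorem smap_comp_map (f : X ⊗ Y ⟶ Z) (g : Z ⟶ V) : smap F f ≫ F.map g = smap F (f ≫ g) := by
  rw [smap, smap, Category.assoc, ← F.map_comp]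

/-- `snd` is the identity of `Y` in the co-Kleisli category. It factors through the terminal
context, where the unit law of the strength applies. -/
theorem smap_snd (X Y : D) : smap F (snd X Y) = snd X (F.obj Y) := by
  have h : snd X Y = toUnit X ▷ Y ≫ (λ_ Y).hom := by simp [leftUnitor_hom]
  rw [h, ← whiskerRight_smap, smap, F.str_unit]
  simp [leftUnitor_hom]

/-- Functoriality of `smap` for co-Kleisli composition, a consequence of the associativity law of
the strength and of its naturality along the diagonal of `X`. -/
theorem lift_fst_smap (f : X ⊗ Y ⟶ Z) (g : X ⊗ Z ⟶ V) :
    lift (fst X (F.obj Y)) (smap F f) ≫ smap F g = smap F (lift (fst X Y) f ≫ g) := by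
  -- Co-Kleisli composition uses the context twice. Factoring the pairing through the diagonal
  -- exposes the associator that occurs in `str_assoc`.
  have h₁ : lift (fst X (F.obj Y)) (smap F f) =
      lift (𝟙 X) (𝟙 X) ▷ F.obj Y ≫ (α_ X X (F.obj Y)).hom ≫ X ◁ F.str X Y ≫ X ◁ F.map f := by
    have h : lift (𝟙 X) (𝟙 X) ▷ F.obj Y ≫ (α_ X X (F.obj Y)).hom = lift (fst _ _) (𝟙 _) := by
      ext <;> simp
    rw [reassoc_of% h]; simp [smap]
  have h₂ : lift (fst X Y) f = lift (𝟙 X) (𝟙 X) ▷ Y ≫ (α_ X X Y).hom ≫ X ◁ f := by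
    have h : lift (𝟙 X) (𝟙 X) ▷ Y ≫ (α_ X X Y).hom = lift (fst _ _) (𝟙 _) := by ext <;> simp
    rw [reassoc_of% h]; simp
  have h₃ : (α_ X X (F.obj Y)).hom ≫ X ◁ F.str X Y ≫ smap F (X ◁ f ≫ g) =
      smap F ((α_ X X Y).hom ≫ X ◁ f ≫ g) := by
    simp only [smap, F.map_comp, ← Category.assoc]
    rw [F.str_assoc]
    simp only [Category.assoc]
  rw [h₁, h₂]
  simp only [Category.assoc]
  rw [whiskerLeft_map_smap, h₃, whiskerRight_smap]

variable {F} {G : StrongEndo D}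

/-- Naturality in the co-Kleisli category: ordinary naturality combined with compatibility with the
strengths. Applied to `up`, `ret`, `extr` and `join`, it moves each of them across a `lift`. -/
theorem whiskerLeft_app_smap (α : F ⟶ G) (f : X ⊗ Y ⟶ Z) :
    X ◁ StrongEndo.app α Y ≫ smap G f = smap F f ≫ StrongEndo.app α Z := by
  rw [smap, smap, ← Category.assoc, ← StrongEndo.strong, Category.assoc, Category.assoc,
    StrongEndo.naturality]

theorem smap_unit (f : X ⊗ Y ⟶ Z) : smap StrongEndo.unit f = f := Category.id_comp f

theorem smap_comp (f : X ⊗ Y ⟶ Z) : smap (StrongEndo.comp F G) f = smap F (smap G f) := by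
  simp [smap, StrongEndo.comp]

end Strength

end Combinators

/-! ### Laws of the graded structure maps of a model -/

section Soundness

open ChosenFiniteCoproducts

variable {M : Type u} [Monoid M] [Preorder M] [MulLeftMono M] [MulRightMono M]
  {D : Type v} [Category.{w} D] [CartesianMonoidalCategory D] (S : M ⥤ StrongEndo D)

theorem upHom_refl {m : M} (h : m ≤ m) (X : D) : upHom S h X = 𝟙 _ :=
  congrArg (StrongEndo.app · X) (S.map_id m)

theorem upHom_trans {m₁ m₂ m₃ : M} (h : m₁ ≤ m₂) (h' : m₂ ≤ m₃) (h'' : m₁ ≤ m₃) (X : D) :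
    upHom S h X ≫ upHom S h' X = upHom S h'' X :=
  (congrArg (StrongEndo.app · X) (S.map_comp (homOfLE h) (homOfLE h'))).symm

variable {X Y Z : D}

theorem whiskerLeft_upHom_smap {m₁ m₂ : M} (h : m₁ ≤ m₂) (f : X ⊗ Y ⟶ Z) :
    X ◁ upHom S h Y ≫ smap (S.obj m₂) f = smap (S.obj m₁) f ≫ upHom S h Z :=
  whiskerLeft_app_smap _ f

section Monoidal

variable [S.Monoidal]

/-- The multiplication into a grade equal to the product. -/
def joinIn {m₁ m₂ n : M} (e : m₁ * m₂ = n) (X : D) :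
    (S.obj m₁).obj ((S.obj m₂).obj X) ⟶ (S.obj n).obj X :=
  joinHom S m₁ m₂ X ≫ upHom S (le_of_eq e) X

/-- The comultiplication out of a grade equal to the product. -/
def forkIn {m₁ m₂ n : M} (e : m₁ * m₂ = n) (X : D) :
    (S.obj n).obj X ⟶ (S.obj m₁).obj ((S.obj m₂).obj X) :=
  upHom S (le_of_eq e.symm) X ≫ forkHom S m₁ m₂ X

variable {m₁ m₂ m₃ m₁' m₂' m₁₂ m₂₃ n n' m : M}

/-- Statements about `joinIn` are reduced to the multiplication itself by substituting the product
for `n`; the transport then becomes an identity. -/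
theorem joinIn_rfl (m₁ m₂ : M) (X : D) : joinIn S (rfl : m₁ * m₂ = _) X = joinHom S m₁ m₂ X := by
  rw [joinIn, upHom_refl, Category.comp_id]

theorem forkIn_rfl (m₁ m₂ : M) (X : D) : forkIn S (rfl : m₁ * m₂ = _) X = forkHom S m₁ m₂ X := by
  rw [forkIn, upHom_refl, Category.id_comp]

theorem joinHom_forkHom (m₁ m₂ : M) (X : D) : joinHom S m₁ m₂ X ≫ forkHom S m₁ m₂ X = 𝟙 _ :=
  congrArg (StrongEndo.app · X) (Functor.Monoidal.μ_δ S m₁ m₂)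

theorem forkHom_joinHom (m₁ m₂ : M) (X : D) : forkHom S m₁ m₂ X ≫ joinHom S m₁ m₂ X = 𝟙 _ :=
  congrArg (StrongEndo.app · X) (Functor.Monoidal.δ_μ S m₁ m₂)

theorem joinIn_forkIn (e : m₁ * m₂ = n) (X : D) : joinIn S e X ≫ forkIn S e X = 𝟙 _ := by
  subst e; rw [joinIn_rfl, forkIn_rfl, joinHom_forkHom]

theorem forkIn_joinIn (e : m₁ * m₂ = n) (X : D) : forkIn S e X ≫ joinIn S e X = 𝟙 _ := by
  subst e; rw [joinIn_rfl, forkIn_rfl, forkHom_joinHom]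

theorem retHom_extrHom (X : D) : retHom S X ≫ extrHom S X = 𝟙 _ :=
  congrArg (StrongEndo.app · X) (Functor.Monoidal.ε_η S)

theorem extrHom_retHom (X : D) : extrHom S X ≫ retHom S X = 𝟙 _ :=
  congrArg (StrongEndo.app · X) (Functor.Monoidal.η_ε S)

/-- `join` as an isomorphism, with inverse `fork`. -/
def joinInIso (e : m₁ * m₂ = n) (X : D) :
    (S.obj m₁).obj ((S.obj m₂).obj X) ≅ (S.obj n).obj X :=
  ⟨joinIn S e X, forkIn S e X, joinIn_forkIn S e X, forkIn_joinIn S e X⟩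

instance (e : m₁ * m₂ = n) (X : D) : IsIso (joinIn S e X) := (joinInIso S e X).isIso_hom

theorem whiskerLeft_retHom_smap (f : X ⊗ Y ⟶ Z) :
    X ◁ retHom S Y ≫ smap (S.obj 1) f = f ≫ retHom S Z :=
  (whiskerLeft_app_smap (Functor.LaxMonoidal.ε S) f).trans
    (congrArg (· ≫ retHom S Z) (smap_unit f))

theorem smap_extrHom (f : X ⊗ Y ⟶ Z) :
    smap (S.obj 1) f ≫ extrHom S Z = X ◁ extrHom S Y ≫ f :=
  (whiskerLeft_app_smap (Functor.OplaxMonoidal.η S) f).symm.trans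
    (congrArg (X ◁ extrHom S Y ≫ ·) (smap_unit f))

theorem whiskerLeft_joinHom_smap (f : X ⊗ Y ⟶ Z) :
    X ◁ joinHom S m₁ m₂ Y ≫ smap (S.obj (m₁ * m₂)) f =
      smap (S.obj m₁) (smap (S.obj m₂) f) ≫ joinHom S m₁ m₂ Z :=
  (whiskerLeft_app_smap (Functor.LaxMonoidal.μ S m₁ m₂) f).trans
    (congrArg (· ≫ joinHom S m₁ m₂ Z) (smap_comp f))

theorem whiskerLeft_joinIn_smap (e : m₁ * m₂ = n) (f : X ⊗ Y ⟶ Z) :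
    X ◁ joinIn S e Y ≫ smap (S.obj n) f =
      smap (S.obj m₁) (smap (S.obj m₂) f) ≫ joinIn S e Z := by
  subst e; rw [joinIn_rfl, joinIn_rfl, whiskerLeft_joinHom_smap]

/-- `whiskerLeft_joinIn_smap` read through the inverse isomorphism: it suffices to check after
precomposition with `X ◁ joinIn`. -/
theorem smap_forkIn (e : m₁ * m₂ = n) (f : X ⊗ Y ⟶ Z) :
    smap (S.obj n) f ≫ forkIn S e Z =
      X ◁ forkIn S e Y ≫ smap (S.obj m₁) (smap (S.obj m₂) f) := by
  rw [← cancel_epi (X ◁ joinIn S e Y), ← Category.assoc, whiskerLeft_joinIn_smap, Category.assoc,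
    joinIn_forkIn, ← Category.assoc, ← MonoidalCategory.whiskerLeft_comp, joinIn_forkIn]
  simp

theorem upHom_joinIn (h : m₁ ≤ m₁') (e : m₁ * m₂ = n) (e' : m₁' * m₂ = n') (h' : n ≤ n') (X : D) :
    upHom S h ((S.obj m₂).obj X) ≫ joinIn S e' X = joinIn S e X ≫ upHom S h' X := by
  subst e e'
  rw [joinIn_rfl, joinIn_rfl]
  exact congrArg (StrongEndo.app · X) (Functor.LaxMonoidal.μ_natural_left S (homOfLE h) m₂)

theorem map_upHom_joinIn (h : m₂ ≤ m₂') (e : m₁ * m₂ = n) (e' : m₁ * m₂' = n') (h' : n ≤ n')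
    (X : D) :
    (S.obj m₁).map (upHom S h X) ≫ joinIn S e' X = joinIn S e X ≫ upHom S h' X := by
  subst e e'
  rw [joinIn_rfl, joinIn_rfl]
  exact congrArg (StrongEndo.app · X) (Functor.LaxMonoidal.μ_natural_right S m₁ (homOfLE h))

/-- This is the left unit law of a monoidal functor: the unitor of strong endofunctors has identity
components, and the image of the unitor of `M` is the transport contained in `joinIn`. -/
theorem retHom_joinIn (e : 1 * m = m) (X : D) :
    retHom S ((S.obj m).obj X) ≫ joinIn S e X = 𝟙 _ :=
  (congrArg (StrongEndo.app · X) (Functor.LaxMonoidal.left_unitality S m)).symm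

theorem map_retHom_joinIn (e : m * 1 = m) (X : D) :
    (S.obj m).map (retHom S X) ≫ joinIn S e X = 𝟙 _ :=
  (congrArg (StrongEndo.app · X) (Functor.LaxMonoidal.right_unitality S m)).symm

theorem joinIn_joinIn (e₁₂ : m₁ * m₂ = m₁₂) (e : m₁₂ * m₃ = n) (e₂₃ : m₂ * m₃ = m₂₃)
    (e' : m₁ * m₂₃ = n) (X : D) :
    joinIn S e₁₂ ((S.obj m₃).obj X) ≫ joinIn S e X =
      (S.obj m₁).map (joinIn S e₂₃ X) ≫ joinIn S e' X := by
  have h := congrArg (StrongEndo.app · X) (Functor.LaxMonoidal.associativity S m₁ m₂ m₃)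
  -- The associator of strong endofunctors has identity components, while that of `M` is sent to an
  -- `upHom`.
  have h' : joinHom S m₁ m₂ ((S.obj m₃).obj X) ≫ joinHom S (m₁ * m₂) m₃ X ≫
      upHom S (mul_assoc m₁ m₂ m₃).le X =
        (S.obj m₁).map (joinHom S m₂ m₃ X) ≫ joinHom S m₁ (m₂ * m₃) X :=
    h.trans (Category.id_comp _)
  -- The remaining equation `e` is now associativity of the monoid, so `joinIn S e` already consists
  -- of the last two factors on the left of `h'`.
  subst e₁₂ e₂₃ e'
  rw [joinIn_rfl, joinIn_rfl, joinIn_rfl, ← h']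
  rfl

/-- Conjugating `upHom_joinIn` by the two isomorphisms `join` turns it into this equation. -/
theorem upHom_forkIn (h : m₁ ≤ m₁') (e : m₁ * m₂ = n) (e' : m₁' * m₂ = n') (h' : n ≤ n') (X : D) :
    upHom S h' X ≫ forkIn S e' X = forkIn S e X ≫ upHom S h ((S.obj m₂).obj X) := by
  rw [← cancel_epi (joinIn S e X), ← cancel_mono (joinIn S e' X)]
  simp only [Category.assoc, forkIn_joinIn, upHom_joinIn S h e e' h', Category.comp_id]
  rw [← Category.assoc (forkIn S e X), forkIn_joinIn, Category.id_comp]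

theorem upHom_forkIn_map (h : m₂ ≤ m₂') (e : m₁ * m₂ = n) (e' : m₁ * m₂' = n') (h' : n ≤ n')
    (X : D) :
    upHom S h' X ≫ forkIn S e' X = forkIn S e X ≫ (S.obj m₁).map (upHom S h X) := by
  rw [← cancel_epi (joinIn S e X), ← cancel_mono (joinIn S e' X)]
  simp only [Category.assoc, forkIn_joinIn, map_upHom_joinIn S h e e' h', Category.comp_id]
  rw [← Category.assoc (forkIn S e X), forkIn_joinIn, Category.id_comp]

/-- By the unit law `ret` is a section of `join` at grade `1`. So is `fork`, and `join` is
invertible, so the two agree and `extr` undoes both. -/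
theorem forkIn_extrHom (e : 1 * m = m) (X : D) :
    forkIn S e X ≫ extrHom S ((S.obj m).obj X) = 𝟙 _ := by
  have h : forkIn S e X = retHom S ((S.obj m).obj X) := by
    rw [← cancel_mono (joinIn S e X), forkIn_joinIn, retHom_joinIn]
  rw [h, retHom_extrHom]

theorem forkIn_map_extrHom (e : m * 1 = m) (X : D) :
    forkIn S e X ≫ (S.obj m).map (extrHom S X) = 𝟙 _ := by
  have h : forkIn S e X = (S.obj m).map (retHom S X) := by
    rw [← cancel_mono (joinIn S e X), forkIn_joinIn, map_retHom_joinIn]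
  rw [h, ← Functor.map_comp, retHom_extrHom, CategoryTheory.Functor.map_id]

/-- Both sides are inverses of the two composites of isomorphisms equated by `joinIn_joinIn`. -/
theorem forkIn_forkIn (e₁₂ : m₁ * m₂ = m₁₂) (e : m₁₂ * m₃ = n) (e₂₃ : m₂ * m₃ = m₂₃)
    (e' : m₁ * m₂₃ = n) (X : D) :
    forkIn S e X ≫ forkIn S e₁₂ ((S.obj m₃).obj X) =
      forkIn S e' X ≫ (S.obj m₁).map (forkIn S e₂₃ X) := by
  have h := congrArg Iso.inv (Iso.ext (joinIn_joinIn S e₁₂ e e₂₃ e' X) :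
    joinInIso S e₁₂ ((S.obj m₃).obj X) ≪≫ joinInIso S e X =
      (S.obj m₁).mapIso (joinInIso S e₂₃ X) ≪≫ joinInIso S e' X)
  exact h

end Monoidal

end Soundness

/-! ### Interpretation of `lift` and of the `βη`-rules -/

section Soundness

open ChosenFiniteCoproducts

variable {M : Type u} [Monoid M] [Preorder M] [MulLeftMono M] [MulRightMono M]
  {D : Type v} [Category.{w} D] [CartesianMonoidalCategory D] (S : M ⥤ StrongEndo D)

theorem lift_id_comp {X Y Z : D} (a : X ⟶ Y) (f : Y ⟶ Z) :
    lift (𝟙 X) (a ≫ f) = lift (𝟙 X) a ≫ X ◁ f := by simp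

theorem lift_fst_snd_comp {X Y Z : D} (f : Y ⟶ Z) :
    lift (fst X Y) (snd X Y ≫ f) = X ◁ f := by ext <;> simp

variable [MonoidalClosed D]

section Lift

variable {X X' Y Z V : D}

/-- Up to currying, `lift` is `smap`; equations about `lift` are proved by uncurrying and using the
functoriality of `smap`. -/
theorem uncurryHom_liftHom (m : M) (f : X ⟶ (ihom Y).obj Z) :
    uncurryHom (liftHom S m f) = smap (S.obj m) (uncurryHom f) := uncurryHom_curryHom _

theorem comp_liftHom (m : M) (h : X' ⟶ X) (f : X ⟶ (ihom Y).obj Z) :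
    h ≫ liftHom S m f = liftHom S m (h ≫ f) :=
  uncurryHom_injective (by
    rw [uncurryHom_comp, uncurryHom_liftHom, uncurryHom_liftHom, whiskerRight_smap,
      uncurryHom_comp])

theorem appHom_liftHom (m : M) (f : X ⟶ (ihom Y).obj Z) (a : X ⟶ (S.obj m).obj Y) :
    appHom (liftHom S m f) a = lift (𝟙 X) a ≫ smap (S.obj m) (uncurryHom f) := by
  rw [appHom, uncurryHom_liftHom]

theorem appHom_liftHom_fst_comp (m : M) (f : X ⟶ (ihom Y).obj Z) (a : X ⊗ V ⟶ (S.obj m).obj Y) :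
    appHom (liftHom S m (fst X V ≫ f)) a =
      lift (fst X V) a ≫ smap (S.obj m) (uncurryHom f) := by
  rw [← comp_liftHom, appHom_fst_comp, uncurryHom_liftHom]

theorem liftHom_curryHom_snd (X Y : D) (m : M) :
    liftHom S m (curryHom (snd X Y)) = curryHom (snd X ((S.obj m).obj Y)) := by
  apply uncurryHom_injective
  rw [uncurryHom_liftHom, uncurryHom_curryHom, uncurryHom_curryHom, smap_snd]

/-- The content is `lift_fst_smap`. The morphisms `f₁`, `g₁`, `f₂`, `g₂` stand for interpretations
of weakened terms, which agree with a projection followed by the original only through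
`interpTm_wk`. Taking these equations as hypotheses lets the statement match the interpretation of
the rule by unfolding. -/
theorem liftHom_curryHom_appHom (m : M) (f : X ⟶ (ihom Y).obj Z) (g : X ⟶ (ihom Z).obj V)
    {f₁ : X ⊗ Y ⟶ (ihom Y).obj Z} {g₁ : X ⊗ Y ⟶ (ihom Z).obj V}
    {f₂ : X ⊗ (S.obj m).obj Y ⟶ (ihom ((S.obj m).obj Y)).obj ((S.obj m).obj Z)}
    {g₂ : X ⊗ (S.obj m).obj Y ⟶ (ihom ((S.obj m).obj Z)).obj ((S.obj m).obj V)}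
    (hf₁ : f₁ = fst _ _ ≫ f) (hg₁ : g₁ = fst _ _ ≫ g)
    (hf₂ : f₂ = fst _ _ ≫ liftHom S m f) (hg₂ : g₂ = fst _ _ ≫ liftHom S m g) :
    liftHom S m (curryHom (appHom g₁ (appHom f₁ (snd X Y)))) =
      curryHom (appHom g₂ (appHom f₂ (snd X _))) := by
  subst hf₁ hg₁ hf₂ hg₂
  apply uncurryHom_injective
  rw [uncurryHom_liftHom, uncurryHom_curryHom, uncurryHom_curryHom]
  rw [appHom_fst_comp_snd, appHom_fst_comp_snd, appHom_fst_comp, appHom_fst_comp,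
    uncurryHom_liftHom, uncurryHom_liftHom, lift_fst_smap]

end Lift

section Beta

variable {X Y Y₁ Y₂ Z : D}

theorem appHom_curryHom (f : X ⊗ Y ⟶ Z) (a : X ⟶ Y) :
    appHom (curryHom f) a = lift (𝟙 X) a ≫ f := by rw [appHom, uncurryHom_curryHom]

theorem curryHom_appHom_snd (f : X ⟶ (ihom Y).obj Z) {f₁ : X ⊗ Y ⟶ (ihom Y).obj Z}
    (hf₁ : f₁ = fst _ _ ≫ f) : f = curryHom (appHom f₁ (snd X Y)) := by
  rw [hf₁, appHom_fst_comp_snd, curryHom_uncurryHom]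

theorem lift_comp_fst_comp_snd (a : X ⟶ Y ⊗ Z) : a = lift (a ≫ fst Y Z) (a ≫ snd Y Z) := by
  ext <;> simp

variable [ChosenFiniteCoproducts D]

/-- A morphism out of `X ⊗ coprod Y₁ Y₂` is the copairing of its two restrictions, since `X ⊗ -`
preserves coproducts. -/
theorem appHom_eq_caseHom (f : X ⟶ (ihom (coprod Y₁ Y₂)).obj Z) (a : X ⟶ coprod Y₁ Y₂)
    {f₁ : X ⊗ Y₁ ⟶ (ihom (coprod Y₁ Y₂)).obj Z} {f₂ : X ⊗ Y₂ ⟶ (ihom (coprod Y₁ Y₂)).obj Z}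
    (hf₁ : f₁ = fst _ _ ≫ f) (hf₂ : f₂ = fst _ _ ≫ f) :
    appHom f a = caseHom a (curryHom (appHom f₁ (snd X Y₁ ≫ inl Y₁ Y₂)))
      (curryHom (appHom f₂ (snd X Y₂ ≫ inr Y₁ Y₂))) := by
  subst hf₁ hf₂
  simp only [caseHom_eq, uncurryHom_curryHom, appHom_fst_comp, lift_fst_snd_comp]
  rw [appHom]
  congr 1
  apply ctx_coprod_hom_ext
  · rw [whiskerLeft_inl_ctxDesc]
  · rw [whiskerLeft_inr_ctxDesc]

theorem appHom_eq_fromInitial (f : X ⟶ (ihom ChosenFiniteCoproducts.initial).obj Z)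
    (a : X ⟶ ChosenFiniteCoproducts.initial) :
    appHom f a = a ≫ fromInitial Z := by
  rw [appHom, ctx_initial_hom_ext (uncurryHom f) (snd _ _ ≫ fromInitial _), lift_snd_assoc]

end Beta

/-! ### Graded bind and graded extend -/

section Graded

variable {m₁ m₂ m₃ m₁' m₂' m₁₂ m₂₃ n n' m : M} {X Y Z V : D} [S.Monoidal]

/-- Interpretation of the graded bind. -/
def bindHom (e : m₁ * m₂ = n) (a : X ⟶ (S.obj m₁).obj Y) (f : X ⟶ (ihom Y).obj ((S.obj m₂).obj Z)) :
    X ⟶ (S.obj n).obj Z :=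
  appHom (liftHom S m₁ f) a ≫ joinIn S e Z

/-- Interpretation of the graded extend. -/
def extendHom (e : m₁ * m₂ = n) (f : X ⟶ (ihom ((S.obj m₂).obj Y)).obj Z)
    (a : X ⟶ (S.obj n).obj Y) : X ⟶ (S.obj m₁).obj Z :=
  appHom (liftHom S m₁ f) (a ≫ forkIn S e Y)

/-- The normal form used for the monadic rules: with `lift` turned into `smap`, each rule amounts to
moving a structure map across `smap`. -/
theorem bindHom_eq (e : m₁ * m₂ = n) (a : X ⟶ (S.obj m₁).obj Y)
    (f : X ⟶ (ihom Y).obj ((S.obj m₂).obj Z)) :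
    bindHom S e a f = lift (𝟙 X) a ≫ smap (S.obj m₁) (uncurryHom f) ≫ joinIn S e Z := by
  rw [bindHom, appHom_liftHom, Category.assoc]

theorem extendHom_eq (e : m₁ * m₂ = n) (f : X ⟶ (ihom ((S.obj m₂).obj Y)).obj Z)
    (a : X ⟶ (S.obj n).obj Y) :
    extendHom S e f a =
      lift (𝟙 X) a ≫ X ◁ forkIn S e Y ≫ smap (S.obj m₁) (uncurryHom f) := by
  rw [extendHom, appHom_liftHom, lift_id_comp, Category.assoc]

theorem bindHom_fst_comp (e : m₁ * m₂ = n) (a : X ⊗ V ⟶ (S.obj m₁).obj Y)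
    (f : X ⟶ (ihom Y).obj ((S.obj m₂).obj Z)) :
    bindHom S e a (fst X V ≫ f) =
      lift (fst X V) a ≫ smap (S.obj m₁) (uncurryHom f) ≫ joinIn S e Z := by
  rw [bindHom, appHom_liftHom_fst_comp, Category.assoc]

theorem extendHom_fst_comp_snd (e : m₁ * m₂ = n) (f : X ⟶ (ihom ((S.obj m₂).obj Y)).obj Z) :
    extendHom S e (fst X _ ≫ f) (snd X _) =
      X ◁ forkIn S e Y ≫ smap (S.obj m₁) (uncurryHom f) := by
  rw [extendHom, appHom_liftHom_fst_comp, lift_fst_snd_comp]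

theorem bindHom_upHom (h : m₁ ≤ m₁') (e : m₁ * m₂ = n) (e' : m₁' * m₂ = n') (h' : n ≤ n')
    (a : X ⟶ (S.obj m₁).obj Y) (f : X ⟶ (ihom Y).obj ((S.obj m₂).obj Z)) :
    bindHom S e' (a ≫ upHom S h Y) f = bindHom S e a f ≫ upHom S h' Z := by
  simp only [bindHom_eq, lift_id_comp, Category.assoc]
  rw [reassoc_of% whiskerLeft_upHom_smap, upHom_joinIn S h e e' h']

theorem bindHom_curryHom_upHom (h : m₂ ≤ m₂') (e : m₁ * m₂ = n) (e' : m₁ * m₂' = n')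
    (h' : n ≤ n') (a : X ⟶ (S.obj m₁).obj Y) (b : X ⊗ Y ⟶ (S.obj m₂).obj Z) :
    bindHom S e' a (curryHom (b ≫ upHom S h Z)) =
      bindHom S e a (curryHom b) ≫ upHom S h' Z := by
  simp only [bindHom_eq, uncurryHom_curryHom, Category.assoc]
  rw [← smap_comp_map, Category.assoc, map_upHom_joinIn S h e e' h']

theorem bindHom_retHom (e : 1 * m = m) (a : X ⟶ Y) (f : X ⟶ (ihom Y).obj ((S.obj m).obj Z)) :
    bindHom S e (a ≫ retHom S Y) f = appHom f a := by
  simp only [bindHom_eq, lift_id_comp, Category.assoc]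
  rw [reassoc_of% whiskerLeft_retHom_smap, retHom_joinIn, Category.comp_id, appHom]

theorem bindHom_curryHom_retHom (e : m * 1 = m) (a : X ⟶ (S.obj m).obj Y) :
    bindHom S e a (curryHom (snd X Y ≫ retHom S Y)) = a := by
  rw [bindHom_eq, uncurryHom_curryHom, ← smap_comp_map, smap_snd, Category.assoc,
    map_retHom_joinIn, Category.comp_id, lift_snd]

/-- On the right, functoriality of `smap` separates the two functions, and associativity of `join`
regroups the grades. Naturality of `join` with respect to `smap` then carries the inner `join` of
the left side past `g`. -/
theorem bindHom_bindHom (e₁₂ : m₁ * m₂ = m₁₂) (e : m₁₂ * m₃ = n) (e₂₃ : m₂ * m₃ = m₂₃)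
    (e' : m₁ * m₂₃ = n) (a : X ⟶ (S.obj m₁).obj Y) (f : X ⟶ (ihom Y).obj ((S.obj m₂).obj Z))
    (g : X ⟶ (ihom Z).obj ((S.obj m₃).obj V)) {f₁ : X ⊗ Y ⟶ (ihom Y).obj ((S.obj m₂).obj Z)}
    {g₁ : X ⊗ Y ⟶ (ihom Z).obj ((S.obj m₃).obj V)} (hf₁ : f₁ = fst _ _ ≫ f)
    (hg₁ : g₁ = fst _ _ ≫ g) :
    bindHom S e (bindHom S e₁₂ a f) g =
      bindHom S e' a (curryHom (bindHom S e₂₃ (appHom f₁ (snd X Y)) g₁)) := by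
  subst hf₁ hg₁
  -- The function `g` needs the context again after `f` has been applied, so both sides are factored
  -- through the graph of `a`.
  have h : ∀ (k : X ⊗ (S.obj m₁).obj Y ⟶ (S.obj m₁₂).obj Z),
      lift (𝟙 X) (lift (𝟙 X) a ≫ k) = lift (𝟙 X) a ≫ lift (fst _ _) k := by
    intro k; simp [comp_lift]
  rw [bindHom_eq S e', uncurryHom_curryHom, appHom_fst_comp_snd, bindHom_fst_comp,
    ← lift_fst_smap, ← smap_comp_map, Category.assoc, Category.assoc,
    ← joinIn_joinIn S e₁₂ e e₂₃ e', bindHom_eq, bindHom_eq, h]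
  have h' : lift (fst X _) (smap (S.obj m₁) (uncurryHom f) ≫ joinIn S e₁₂ Z) =
      lift (fst X _) (smap (S.obj m₁) (uncurryHom f)) ≫ X ◁ joinIn S e₁₂ Z := by simp
  rw [h']
  simp only [Category.assoc]
  rw [reassoc_of% whiskerLeft_joinIn_smap]

theorem extendHom_upHom (h : m₁ ≤ m₁') (e : m₁ * m₂ = n) (e' : m₁' * m₂ = n') (h' : n ≤ n')
    (f : X ⟶ (ihom ((S.obj m₂).obj Y)).obj Z) (a : X ⟶ (S.obj n).obj Y) :
    extendHom S e' f (a ≫ upHom S h' Y) = extendHom S e f a ≫ upHom S h Z := by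
  simp only [extendHom_eq, lift_id_comp, Category.assoc]
  rw [← whiskerLeft_upHom_smap, ← MonoidalCategory.whiskerLeft_comp_assoc,
    ← MonoidalCategory.whiskerLeft_comp_assoc, upHom_forkIn S h e e' h']

theorem extendHom_curryHom_upHom (h : m₂ ≤ m₂') (e : m₁ * m₂ = n) (e' : m₁ * m₂' = n')
    (h' : n ≤ n') (f : X ⟶ (ihom ((S.obj m₂').obj Y)).obj Z) (a : X ⟶ (S.obj n).obj Y)
    {f₁ : X ⊗ (S.obj m₂).obj Y ⟶ (ihom ((S.obj m₂').obj Y)).obj Z} (hf₁ : f₁ = fst _ _ ≫ f) :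
    extendHom S e' f (a ≫ upHom S h' Y) =
      extendHom S e (curryHom (appHom f₁ (snd X _ ≫ upHom S h Y))) a := by
  subst hf₁
  simp only [extendHom_eq, lift_id_comp, Category.assoc, uncurryHom_curryHom, appHom_fst_comp,
    lift_fst_snd_comp]
  rw [← whiskerLeft_map_smap, ← MonoidalCategory.whiskerLeft_comp_assoc,
    ← MonoidalCategory.whiskerLeft_comp_assoc, upHom_forkIn_map S h e e' h']

theorem extendHom_extrHom (e : 1 * m = m) (f : X ⟶ (ihom ((S.obj m).obj Y)).obj Z)
    (a : X ⟶ (S.obj m).obj Y) : extendHom S e f a ≫ extrHom S Z = appHom f a := by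
  simp only [extendHom_eq, Category.assoc]
  rw [smap_extrHom, ← MonoidalCategory.whiskerLeft_comp_assoc, forkIn_extrHom,
    MonoidalCategory.whiskerLeft_id, Category.id_comp, appHom]

theorem extendHom_curryHom_extrHom (e : m * 1 = m) (a : X ⟶ (S.obj m).obj Y) :
    extendHom S e (curryHom (snd X _ ≫ extrHom S Y)) a = a := by
  rw [extendHom_eq, uncurryHom_curryHom, ← smap_comp_map, smap_snd, whiskerLeft_snd_assoc,
    forkIn_map_extrHom, Category.comp_id, lift_snd]

/-- Dual to `bindHom_bindHom`: naturality of `fork` with respect to `smap` and coassociativity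
replace the corresponding facts about `join`. -/
theorem extendHom_extendHom (e₁₂ : m₁ * m₂ = m₁₂) (e : m₁₂ * m₃ = n) (e₂₃ : m₂ * m₃ = m₂₃)
    (e' : m₁ * m₂₃ = n) (f : X ⟶ (ihom ((S.obj m₃).obj Y)).obj Z)
    (g : X ⟶ (ihom ((S.obj m₂).obj Z)).obj V) (a : X ⟶ (S.obj n).obj Y)
    {f₁ : X ⊗ (S.obj m₂₃).obj Y ⟶ (ihom ((S.obj m₃).obj Y)).obj Z}
    {g₁ : X ⊗ (S.obj m₂₃).obj Y ⟶ (ihom ((S.obj m₂).obj Z)).obj V} (hf₁ : f₁ = fst _ _ ≫ f)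
    (hg₁ : g₁ = fst _ _ ≫ g) :
    extendHom S e₁₂ g (extendHom S e f a) =
      extendHom S e' (curryHom (appHom g₁ (extendHom S e₂₃ f₁ (snd X _)))) a := by
  subst hf₁ hg₁
  have h : ∀ {W : D} (k : X ⊗ (S.obj n).obj Y ⟶ W),
      lift (𝟙 X) (lift (𝟙 X) a ≫ k) = lift (𝟙 X) a ≫ lift (fst _ _) k := by
    intro W k; simp [comp_lift]
  -- The part of the equation that involves neither `a` nor `g`: forking twice before applying `f`
  -- is the same as forking, applying `f` and forking the result.
  have h' : X ◁ forkIn S e' Y ≫ lift (fst _ _) (smap (S.obj m₁)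
      (X ◁ forkIn S e₂₃ Y ≫ smap (S.obj m₂) (uncurryHom f))) =
      lift (fst _ _) (X ◁ forkIn S e Y ≫ smap (S.obj m₁₂) (uncurryHom f)) ≫
        X ◁ forkIn S e₁₂ Z := by
    rw [lift_whiskerLeft, comp_lift, whiskerLeft_fst, Category.assoc, smap_forkIn,
      ← whiskerLeft_map_smap, ← MonoidalCategory.whiskerLeft_comp_assoc,
      ← MonoidalCategory.whiskerLeft_comp_assoc, forkIn_forkIn S e₁₂ e e₂₃ e']
  rw [extendHom_eq S e', uncurryHom_curryHom, extendHom_fst_comp_snd, appHom_fst_comp,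
    ← lift_fst_smap, ← Category.assoc (X ◁ _), h', extendHom_eq, extendHom_eq, h]
  simp only [Category.assoc]

end Graded

/-! ### Substitution lemma and soundness -/

variable [ChosenFiniteCoproducts D] [S.Monoidal]

/-- The morphism `h` is not built from `ρ`; it is any morphism with the right effect on variables.
This makes the binder case immediate with `h ▷ _`, and weakening is the instance `h = fst`. -/
theorem interpTm_ren {Γ : Ctx M} {A : Ty M} (t : Tm Γ A) : ∀ {Δ : Ctx M} (ρ : Ren Γ Δ)
    (h : ctxObj (interpTy S) Δ ⟶ ctxObj (interpTy S) Γ),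
    (∀ ⦃B : Ty M⦄ (x : Var Γ B), varHom (interpTy S) (ρ x) = h ≫ varHom (interpTy S) x) →
      interpTm S (t.ren ρ) = h ≫ interpTm S t := by
  induction t with
  | var x => intro _ _ _ H; exact H x
  | lam b ih =>
    intro Δ ρ h H
    refine (congrArg curryHom (ih (ρ.ext _) (h ▷ _) fun B x => ?_)).trans (comp_curryHom h _).symm
    cases x with
    | z => exact (whiskerRight_snd _ _).symm
    | s x =>
      exact (congrArg (fst _ _ ≫ ·) (H x)).trans (whiskerRight_fst_assoc _ _ _).symm
  | app f a ih ih' =>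
    intro _ _ h H; exact (congrArg₂ appHom (ih _ h H) (ih' _ h H)).trans (comp_appHom h _ _).symm
  | case a b c ih ih' ih'' =>
    intro _ _ h H
    exact (congr (congrArg₂ caseHom (ih _ h H) (ih' _ h H)) (ih'' _ h H)).trans
      (comp_caseHom h _ _ _).symm
  | lift m f ih =>
    intro _ _ h H; exact (congrArg (liftHom S m) (ih _ h H)).trans (comp_liftHom S m h _).symm
  | pair a b ih ih' =>
    intro _ _ h H; exact (congrArg₂ lift (ih _ h H) (ih' _ h H)).trans (comp_lift h _ _).symm
  | unit => intro _ _ h H; exact toUnit_unique _ _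
  | fst a ih | snd a ih | inl a ih | inr a ih | abort a ih | ret a ih | extr a ih | join e a ih
  | fork e a ih | up h a ih =>
    intro _ _ h H; exact (congrArg (· ≫ _) (ih _ h H)).trans (Category.assoc _ _ _)

theorem interpTm_wk {Γ : Ctx M} {A B : Ty M} (t : Tm Γ A) :
    interpTm S (t.wk (B := B)) = fst (ctxObj (interpTy S) Γ) (interpTy S B) ≫ interpTm S t :=
  interpTm_ren S t _ _ fun _ _ => rfl

/-- Stated in the same relative form as for renamings, which must come first: extending a
substitution under a binder weakens its terms. -/
theorem interpTm_sub {Γ : Ctx M} {A : Ty M} (t : Tm Γ A) : ∀ {Δ : Ctx M} (σ : Sub Γ Δ)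
    (h : ctxObj (interpTy S) Δ ⟶ ctxObj (interpTy S) Γ),
    (∀ ⦃B : Ty M⦄ (x : Var Γ B), interpTm S (σ x) = h ≫ varHom (interpTy S) x) →
      interpTm S (t.sub σ) = h ≫ interpTm S t := by
  induction t with
  | var x => intro _ _ _ H; exact H x
  | lam b ih =>
    intro Δ σ h H
    refine (congrArg curryHom (ih (σ.ext _) (h ▷ _) fun B x => ?_)).trans (comp_curryHom h _).symm
    cases x with
    | z => exact (whiskerRight_snd _ _).symm
    | s x =>
      exact (interpTm_wk S (σ x)).trans
        ((congrArg (fst _ _ ≫ ·) (H x)).trans (whiskerRight_fst_assoc _ _ _).symm)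
  | app f a ih ih' =>
    intro _ _ h H; exact (congrArg₂ appHom (ih _ h H) (ih' _ h H)).trans (comp_appHom h _ _).symm
  | case a b c ih ih' ih'' =>
    intro _ _ h H
    exact (congr (congrArg₂ caseHom (ih _ h H) (ih' _ h H)) (ih'' _ h H)).trans
      (comp_caseHom h _ _ _).symm
  | lift m f ih =>
    intro _ _ h H; exact (congrArg (liftHom S m) (ih _ h H)).trans (comp_liftHom S m h _).symm
  | pair a b ih ih' =>
    intro _ _ h H; exact (congrArg₂ lift (ih _ h H) (ih' _ h H)).trans (comp_lift h _ _).symm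
  | unit => intro _ _ h H; exact toUnit_unique _ _
  | fst a ih | snd a ih | inl a ih | inr a ih | abort a ih | ret a ih | extr a ih | join e a ih
  | fork e a ih | up h a ih =>
    intro _ _ h H; exact (congrArg (· ≫ _) (ih _ h H)).trans (Category.assoc _ _ _)

theorem interpTm_inst {Γ : Ctx M} {A B : Ty M} (b : Tm (B :: Γ) A) (a : Tm Γ B) :
    interpTm S (b.inst a) = lift (𝟙 _) (interpTm S a) ≫ interpTm S b := by
  refine interpTm_sub S b _ _ fun C x => ?_
  cases x with
  | z => exact (lift_snd _ _).symm
  | s x => exact ((lift_fst_assoc _ _ _).trans (Category.id_comp _)).symm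

/-- Provably equal terms have the same interpretation in every model. -/
theorem interpTm_eq_of_eqv {Γ : Ctx M} {A : Ty M} {a b : Tm Γ A} (h : Eqv a b) :
    interpTm S a = interpTm S b := by
  induction h with
  | refl => rfl
  | symm _ ih => exact ih.symm
  | trans _ _ ih ih' => exact ih.trans ih'
  | lam _ ih => exact congrArg curryHom ih
  | lift m _ ih => exact congrArg (liftHom S m) ih
  | pair _ _ ih ih' => exact congrArg₂ CartesianMonoidalCategory.lift ih ih'
  | fst _ ih | snd _ ih | inl _ ih | inr _ ih | abort _ ih | ret _ ih | extr _ ih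
  | join e _ ih | fork e _ ih | up h _ ih => simp only [interpTm, ih]
  | app _ _ ih ih' => simp only [interpTm, ih, ih']
  | case _ _ _ ih ih' ih'' => simp only [interpTm, ih, ih', ih'']
  | fn_beta b a => exact (appHom_curryHom _ _).trans (interpTm_inst S b a).symm
  | fn_eta f => exact curryHom_appHom_snd _ (interpTm_wk S f)
  | fst_beta a b => exact lift_fst _ _
  | snd_beta a b => exact lift_snd _ _
  | prod_eta a => exact lift_comp_fst_comp_snd _
  | unit_eta a => exact toUnit_unique _ _
  | inl_beta a b c => exact caseHom_inl _ _ _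
  | inr_beta a b c => exact caseHom_inr _ _ _
  | sum_eta f a => exact appHom_eq_caseHom _ _ (interpTm_wk S f) (interpTm_wk S f)
  | void_eta f a => exact appHom_eq_fromInitial _ _
  | lift_id m => exact liftHom_curryHom_snd S _ _ m
  | lift_comp m f g =>
    exact liftHom_curryHom_appHom S m _ _ (interpTm_wk S f) (interpTm_wk S g)
      (interpTm_wk S (.lift m f)) (interpTm_wk S (.lift m g))
  | up_refl h a => exact (congrArg (_ ≫ ·) (upHom_refl S h _)).trans (Category.comp_id _)
  | up_trans h h' h'' a =>
    exact (Category.assoc _ _ _).trans (congrArg (_ ≫ ·) (upHom_trans S h h' h'' _))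
  -- The interpretations of `Tm.bind` and `Tm.extend` unfold to `bindHom` and `extendHom`, so the
  -- graded lemmas apply as they stand.
  | bind_natl h e e' h' a f => exact bindHom_upHom S h e e' h' _ _
  | bind_natr h e e' h' a b => exact bindHom_curryHom_upHom S h e e' h' _ _
  | bind_idl e a f => exact bindHom_retHom S e _ _
  | bind_idr e a => exact bindHom_curryHom_retHom S e _
  | bind_assoc e₁₂ e e₂₃ e' a f g =>
    exact bindHom_bindHom S e₁₂ e e₂₃ e' _ _ _ (interpTm_wk S f) (interpTm_wk S g)
  | extend_natl h e e' h' f a => exact extendHom_upHom S h e e' h' _ _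
  | extend_natr h e e' h' f a => exact extendHom_curryHom_upHom S h e e' h' _ _ (interpTm_wk S f)
  | extend_idl e f a => exact extendHom_extrHom S e _ _
  | extend_idr e a => exact extendHom_curryHom_extrHom S e _
  | extend_assoc e₁₂ e e₂₃ e' f g a =>
    exact extendHom_extendHom S e₁₂ e e₂₃ e' _ _ _ (interpTm_wk S f) (interpTm_wk S g)
  | extr_ret a =>
    exact (Category.assoc _ _ _).trans
      ((congrArg (_ ≫ ·) (retHom_extrHom S _)).trans (Category.comp_id _))
  | ret_extr a =>
    exact (Category.assoc _ _ _).trans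
      ((congrArg (_ ≫ ·) (extrHom_retHom S _)).trans (Category.comp_id _))
  | fork_join e a =>
    exact (Category.assoc _ _ _).trans
      ((congrArg (_ ≫ ·) (joinIn_forkIn S e _)).trans (Category.comp_id _))
  | join_fork e a =>
    exact (Category.assoc _ _ _).trans
      ((congrArg (_ ≫ ·) (forkIn_joinIn S e _)).trans (Category.comp_id _))

end Soundness

/-! ### Combinators of the classifying category computed on terms -/

section Generic

variable {M : Type u} [Monoid M] [Preorder M]

namespace Cl

open Q

variable {Γ Δ : Ctx M} {A B C X Y Z : Cl M}

/-- A morphism of `Cl` is determined by its effect `ap` on a variable, and `ap` turns composites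
into nested applications. Hence each combinator is described by what it does to an arbitrary term.
-/
theorem ap_lift_hom (f : X ⟶ A) (g : X ⟶ B) (a : Q Γ X) :
    ap (CartesianMonoidalCategory.lift f g) a = pair (ap f a) (ap g a) := by
  have h : CartesianMonoidalCategory.lift f g = fun' (pair (ap f (var .z)) (ap g (var .z))) := rfl
  rw [h, ap_fun']; simp [sub_ap]

theorem ap_fst (a : Q Γ (A ⊗ B : Cl M)) : ap (CartesianMonoidalCategory.fst A B) a = Q.fst a :=
  (ap_fun' (Q.fst (var .z)) a).trans (by simp)

theorem ap_snd (a : Q Γ (A ⊗ B : Cl M)) : ap (CartesianMonoidalCategory.snd A B) a = Q.snd a :=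
  (ap_fun' (Q.snd (var .z)) a).trans (by simp)

theorem ap_ihom_map (f : X ⟶ Y) (a : Q Γ ((ihom A).obj X : Cl M)) :
    ap ((ihom A).map f) a = lam (ap f (app (Q.wk (show Q Γ (.fn A X) from a)) (var .z))) :=
  (ap_fun' (lam (ap f (app (var (.s .z)) (var .z)))) a).trans (by simp [sub_ap]; rfl)

theorem ap_coev (a : Q Γ X) :
    ap ((ihom.coev A).app X) a = lam (pair (var .z) a.wk) :=
  (ap_fun' (lam (ap (𝟙 (A ⊗ X : Cl M)) (pair (var .z) (var (.s .z))))) a).trans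
    (by simp [ap_id])

theorem ap_ev (a : Q Γ (A ⊗ (ihom A).obj X : Cl M)) :
    ap ((ihom.ev A).app X) a = app (show Q Γ (.fn A X) from Q.snd a) (Q.fst a) :=
  (ap_fun' (app (ap (𝟙 (Ty.fn A X : Cl M)) (Q.snd (var .z))) (Q.fst (var .z))) a).trans
    (by simp [ap_id]; rfl)

theorem ap_curry (f : A ⊗ X ⟶ Y) (a : Q Γ X) :
    ap (MonoidalClosed.curry f) a = lam (ap f (pair (var .z) a.wk)) := by
  rw [MonoidalClosed.curry_eq, ap_comp, ap_ihom_map, ap_coev]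
  simp
  rfl

theorem ap_uncurry (f : X ⟶ (ihom A).obj Y) (a : Q Γ (A ⊗ X : Cl M)) :
    ap (MonoidalClosed.uncurry f) a = app (show Q Γ (.fn A Y) from ap f (Q.snd a)) (Q.fst a) := by
  rw [MonoidalClosed.uncurry_eq, ap_comp, ap_ev, ap_whiskerLeft, fst_beta]
  exact congrArg (app · _) (snd_beta _ _)

theorem ap_curryHom (f : X ⊗ A ⟶ Y) (a : Q Γ X) :
    ap (curryHom f) a = lam (ap f (pair a.wk (var .z))) := by
  rw [curryHom, ap_curry, ap_comp, ap_lift_hom, ap_fst, ap_snd]; simp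
  rfl

theorem ap_uncurryHom (f : X ⟶ (ihom A).obj Y) (a : Q Γ (X ⊗ A : Cl M)) :
    ap (uncurryHom f) a = app (ap f (Q.fst a)) (Q.snd a) := by
  rw [uncurryHom, ap_comp, ap_uncurry, ap_lift_hom, ap_fst, ap_snd]; simp

theorem ap_appHom (f : X ⟶ (ihom A).obj Y) (b : X ⟶ A) (a : Q Γ X) :
    ap (appHom f b) a = app (ap f a) (ap b a) := by
  rw [appHom, ap_comp, ap_uncurryHom, ap_lift_hom, ap_id]; simp

theorem ap_desc (f : A ⟶ Y) (g : B ⟶ Y) (a : Q Γ (.sum A B)) :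
    ap (ChosenFiniteCoproducts.desc f g) a = case a (clo f) (clo g) :=
  (ap_fun' (case (var .z) (clo f) (clo g)) a).trans (by simp)

/-- The commuting conversion of `case` with application: the `η`-rule for sums applied to the
function sending `s` to `app (case s f g) a`, whose values at the two injections `β`-reduce. -/
theorem app_case {A B C D : Ty M} (s : Q Γ (.sum A B)) (f : Q Γ (.fn A (.fn C D)))
    (g : Q Γ (.fn B (.fn C D))) (a : Q Γ C) :
    app (case s f g) a = case s (lam (app (app f.wk (var .z)) a.wk))
      (lam (app (app g.wk (var .z)) a.wk)) := by
  have h := sum_eta (lam (app (case (var .z) f.wk g.wk) a.wk)) s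
  have h₁ : ∀ {E F : Ty M} (t : Q Γ E) (b : Q (F :: Γ) (.sum A B)),
      (t.wk.sub (ext (fun _ x => var (.s x)) (.sum A B))).sub (one b) = t.wk := by
    intro E F t b
    rw [wk_sub_ext, wk_sub_one, sub_s]
  simpa only [wk_lam, fn_beta, sub_app, sub_case, sub_var, one_z, wk_sub_one, h₁, ext_z, inl_beta,
    inr_beta] using h

/-- Because `caseHom` curries the context away, it unfolds to a `case` with values in functions of
the context, applied to `a`. `app_case` moves `a` into the branches. -/
theorem ap_caseHom {A B Y : Ty M} (b : X ⟶ (Ty.sum A B : Cl M)) (f : X ⟶ (Ty.fn A Y : Cl M))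
    (g : X ⟶ (Ty.fn B Y : Cl M)) (a : Q Γ X) :
    ap (caseHom (Y₁ := (A : Cl M)) (Y₂ := (B : Cl M)) (Z := (Y : Cl M)) b f g) a =
      case (ap b a) (ap f a) (ap g a) := by
  -- Each branch obtained in this way is an `η`-expansion of `ap k a`.
  have key : ∀ {C : Ty M} (k : X ⟶ (Ty.fn C Y : Cl M)),
      (lam (app (app (Q.wk (clo (MonoidalClosed.curry
        (uncurryHom (Y := (C : Cl M)) (Z := (Y : Cl M)) k)) : Q Γ (.fn C (.fn X Y))))
          (var .z)) a.wk) : Q Γ (.fn C Y)) = ap k a := by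
    intro C k
    refine Eq.trans ?_ (fn_eta (ap k a))
    refine (congrArg (fun t => lam (app t a.wk))
      ((congrArg (app · (var .z)) (clo_wk _)).trans (ap_curry _ _))).trans ?_
    refine congrArg lam ((fn_beta _ _).trans ?_)
    refine (sub_ap _ _ _).trans ((ap_uncurryHom _ _).trans ?_)
    rw [sub_pair, sub_var, wk_var, sub_var]
    refine (congrArg₂ (fun s t => app (ap k s) t) (fst_beta _ _) (snd_beta _ _)).trans ?_
    exact congrArg (app · (var .z)) (wk_ap k a).symm
  refine (ap_comp _ _ _).trans ((ap_uncurry _ _).trans ?_)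
  rw [ap_lift_hom, ap_id, fst_beta]
  refine (congrArg (fun t => app (ap _ t) a) (snd_beta _ _)).trans ?_
  refine (congrArg (app · a) (ap_desc _ _ _)).trans ((app_case _ _ _ _).trans ?_)
  exact congrArg₂ (case _) (key f) (key g)

theorem ap_str (m : M) (b : Q Γ (.prod X (.gr m A))) :
    ap ((endo m).str X A) b =
      app (lift m (lam (pair (Q.fst b.wk) (var .z)))) (Q.snd b) := by
  simp [endo, ap_fun']

/-- The strength is itself a `lift`, so strength followed by functorial action is a composite of two
lifts. `lift_lift` fuses them, and the fused function is an `η`-expansion of `ap f a`. -/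
theorem ap_liftHom {A Y : Ty M} (m : M) (f : X ⟶ (Ty.fn A Y : Cl M)) (a : Q Γ X) :
    ap (liftHom (generic M) m (Y := (A : Cl M)) (Z := (Y : Cl M)) f) a = lift m (ap f a) := by
  refine (ap_curryHom ((endo m).str X A ≫ (endo m).map (uncurryHom f)) a).trans ?_
  refine Eq.trans ?_ (fn_eta (lift m (ap f a)))
  refine congrArg lam ((ap_comp _ _ _).trans ((ap_lift _ _).trans ?_))
  refine (congrArg (app _) (ap_str m _)).trans ((lift_lift _ _ _ _).trans ?_)
  refine congrArg₂ app ?_ (snd_beta _ _)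
  rw [wk_lift]
  refine congrArg (lift m) ?_
  refine Eq.trans ?_ (fn_eta (ap f a).wk)
  refine congrArg lam ?_
  simp [sub_ap]
  refine (ap_uncurryHom _ _).trans ?_
  rw [wk_ap, wk_ap]
  refine congrArg₂ app ?_ (snd_beta _ _)
  refine congrArg (ap f) ((fst_beta _ _).trans ?_)
  refine (congrArg Q.fst ?_).trans (fst_beta (a.wk.wk : Q (_ :: _ :: Γ) X) (var (.s .z)))
  exact (congrArg (Q.sub (one (var .z))) (wk_sub_ext _ _)).trans
    ((wk_sub_one _ _).trans ((sub_s _).trans (wk_pair _ _)))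

/-- The object of the classifying category given by a context. -/
abbrev ctx (Γ : Ctx M) : Cl M := ctxObj (fun A : Ty M => (A : Cl M)) Γ

/-- The components of a tuple of terms. -/
def proj : ∀ {Γ : Ctx M}, Q Δ (ctx Γ) → ∀ ⦃A : Ty M⦄, Var Γ A → Q Δ A
  | _ :: _, t, _, .z => Q.snd t
  | _ :: _, t, _, .s x => proj (Q.fst t) x

/-- The tuple of the variables of a context. -/
def tuple : ∀ Γ : Ctx M, Q Γ (ctx Γ)
  | [] => unit
  | _ :: Γ => pair (tuple Γ).wk (var .z)

/-- A term in a context, as a morphism of the classifying category. -/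
noncomputable def homOf {A : Ty M} (a : Q Γ A) : ctx Γ ⟶ (A : Cl M) := fun' (a.sub (proj (var .z)))

theorem sub_proj {Θ : Ctx M} (σ : ∀ ⦃A : Ty M⦄, Var Δ A → Q Θ A) : ∀ {Γ : Ctx M} (t : Q Δ (ctx Γ))
    ⦃A : Ty M⦄ (x : Var Γ A), (proj t x).sub σ = proj (t.sub σ) x
  | _ :: _, t, _, .z => sub_snd σ t
  | _ :: _, t, _, .s x =>
    (sub_proj σ (Q.fst t) x).trans (congrArg (fun t => proj t x) (sub_fst σ t))

theorem proj_tuple : ∀ {Γ : Ctx M} ⦃A : Ty M⦄ (x : Var Γ A), proj (tuple Γ) x = var x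
  | _ :: _, _, .z => snd_beta _ _
  | _ :: Γ, _, .s x => by
    refine (congrArg (fun t => proj t x) (fst_beta _ _)).trans ?_
    rw [wk_eq_sub, ← sub_proj, proj_tuple x, sub_var]

theorem ap_homOf {A : Ty M} (a : Q Γ A) (t : Q Δ (ctx Γ)) : ap (homOf a) t = a.sub (proj t) := by
  rw [homOf, ap_fun', Q.sub_sub]
  congr 1
  funext B x
  rw [sub_proj, sub_var, only_z]

theorem ap_homOf_tuple {A : Ty M} (a : Q Γ A) : ap (homOf a) (tuple Γ) = a := by
  have h : (proj (tuple Γ) : ∀ ⦃A : Ty M⦄, Var Γ A → Q Γ A) = fun _ x => var x := by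
    funext B x; exact proj_tuple x
  rw [ap_homOf, h, sub_id]

/-- Evaluation at the tuple of variables is a left inverse. Faithfulness of the generic model comes
from here. -/
theorem homOf_injective {A : Ty M} : Function.Injective (homOf : Q Γ A → _) := fun a b h => by
  rw [← ap_homOf_tuple a, h, ap_homOf_tuple]

theorem ap_varHom : ∀ {Γ : Ctx M} {A : Ty M} (x : Var Γ A) {Δ : Ctx M} (t : Q Δ (ctx Γ)),
    ap (varHom (fun A : Ty M => (A : Cl M)) x) t = proj t x
  | _ :: _, _, .z, _, t => ap_snd t
  | _ :: _, _, .s x, _, t =>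
    (ap_comp _ _ _).trans ((ap_varHom x _).trans (congrArg (fun t => proj t x) (ap_fst t)))

theorem varHom_eq {A : Ty M} (x : Var Γ A) :
    varHom (fun A : Ty M => (A : Cl M)) x = homOf (var x) :=
  ext' (by rw [ap_varHom, ap_homOf, sub_var])

end Cl

end Generic

/-! ### The generic model interprets each term by its class -/

section Generic

variable {M : Type u} [Monoid M] [Preorder M]

/-- The interpretation of types by themselves and of terms by their classes. -/
noncomputable def syntacticInterp (M : Type u) [Monoid M] [Preorder M] : Interp M (Cl M) where
  ty A := A
  tm a := Cl.homOf (Q.mk a)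

namespace Cl

open Q

variable {Γ : Ctx M} {A B C : Ty M}

/-- The only variable of the one-variable context formed from the product of a context. -/
abbrev pvar (Γ : Ctx M) : Q [ctx Γ] (ctx Γ) := var .z

theorem homOf_eq {a : Q Γ A} {f : ctx Γ ⟶ (A : Cl M)}
    (h : ap f (pvar Γ) = a.sub (proj (pvar Γ))) : homOf a = f :=
  ext' ((ap_homOf _ _).trans h.symm)

theorem ap_homOf_pvar (a : Q Γ A) : ap (homOf a) (pvar Γ) = a.sub (proj (pvar Γ)) := ap_homOf _ _

/-- Serves the term formers that are interpreted by postcomposition with a fixed morphism `φ`. -/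
theorem homOf_eq_comp {a : Q Γ A} {b : Q Γ B} {φ : (A : Cl M) ⟶ (B : Cl M)}
    (h : ap φ (a.sub (proj (pvar Γ))) = b.sub (proj (pvar Γ))) : homOf b = homOf a ≫ φ :=
  homOf_eq ((ap_comp _ _ _).trans ((congrArg (ap φ) (ap_homOf_pvar a)).trans h))

/-- The point is that the components of the tuple extended by a fresh variable are the extension
under the binder of the substitution by projections. -/
theorem homOf_lam (b : Q (A :: Γ) B) :
    homOf (lam b) = curryHom (X := ctx Γ) (Y := (A : Cl M)) (Z := (B : Cl M)) (homOf b) := by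
  refine homOf_eq ((ap_curryHom _ _).trans ?_)
  rw [sub_lam]
  refine congrArg lam ((ap_homOf _ _).trans (congrArg (fun σ => Q.sub σ b) ?_))
  funext C x
  cases x with
  | z => exact snd_beta _ _
  | s x =>
    refine (congrArg (fun t => proj t x) (fst_beta _ _)).trans ?_
    rw [ext_s, wk_eq_sub, wk_eq_sub, sub_proj]

theorem homOf_app (f : Q Γ (.fn A B)) (a : Q Γ A) :
    homOf (app f a) = appHom (Y := (A : Cl M)) (Z := (B : Cl M)) (homOf f) (homOf a) := by
  refine homOf_eq ((ap_appHom _ _ _).trans ?_)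
  rw [sub_app]
  exact congrArg₂ app (ap_homOf_pvar f) (ap_homOf_pvar a)

theorem homOf_pair (a : Q Γ A) (b : Q Γ B) :
    homOf (pair a b) = CartesianMonoidalCategory.lift (homOf a) (homOf b) := by
  refine homOf_eq ((ap_lift_hom _ _ _).trans ?_)
  rw [sub_pair, ap_homOf_pvar, ap_homOf_pvar]

theorem homOf_case (a : Q Γ (.sum A B)) (f : Q Γ (.fn A C)) (g : Q Γ (.fn B C)) :
    homOf (case a f g) = caseHom (Y₁ := (A : Cl M)) (Y₂ := (B : Cl M)) (Z := (C : Cl M))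
      (homOf a) (homOf f) (homOf g) := by
  refine homOf_eq ((ap_caseHom _ _ _ _).trans ?_)
  rw [sub_case, ap_homOf_pvar]
  exact congrArg₂ (case _) (ap_homOf_pvar f) (ap_homOf_pvar g)

theorem homOf_lift (m : M) (f : Q Γ (.fn A B)) :
    homOf (lift m f) =
      liftHom (generic M) m (Y := (A : Cl M)) (Z := (B : Cl M)) (homOf f) := by
  refine homOf_eq ((ap_liftHom _ _ _).trans ?_)
  rw [sub_lift]
  exact congrArg (lift m) (ap_homOf_pvar f)

theorem ap_inl (a : Q Γ A) :
    ap (ChosenFiniteCoproducts.inl (A : Cl M) (B : Cl M)) a = inl a :=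
  (ap_fun' (inl (var .z)) a).trans (by simp)

theorem ap_inr (a : Q Γ B) :
    ap (ChosenFiniteCoproducts.inr (A : Cl M) (B : Cl M)) a = inr a :=
  (ap_fun' (inr (var .z)) a).trans (by simp)

theorem ap_fromInitial (a : Q Γ .void) :
    ap (ChosenFiniteCoproducts.fromInitial (A : Cl M)) a = abort a :=
  (ap_fun' (abort (var .z)) a).trans (by simp)

theorem ap_upHom {m₁ m₂ : M} (h : m₁ ≤ m₂) (a : Q Γ (.gr m₁ A)) :
    ap (upHom (generic M) h (A : Cl M)) a = up h a :=
  (ap_fun' (up h (var .z)) a).trans (by simp)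

section Monoidal

variable [MulLeftMono M] [MulRightMono M]

theorem ap_retHom (a : Q Γ A) : ap (retHom (generic M) (A : Cl M)) a = ret a :=
  (ap_fun' (ret (var .z)) a).trans (by simp)

theorem ap_extrHom (a : Q Γ (.gr 1 A)) : ap (extrHom (generic M) (A : Cl M)) a = extr a :=
  (ap_fun' (extr (var .z)) a).trans (by simp)

theorem ap_joinHom (m₁ m₂ : M) (a : Q Γ (.gr m₁ (.gr m₂ A))) :
    ap (joinHom (generic M) m₁ m₂ (A : Cl M)) a = join rfl a :=
  (ap_fun' (join rfl (var .z)) a).trans (by simp)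

theorem ap_forkHom (m₁ m₂ : M) (a : Q Γ (.gr (m₁ * m₂) A)) :
    ap (forkHom (generic M) m₁ m₂ (A : Cl M)) a = fork rfl a :=
  (ap_fun' (fork rfl (var .z)) a).trans (by simp)

theorem ap_joinIn {m₁ m₂ n : M} (e : m₁ * m₂ = n) (a : Q Γ (.gr m₁ (.gr m₂ A))) :
    ap (joinIn (generic M) e (A : Cl M)) a = join e a := by
  subst e; rw [joinIn_rfl]; exact ap_joinHom _ _ a

theorem ap_forkIn {m₁ m₂ n : M} (e : m₁ * m₂ = n) (a : Q Γ (.gr n A)) :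
    ap (forkIn (generic M) e (A : Cl M)) a = fork e a := by
  subst e; rw [forkIn_rfl]; exact ap_forkHom _ _ a

end Monoidal

/-! Congruence of the categorical operations along equalities of objects. -/

section HEq

variable {X X' Y Y' Z Z' V V' : Cl M}

/-- Two object parameters suffice for all the term formers interpreted by postcomposition; those
depending on a single type take `Ty.unit` as an idle second one. -/
theorem heq_comp (F G : Cl M → Cl M → Cl M) (φ : ∀ Y Z, F Y Z ⟶ G Y Z) (hX : X = X') (hY : Y = Y')
    (hZ : Z = Z') {f : X ⟶ F Y Z} {f' : X' ⟶ F Y' Z'} (hf : HEq f f') :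
    HEq (f ≫ φ Y Z) (f' ≫ φ Y' Z') := by
  subst hX hY hZ hf; rfl

theorem heq_curryHom (hX : X = X') (hY : Y = Y') (hZ : Z = Z') {f : X ⊗ Y ⟶ Z} {f' : X' ⊗ Y' ⟶ Z'}
    (hf : HEq f f') : HEq (curryHom f) (curryHom f') := by
  subst hX hY hZ hf; rfl

theorem heq_appHom (hX : X = X') (hY : Y = Y') (hZ : Z = Z') {f : X ⟶ (ihom Y).obj Z}
    {f' : X' ⟶ (ihom Y').obj Z'} (hf : HEq f f') {a : X ⟶ Y} {a' : X' ⟶ Y'} (ha : HEq a a') :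
    HEq (appHom f a) (appHom f' a') := by
  subst hX hY hZ hf ha; rfl

theorem heq_lift (hX : X = X') (hY : Y = Y') (hZ : Z = Z') {f : X ⟶ Y} {f' : X' ⟶ Y'}
    (hf : HEq f f') {g : X ⟶ Z} {g' : X' ⟶ Z'} (hg : HEq g g') :
    HEq (CartesianMonoidalCategory.lift f g) (CartesianMonoidalCategory.lift f' g') := by
  subst hX hY hZ hf hg; rfl

theorem heq_toUnit (hX : X = X') : HEq (toUnit X) (toUnit X') := by subst hX; rfl

theorem heq_caseHom (hX : X = X') (hY : Y = Y') (hZ : Z = Z') (hV : V = V')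
    {a : X ⟶ ChosenFiniteCoproducts.coprod Y Z} {a' : X' ⟶ ChosenFiniteCoproducts.coprod Y' Z'}
    (ha : HEq a a') {f : X ⟶ (ihom Y).obj V} {f' : X' ⟶ (ihom Y').obj V'} (hf : HEq f f')
    {g : X ⟶ (ihom Z).obj V} {g' : X' ⟶ (ihom Z').obj V'} (hg : HEq g g') :
    HEq (caseHom a f g) (caseHom a' f' g') := by
  subst hX hY hZ hV ha hf hg; rfl

theorem heq_liftHom (m : M) (hX : X = X') (hY : Y = Y') (hZ : Z = Z') {f : X ⟶ (ihom Y).obj Z}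
    {f' : X' ⟶ (ihom Y').obj Z'} (hf : HEq f f') :
    HEq (liftHom (generic M) m f) (liftHom (generic M) m f') := by
  subst hX hY hZ hf; rfl

end HEq

/-- For a variable type this holds by induction and not by unfolding, which is why interpretations
of terms are compared by heterogeneous equality. -/
theorem interpTy_generic (A : Ty M) : interpTy (generic M) A = A := by
  induction A with
  | unit => rfl
  | void => rfl
  | fn A B ih ih' => exact congrArg₂ Ty.fn ih ih'
  | prod A B ih ih' => exact congrArg₂ Ty.prod ih ih'
  | sum A B ih ih' => exact congrArg₂ Ty.sum ih ih'
  | gr m A ih => exact congrArg (Ty.gr m) ih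

theorem interpTy_generic_eq : interpTy (generic M) = fun A => A := funext interpTy_generic

theorem ctxObj_generic (Γ : Ctx M) : ctxObj (interpTy (generic M)) Γ = ctx Γ := by
  rw [interpTy_generic_eq]

variable [MulLeftMono M] [MulRightMono M]

/-- In each inductive case the congruence lemma replaces the objects and the subterms; what remains
is that `homOf` commutes with the term former. -/
theorem interpTm_generic {Γ : Ctx M} {A : Ty M} (a : Tm Γ A) :
    HEq (interpTm (generic M) a) (homOf (mk a)) := by
  have hC := ctxObj_generic (M := M)
  have hT := interpTy_generic (M := M)
  induction a with
  | var x =>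
    have h : ∀ ty ty' : Ty M → Cl M, ty = ty' → HEq (varHom ty x) (varHom ty' x) := by
      rintro _ _ rfl; rfl
    exact (h _ _ interpTy_generic_eq).trans (heq_of_eq (varHom_eq x))
  | lam b ih =>
    exact (heq_curryHom (hC _) (hT _) (hT _) ih).trans (heq_of_eq (homOf_lam _).symm)
  | app f a ih ih' =>
    exact (heq_appHom (hC _) (hT _) (hT _) ih ih').trans (heq_of_eq (homOf_app _ _).symm)
  | pair a b ih ih' =>
    exact (heq_lift (hC _) (hT _) (hT _) ih ih').trans (heq_of_eq (homOf_pair _ _).symm)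
  | fst a ih =>
    exact (heq_comp _ _ CartesianMonoidalCategory.fst (hC _) (hT _) (hT _) ih).trans
      (heq_of_eq (homOf_eq_comp ((ap_fst _).trans (sub_fst _ (mk a)).symm)).symm)
  | snd a ih =>
    exact (heq_comp _ _ CartesianMonoidalCategory.snd (hC _) (hT _) (hT _) ih).trans
      (heq_of_eq (homOf_eq_comp ((ap_snd _).trans (sub_snd _ (mk a)).symm)).symm)
  | unit => exact (heq_toUnit (hC _)).trans (heq_of_eq (toUnit_unique _ _))
  | inl a ih =>
    exact (heq_comp _ _ ChosenFiniteCoproducts.inl (hC _) (hT _) (hT _) ih).trans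
      (heq_of_eq (homOf_eq_comp ((ap_inl _).trans (sub_inl _ (mk a)).symm)).symm)
  | inr a ih =>
    exact (heq_comp _ _ (fun Y Z => ChosenFiniteCoproducts.inr Z Y) (hC _) (hT _) (hT _) ih).trans
      (heq_of_eq (homOf_eq_comp ((ap_inr _).trans (sub_inr _ (mk a)).symm)).symm)
  | case a f g ih ih' ih'' =>
    exact (heq_caseHom (hC _) (hT _) (hT _) (hT _) ih ih' ih'').trans
      (heq_of_eq (homOf_case _ _ _).symm)
  | abort a ih =>
    exact (heq_comp _ _ (fun Y _ => ChosenFiniteCoproducts.fromInitial Y) (hC _) (hT _)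
      (rfl : Ty.unit = Ty.unit) ih).trans
      (heq_of_eq (homOf_eq_comp ((ap_fromInitial _).trans (sub_abort _ (mk a)).symm)).symm)
  | ret a ih =>
    exact (heq_comp _ _ (fun Y _ => retHom (generic M) Y) (hC _) (hT _)
      (rfl : Ty.unit = Ty.unit) ih).trans
      (heq_of_eq (homOf_eq_comp ((ap_retHom _).trans (sub_ret _ (mk a)).symm)).symm)
  | extr a ih =>
    exact (heq_comp _ _ (fun Y _ => extrHom (generic M) Y) (hC _) (hT _)
      (rfl : Ty.unit = Ty.unit) ih).trans
      (heq_of_eq (homOf_eq_comp ((ap_extrHom _).trans (sub_extr _ (mk a)).symm)).symm)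
  | lift m f ih =>
    exact (heq_liftHom m (hC _) (hT _) (hT _) ih).trans (heq_of_eq (homOf_lift m _).symm)
  | join e a ih =>
    exact (heq_comp _ _ (fun Y _ => joinIn (generic M) e Y) (hC _) (hT _)
      (rfl : Ty.unit = Ty.unit) ih).trans
      (heq_of_eq (homOf_eq_comp ((ap_joinIn e _).trans (sub_join _ e (mk a)).symm)).symm)
  | fork e a ih =>
    exact (heq_comp _ _ (fun Y _ => forkIn (generic M) e Y) (hC _) (hT _)
      (rfl : Ty.unit = Ty.unit) ih).trans
      (heq_of_eq (homOf_eq_comp ((ap_forkIn e _).trans (sub_fork _ e (mk a)).symm)).symm)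
  | up h a ih =>
    exact (heq_comp _ _ (fun Y _ => upHom (generic M) h Y) (hC _) (hT _)
      (rfl : Ty.unit = Ty.unit) ih).trans
      (heq_of_eq (homOf_eq_comp ((ap_upHom h _).trans (sub_up _ h (mk a)).symm)).symm)

end Cl

theorem interp_generic_eq_iff [MulLeftMono M] [MulRightMono M] {Γ : Ctx M} {A : Ty M}
    (a b : Tm Γ A) :
    (interp (generic M)).tm a = (interp (generic M)).tm b ↔ Eqv a b := by
  refine ⟨fun h => Q.mk_eq.1 (Cl.homOf_injective (eq_of_heq ?_)), interpTm_eq_of_eqv _⟩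
  exact (Cl.interpTm_generic a).symm.trans ((heq_of_eq h).trans (Cl.interpTm_generic b))

theorem Interp.ext_of_heq {D : Type v} [Category.{w} D] [CartesianMonoidalCategory D]
    {I J : Interp M D} (h : I.ty = J.ty)
    (h' : ∀ {Γ : Ctx M} {A : Ty M} (a : Tm Γ A), HEq (I.tm a) (J.tm a)) : I = J := by
  obtain ⟨ty, tm⟩ := I
  obtain ⟨ty', tm'⟩ := J
  cases h
  congr
  funext Γ A a
  exact eq_of_heq (h' a)

theorem interp_generic [MulLeftMono M] [MulRightMono M] :
    interp (generic M) = syntacticInterp M :=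
  Interp.ext_of_heq Cl.interpTy_generic_eq Cl.interpTm_generic

end Generic

theorem comp_comp_comp_of_comp_eq_id {C : Type v} [Category.{w} C] {X Y Z W : C} {p : X ⟶ Y}
    {q : Y ⟶ X} (h : p ≫ q = 𝟙 X) (f : X ⟶ Z) (g : Z ⟶ W) : p ≫ (q ≫ f) ≫ g = f ≫ g := by
  rw [Category.assoc, reassoc_of% h]

/-! ### One-variable contexts and transport along product-preserving functors -/

section Point

variable {M : Type u} {D : Type v} [Category.{w} D] [CartesianMonoidalCategory D]
  (ty : Ty M → D)

/-- The canonical morphism from an object to the interpretation of a one-variable context. -/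
def point (A : Ty M) : ty A ⟶ ctxObj ty [A] := lift (toUnit (ty A)) (𝟙 (ty A))

theorem point_varHom (A : Ty M) : point ty A ≫ varHom ty (Var.z : Var [A] A) = 𝟙 _ := lift_snd _ _

end Point

section Push

variable {M : Type u} {C : Type v'} [Category.{w'} C] [CartesianMonoidalCategory C]
  {D : Type v} [Category.{w} D] [CartesianMonoidalCategory D]
  (F : C ⥤ D) [PreservesFiniteProducts F]

/-- The canonical isomorphism is used below through its effect on projections, which is the form
required by the substitution lemma. -/
theorem ctxIso_hom_varHom (ty : Ty M → C) : ∀ {Γ : Ctx M} {A : Ty M} (x : Var Γ A),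
    (ctxIso F ty Γ).hom ≫ varHom (fun A => F.obj (ty A)) x = F.map (varHom ty x)
  | _ :: Γ, A, .z => by
    have h : ((prodComparisonIso F (ctxObj ty Γ) (ty A)).hom ≫
        (ctxIso F ty Γ).hom ▷ F.obj (ty A)) ≫ snd _ _ = F.map (snd _ _) := by
      rw [Category.assoc, whiskerRight_snd, prodComparisonIso_hom, CartesianMonoidalCategory.prodComparison_snd]
    exact h
  | B :: Γ, A, .s x => by
    have h : ((prodComparisonIso F (ctxObj ty Γ) (ty B)).hom ≫
        (ctxIso F ty Γ).hom ▷ F.obj (ty B)) ≫ fst _ _ ≫ varHom (fun A => F.obj (ty A)) x =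
          F.map (fst _ _ ≫ varHom ty x) := by
      rw [Category.assoc, whiskerRight_fst_assoc, ctxIso_hom_varHom ty x, prodComparisonIso_hom,
        CartesianMonoidalCategory.prodComparison_fst_assoc, F.map_comp]
    exact h

end Push

/-! ### The classifying functor of a model and its uniqueness -/

section Classify

variable {M : Type u} [Monoid M] [Preorder M] [MulLeftMono M] [MulRightMono M]
  {D : Type v} [Category.{w} D] [CartesianMonoidalCategory D] [MonoidalClosed D]
  [ChosenFiniteCoproducts D] (S : M ⥤ StrongEndo D) [S.Monoidal]

/-- Interpretation of classes of terms. -/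
def interpQ {Γ : Ctx M} {A : Ty M} : Q Γ A → (ctxObj (interpTy S) Γ ⟶ interpTy S A) :=
  Quotient.lift (interpTm S) fun _ _ h => interpTm_eq_of_eqv S h

theorem interpQ_fst {Γ : Ctx M} {A B : Ty M} (a : Q Γ (.prod A B)) :
    interpQ S a.fst = interpQ S a ≫ fst (interpTy S A) (interpTy S B) := by
  induction a using Q.ind; rfl

theorem interpQ_snd {Γ : Ctx M} {A B : Ty M} (a : Q Γ (.prod A B)) :
    interpQ S a.snd = interpQ S a ≫ snd (interpTy S A) (interpTy S B) := by
  induction a using Q.ind; rfl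

theorem interpQ_sub {Γ Δ : Ctx M} {A : Ty M} (a : Q Γ A) (σ : ∀ ⦃A : Ty M⦄, Var Γ A → Q Δ A)
    (h : ctxObj (interpTy S) Δ ⟶ ctxObj (interpTy S) Γ)
    (H : ∀ ⦃B : Ty M⦄ (x : Var Γ B), interpQ S (σ x) = h ≫ varHom (interpTy S) x) :
    interpQ S (a.sub σ) = h ≫ interpQ S a := by
  obtain ⟨τ, rfl⟩ := Q.exists_sub σ
  induction a using Q.ind with
  | h a => rw [Q.sub_mk]; exact interpTm_sub S a τ h H

/-- The morphism interpreting a closed term of function type, applied to its argument. -/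
def actHom {A B : Cl M} (f : A ⟶ B) : interpTy S A ⟶ interpTy S B :=
  point (interpTy S) A ≫ interpQ S (Cl.ap f (Q.var .z : Q [A] A))

/-- `ap f t` is the substitution of `t` for the variable in `ap f (var .z)`, so the substitution
lemma makes it a composite. Functoriality of `classify` follows from this and `Cl.ap_comp`. -/
theorem interpQ_ap {Γ : Ctx M} {A B : Cl M} (f : A ⟶ B) (t : Q Γ A) :
    interpQ S (Cl.ap f t) = interpQ S t ≫ actHom S f := by
  have h₁ : Cl.ap f t = (Cl.ap f (Q.var .z : Q [A] A)).sub (Q.only t) := by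
    rw [Cl.sub_ap, Q.sub_var, Q.only_z]
  rw [h₁, actHom, ← Category.assoc]
  refine interpQ_sub S _ _ _ fun B x => ?_
  cases x with
  | z =>
    exact ((Category.assoc _ _ _).trans ((congrArg (interpQ S t ≫ ·) (point_varHom _ A)).trans
      (Category.comp_id _))).symm
  | s x => exact nomatch x

/-- The functor out of the classifying category induced by a model. -/
def classify : Cl M ⥤ D where
  obj A := interpTy S A
  map f := actHom S f
  map_id A := by
    rw [actHom, Cl.ap_id]
    exact point_varHom _ A
  map_comp f g := by
    rw [actHom, Cl.ap_comp, interpQ_ap, ← Category.assoc, ← actHom]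

theorem classify_map_fst (A B : Cl M) :
    (classify S).map (fst A B) = fst ((classify S).obj A) ((classify S).obj B) := by
  have h := congrArg (interpQ S) (Cl.ap_fst (Q.var .z : Q [Ty.prod A B] (Ty.prod A B)))
  refine (congrArg (point (interpTy S) (Ty.prod A B) ≫ ·) (h.trans (interpQ_fst S _))).trans ?_
  exact (Category.assoc _ _ _).symm.trans
    ((congrArg (· ≫ fst (interpTy S A) (interpTy S B)) (point_varHom _ (Ty.prod A B))).trans
      (Category.id_comp _))

theorem classify_map_snd (A B : Cl M) :
    (classify S).map (snd A B) = snd ((classify S).obj A) ((classify S).obj B) := by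
  have h := congrArg (interpQ S) (Cl.ap_snd (Q.var .z : Q [Ty.prod A B] (Ty.prod A B)))
  refine (congrArg (point (interpTy S) (Ty.prod A B) ≫ ·) (h.trans (interpQ_snd S _))).trans ?_
  exact (Category.assoc _ _ _).symm.trans
    ((congrArg (· ≫ snd (interpTy S A) (interpTy S B)) (point_varHom _ (Ty.prod A B))).trans
      (Category.id_comp _))

instance : PreservesFiniteProducts (classify S) := by
  have h (A B : Cl M) : IsIso (CartesianMonoidalCategory.prodComparison (classify S) A B) := by
    -- On objects the functor takes products to products by definition, and it preserves the
    -- projections, so the comparison is an identity.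
    have h' : CartesianMonoidalCategory.prodComparison (classify S) A B =
        𝟙 ((classify S).obj A ⊗ (classify S).obj B : D) := by
      rw [CartesianMonoidalCategory.prodComparison, classify_map_fst, classify_map_snd]
      exact lift_fst_snd
    rw [h']
    exact inferInstanceAs (IsIso (𝟙 _))
  have h₀ : IsIso (CartesianMonoidalCategory.terminalComparison (classify S)) := by
    have h' : CartesianMonoidalCategory.terminalComparison (classify S) = 𝟙 (𝟙_ D) := toUnit_unique _ _
    rw [h']
    exact inferInstanceAs (IsIso (𝟙 _))
  have := preservesLimitsOfShape_discrete_walkingPair_of_isIso_prodComparison (classify S)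
  have := preservesLimit_empty_of_isIso_terminalComparison (classify S)
  have := Limits.preservesLimitsOfShape_pempty_of_preservesTerminal (classify S)
  exact .of_preserves_binary_and_terminal _

/-- `homOf a` is `a` with projections substituted for its variables. The functor carries these
projections to those of the target, up to the canonical isomorphism, so the substitution lemma
applies. -/
theorem classify_map_homOf {Γ : Ctx M} {A : Ty M} (a : Q Γ A) :
    (classify S).map (Cl.homOf a) =
      (ctxIso (classify S) (fun A : Ty M => (A : Cl M)) Γ).hom ≫ interpQ S a := by
  have h : interpQ S (Cl.ap (Cl.homOf a) (Cl.pvar Γ)) = _ :=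
    (congrArg (interpQ S) (Cl.ap_homOf_pvar a)).trans (interpQ_sub S a (Cl.proj (Cl.pvar Γ))
      (interpQ S (Cl.pvar Γ) ≫ (ctxIso (classify S) (fun A : Ty M => (A : Cl M)) Γ).hom)
      fun B x => by
        -- A component of the tuple is `ap` of a projection morphism, so its interpretation is the
        -- image of that projection under the functor.
        rw [← Cl.ap_varHom, interpQ_ap]
        refine Eq.trans ?_ (Category.assoc _ _ _).symm
        exact congrArg (interpQ S (Cl.pvar Γ) ≫ ·)
          (ctxIso_hom_varHom (classify S) (fun A : Ty M => (A : Cl M)) x).symm)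
  refine (congrArg (point (interpTy S) (Cl.ctx Γ) ≫ ·) h).trans ?_
  exact comp_comp_comp_of_comp_eq_id (point_varHom (interpTy S) (Cl.ctx Γ)) _ _

theorem push_classify : (interp (generic M)).push (classify S) = interp S := by
  rw [interp_generic]
  refine Interp.ext_of_heq rfl fun {Γ A} a => heq_of_eq ?_
  exact (Iso.inv_comp_eq _).2 (classify_map_homOf S (Q.mk a))

/-- The morphism interpreting a term with one variable. -/
def Interp.act (I : Interp M D) {A B : Ty M} (b : Tm [A] B) : I.ty A ⟶ I.ty B :=
  point I.ty A ≫ I.tm b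

/-- Recovers `F` on morphisms from the transported interpretation: `f` is applied to the variable of
a one-variable context, and `point` removes the terminal factor of that context. A representative is
chosen because interpretations are defined on terms and not on classes. -/
theorem act_push (F : Cl M ⥤ D) [PreservesFiniteProducts F] {A B : Cl M} (f : A ⟶ B) :
    ((syntacticInterp M).push F).act (Cl.ap f (Q.var .z : Q [A] A)).out = F.map f := by
  have h : Cl.homOf (Cl.ap f (Q.var .z : Q [A] A)) =
      varHom (fun A : Ty M => (A : Cl M)) (Var.z : Var [A] A) ≫ f :=
    (Cl.homOf_eq_comp (Cl.sub_ap _ _ _).symm).trans (congrArg (· ≫ f) (Cl.varHom_eq Var.z).symm)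
  have h' : (ctxIso F (fun A : Ty M => (A : Cl M)) [A]).inv ≫
      F.map (Cl.homOf (Cl.ap f (Q.var .z : Q [A] A))) =
        varHom (fun A : Ty M => F.obj A) (Var.z : Var [A] A) ≫ F.map f := by
    rw [h, F.map_comp, ← ctxIso_hom_varHom, Category.assoc, Iso.inv_hom_id_assoc]
  have h'' : ((syntacticInterp M).push F).tm (Cl.ap f (Q.var .z : Q [A] A)).out =
      varHom (fun A : Ty M => F.obj A) (Var.z : Var [A] A) ≫ F.map f :=
    (congrArg (fun b => (ctxIso F (fun A : Ty M => (A : Cl M)) [A]).inv ≫ F.map (Cl.homOf b))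
      (Q.mk_out _)).trans h'
  refine (congrArg (point (fun A : Ty M => F.obj A) A ≫ ·) h'').trans ?_
  refine (Category.assoc _ _ _).symm.trans ?_
  exact (congrArg (· ≫ F.map f) (point_varHom (fun A : Ty M => F.obj A) A)).trans
    (Category.id_comp _)

/-- Types give equality on objects. The morphisms then have only propositionally equal sources and
targets, so they are compared by heterogeneous equality, using `act_push` for both functors. -/
theorem functor_ext_of_push {F G : Cl M ⥤ D} [PreservesFiniteProducts F] [PreservesFiniteProducts G]
    (h : (interp (generic M)).push F = (interp (generic M)).push G) : F = G := by
  rw [interp_generic] at h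
  have h' : ∀ {I J : Interp M D}, I = J → ∀ {A B : Ty M} (b : Tm [A] B),
      HEq (I.act b) (J.act b) := by
    rintro I _ rfl A B b; rfl
  refine Functor.hext (congrFun (congrArg Interp.ty h)) fun A B f => ?_
  exact (heq_of_eq (act_push F f).symm).trans ((h' h _).trans (heq_of_eq (act_push G f)))

end Classify

end GMCC

theorem mainTheorem2 (M : Type u) [Monoid M] [Preorder M] [MulLeftMono M]
    [MulRightMono M] :
    -- completeness: terms identified in every model are provably equal
    (∀ (Γ : GMCC.Ctx M) (A : GMCC.Ty M) (a b : GMCC.Tm Γ A),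
      (∀ (D : Type u) [Category.{u} D] [CartesianMonoidalCategory D] [MonoidalClosed D]
        [GMCC.ChosenFiniteCoproducts D] (S : M ⥤ GMCC.StrongEndo D) [S.Monoidal],
        (GMCC.interp S).tm a = (GMCC.interp S).tm b) →
      GMCC.Eqv a b) ∧
    -- the generic model in the classifying category identifies exactly the provably equal terms
    (∀ (Γ : GMCC.Ctx M) (A : GMCC.Ty M) (a b : GMCC.Tm Γ A),
      (GMCC.interp (GMCC.generic M)).tm a = (GMCC.interp (GMCC.generic M)).tm b ↔
        GMCC.Eqv a b) ∧
    -- finite-product-preserving functors transport models in the classifying category to sound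
    -- interpretations
    (∀ (D : Type v) [Category.{w} D] [CartesianMonoidalCategory D] [MonoidalClosed D]
      [GMCC.ChosenFiniteCoproducts D] (W : M ⥤ GMCC.StrongEndo (GMCC.Cl M)) [W.Monoidal]
      (F : GMCC.Cl M ⥤ D) [PreservesFiniteProducts F] (Γ : GMCC.Ctx M) (A : GMCC.Ty M)
      (a b : GMCC.Tm Γ A), GMCC.Eqv a b →
        ((GMCC.interp W).push F).tm a = ((GMCC.interp W).push F).tm b) ∧
    -- every model is the image of the generic model under a unique finite-product-preserving functor
    (∀ (D : Type v) [Category.{w} D] [CartesianMonoidalCategory D] [MonoidalClosed D]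
      [GMCC.ChosenFiniteCoproducts D] (S : M ⥤ GMCC.StrongEndo D) [S.Monoidal],
      ∃! F : GMCC.Cl M ⥤ D, ∃ _ : PreservesFiniteProducts F,
        (GMCC.interp (GMCC.generic M)).push F = GMCC.interp S) := by
  have hgen := fun (Γ : GMCC.Ctx M) (A : GMCC.Ty M) (a b : GMCC.Tm Γ A) =>
    GMCC.interp_generic_eq_iff a b
  -- Types, and classes of terms, live in `Type u`, so the generic model is among the models
  -- quantified over, and completeness is an instance of part 2.
  refine ⟨fun Γ A a b h => (hgen Γ A a b).1 (h (GMCC.Cl M) (GMCC.generic M)), hgen, ?_, ?_⟩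
  · intro D _ _ _ _ W _ F _ Γ A a b h
    -- Equal terms are already equal in `W`; applying `F` and precomposing with the canonical
    -- isomorphism preserves this equality.
    exact congrArg (fun f => (GMCC.ctxIso F (GMCC.interp W).ty Γ).inv ≫ F.map f)
      (GMCC.interpTm_eq_of_eqv W h)
  · intro D _ _ _ _ S _
    refine ⟨GMCC.classify S, ⟨inferInstance, GMCC.push_classify S⟩, ?_⟩
    rintro F ⟨_, hF⟩
    -- Two functors with the same image of the generic model coincide.
    exact GMCC.functor_ext_of_push (hF.trans (GMCC.push_classify S).symm)
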